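/- Conventions. All vector spaces are real. For a 3-term chain complex $L=(L_0\xleftarrow{d}L_1\xleftarrow{d}L_2)$ and multilinear maps $\mu\colon L^{\otimes n}\to L$ of degree $|\mu|$ (raising degree by $|\mu|$), the Koszul sign rule is used: $$\mu^\sigma(v_1,\dots,v_n)=\varepsilon(\sigma;v)\,\mu(v_{\sigma^{-1}(1)},\dots,v_{\sigma^{-1}(n)}),\qquad (\mu\circ_i\nu)(v_1,\dots)=(-1)^{|\nu|(|v_1|+\dots+|v_{i-1}|)}\mu(v_1,\dots,v_{i-1},\nu(v_i,\dots),\dots),$$ $\partial\mu=d\circ\mu-(-1)^{|\mu|}\sum_i\mu\circ_i d$, and $\mathrm{Sh}^{-1}(p,q)$ is the set of $\sigma\in S_{p+q}$ whose inverse is increasing on $\{1,\dots,p\}$ and on $\{p+1,\dots,p+q\}$. A Leibniz 3-algebra is a 3-term complex $L$ with maps $\lambda_2,\lambda_3,\lambda_4$ of degrees $0,1,2$ (and $\lambda_n=0$ for $n\ge5$) with $\partial\lambda_2=0$ and, for $n=3,4,5$, $$\partial\lambda_n=-\sum_{i+j=n+1,\ i,j\ge2}(-1)^{(j-1)i}\sum_{p=1}^{j}(-1)^{(p-1)(i-1)}\sum_\sigma(-1)^{|\sigma|}(\lambda_j\circ_p\lambda_i)^\sigma,$$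 where $\sigma$ runs over the elements of $\mathrm{Sh}^{-1}(p-1,i)$ (acting on the first $p-1+i$ letters) with $\sigma^{-1}(p-1)<\sigma^{-1}(p+i-1)$ if $p>1$. A Leibniz 2-algebra is the case $L_2=0$. A weak Lie 3-algebra is a Leibniz 3-algebra with further maps $\lambda_{2;1}$ of degree $1$ and $\lambda_{2;1,1},\lambda_{3;1},\lambda_{3;2}$ of degree $2$, of arity given by the first index, such that \begin{align*} \partial\lambda_{2;1}&=\lambda_2+\lambda_2^{(12)},\qquad \partial\lambda_{2;1,1}=\lambda_{2;1}-\lambda_{2;1}^{(12)},\qquad \partial\lambda_{3;1}=\lambda_3+\lambda_3^{(12)}+\lambda_2\circ_1\lambda_{2;1},\\ \partial\lambda_{3;2}&=\lambda_3+\lambda_3^{(23)}-\lambda_2\circ_2\lambda_{2;1}+\lambda_{2;1}\circ_1\lambda_2+(\lambda_{2;1}\circ_2\lambda_2)^{(12)},\\ 0&=\lambda_{2;1,1}+\lambda_{2;1,1}^{(12)},\qquad \lambda_{3;1}-\lambda_{3;1}^{(12)}=\lambda_2\circ_1\lambda_{2;1,1},\\ \lambda_{3;1}&-\lambda_{3;2}^{(12)}+\lambda_{3;1}^{(132)}-\lambda_{3;2}+\lambda_{3;1}^{(23)}-\lambda_{3;2}^{(123)}\\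 &=\lambda_{2;1}\circ_2\lambda_{2;1}+\lambda_{2;1}\circ_1\lambda_{2;1}+(\lambda_{2;1}\circ_2\lambda_{2;1})^{(12)}+(\lambda_{2;1,1}\circ_2\lambda_2)^{(132)},\\ \lambda_{3;2}&-\lambda_{3;2}^{(23)}=-\lambda_2\circ_2\lambda_{2;1,1}+\lambda_{2;1,1}\circ_1\lambda_2+(\lambda_{2;1,1}\circ_2\lambda_2)^{(12)},\\ \lambda_4&+\lambda_4^{(12)}=\lambda_2\circ_1\lambda_{3;1}-\lambda_{3;1}\circ_3\lambda_2+(\lambda_2\circ_2\lambda_{3;1})^{(123)}+\lambda_3\circ_1\lambda_{2;1},\\ \lambda_4&+\lambda_4^{(23)}=\lambda_2\circ_1\lambda_{3;2}-\lambda_3\circ_2\lambda_{2;1}+\lambda_2\circ_2\lambda_{3;1}-\lambda_{3;1}\circ_1\lambda_2-(\lambda_{3;1}\circ_2\lambda_2)^{(12)}-(\lambda_{3;1}\circ_3\lambda_2)^{(132)},\\ \lambda_4&+\lambda_4^{(34)}=\lambda_{2;1}\circ_1\lambda_3-\lambda_{3;2}\circ_1\lambda_2+\lambda_{3;2}\circ_2\lambda_2-(\lambda_{3;2}\circ_2\lambda_2)^{(12)}+\lambda_3\circ_3\lambda_{2;1}+(\lambda_{3;2}\circ_3\lambda_2)^{(23)}\\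 &\quad-(\lambda_{3;2}\circ_3\lambda_2)^{(132)}+\lambda_2\circ_2\lambda_{3;2}-(\lambda_2\circ_2\lambda_{3;2})^{(12)}+(\lambda_{2;1}\circ_2\lambda_3)^{(123)}. \end{align*} A Lie 3-algebra (3-term $L_\infty$-algebra) is a 3-term complex with maps $l_n$ of arity $n$ and degree $n-2$ ($n=2,3,4$; $l_n=0$ for $n\ge5$) with $l_n^\sigma=(-1)^{|\sigma|}l_n$ and, for all $n\geq 2$, $$\partial l_n=-\sum_{i+j=n+1,\ i,j\ge2}(-1)^{(j-1)i}\sum_{\sigma\in\mathrm{Sh}^{-1}(i,j-1)}(-1)^{|\sigma|}(l_j\circ_1l_i)^\sigma .$$ The skew-symmetrization of a weak Lie 3-algebra is the same complex with \begin{align*} l_2&=\tfrac12\sum_{\sigma\in S_2}(-1)^{|\sigma|}\lambda_2^\sigma,\qquad l_3=\tfrac16\sum_{\sigma\in S_3}(-1)^{|\sigma|}\lambda_3^\sigma-\tfrac1{24}\sum_{\sigma\in S_3}(-1)^{|\sigma|}(\lambda_{2;1}\circ_1\lambda_2+\lambda_{2;1}\circ_2\lambda_2)^\sigma,\\ l_4&=\tfrac1{24}\sum_{\sigma\in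 S_4}(-1)^{|\sigma|}\lambda_4^\sigma+\tfrac1{48}\sum_{\sigma\in S_4}(-1)^{|\sigma|}\big(\lambda_{2;1}\circ_1\lambda_3-\lambda_{3;1}\circ_1\lambda_2+\lambda_{3;2}\circ_2\lambda_2-\lambda_{2;1}\circ_2\lambda_3-\lambda_{3;1}\circ_2\lambda_2+\lambda_{3;2}\circ_3\lambda_2\big)^\sigma . \end{align*} CLWX 2-algebroids. Let $E_0,E_1$ be smooth real vector bundles of finite rank over a smooth manifold $M$, put $E=E_0\oplus E_1$ ($E_i$ in degree $i$), and let there be given: bundle maps $\partial\colon E_1\to E_0$ and $\rho\colon E_0\to TM$ over $\mathrm{id}_M$ with $\rho\partial=0$ (extend $\rho$ by $0$ to $E_1$ and $\partial$ by $0$ to $E_0$); a graded $\mathbb R$-bilinear map $\circ\colon\Gamma E\otimes\Gamma E\to\Gamma E$ that is skew-symmetric on $\Gamma E_0$; a 3-form $\Omega$ on $E_0$ with values in $E_1$ (extended by $0$ to $E$); and a non-degenerate symmetric bilinear form $S$ on $E$ for which $E_0$ and $E_1$ are isotropic. Let $\mathcal D\colon C^\infty(M)\to\Gamma E_1$ be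 the map with $S(e,\mathcal Df)=\rho(e)(f)$ for all $e\in\Gamma E$. These data form a CLWX 2-algebroid if $(\Gamma E_0\xleftarrow{\partial}\Gamma E_1,\circ,\Omega)$ is a Leibniz 2-algebra and for all $e,e_i\in\Gamma E$ \begin{align*} &e\circ e=\tfrac12\mathcal DS(e,e),\qquad S(\partial e_1,e_2)=S(e_1,\partial e_2),\qquad \rho(e_1)S(e_2,e_3)=S(e_1\circ e_2,e_3)+S(e_2,e_1\circ e_3),\\ &S(\Omega(e_1,e_2,e_3),e_4)=-S(e_3,\Omega(e_1,e_2,e_4)). \end{align*} Statement. For every CLWX 2-algebroid, the sequence $L=(\Gamma E_0\xleftarrow{\partial}\Gamma E_1\xleftarrow{\mathcal D}C^\infty(M))$ is a complex, and with $\lambda_2=\circ+S\circ_2\mathcal D$, $\lambda_{2;1}=S$, $\lambda_3=\Omega$ and $\lambda_{2;1,1}=\lambda_{3;1}=\lambda_{3;2}=\lambda_4=0$ it is a weak Lie 3-algebra (all operations are extended by zero to the remaining arguments). Its skew-symmetrization is a Lie 3-algebra, with structure maps $$l_2=\tfrac12\big(\circ-\circ^{(12)}-S\circ_1\mathcal D+S\circ_2\mathcal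 D\big),\qquad l_3=\Omega-\tfrac1{12}\sum_{\sigma\in S_3}(-1)^{|\sigma|}(S\circ_1\circ)^\sigma,\qquad l_4=S\circ_1\Omega .$$ These are the brackets of Liu and Sheng: with $[e,a]=\frac12(e\circ a-a\circ e)$, for $x,y,z,w\in\Gamma E_0$, $a,b\in\Gamma E_1$, $f\in C^\infty(M)$, \begin{align*} &l_2(x,y)=x\circ y,\quad l_2(x,a)=[x,a],\quad l_2(x,f)=\tfrac12S(x,\mathcal Df),\quad l_2(a,b)=0,\quad l_3(x,y,z)=\Omega(x,y,z),\\ &l_3(x,y,a)=-\tfrac16\big(S(x,[y,a])+S(x\circ y,a)-S(y,[x,a])\big),\quad l_4(x,y,z,w)=S(\Omega(x,y,z),w), \end{align*} all other components being determined by graded skew-symmetry or zero for degree reasons. -/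

import Mathlib

open Bundle Manifold
open scoped ContDiff Manifold

noncomputable section

set_option linter.unusedSectionVars false

namespace WeakLie

/-! ## The endomorphism operad of a 3-term graded vector space -/

section Operad

variable (A B C : Type*) [AddCommGroup A] [Module ℝ A] [AddCommGroup B] [Module ℝ B]
  [AddCommGroup C] [Module ℝ C]

/-- The total space of the graded real vector space with `A` in degree 0, `B` in degree 1, `C` in
degree 2 and nothing in other degrees. -/
abbrev Tot : Type _ := A × B × C

/-- The `n`-multilinear maps on the graded vector space `Tot A B C`, i.e. the arity `n` part of its
endomorphism operad (all degrees together, see `IsHomog`). -/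
abbrev Op (n : ℕ) : Type _ := MultilinearMap ℝ (fun _ : Fin n => Tot A B C) (Tot A B C)

variable {A B C}

/-- The projection of the total space onto its homogeneous component of degree `j`. -/
def proj : Fin 3 → (Tot A B C →ₗ[ℝ] Tot A B C)
  | 0 => LinearMap.prodMap LinearMap.id 0
  | 1 => LinearMap.prodMap 0 (LinearMap.prodMap LinearMap.id 0)
  | 2 => LinearMap.prodMap 0 (LinearMap.prodMap 0 LinearMap.id)

/-- The parity involution `v ↦ (-1)^|v| v`. -/
def parity : Tot A B C →ₗ[ℝ] Tot A B C :=
  LinearMap.prodMap LinearMap.id (LinearMap.prodMap (-LinearMap.id) LinearMap.id)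

/-- The linear map of degree `-1` on the total space with components `d₁ : B → A`, `d₂ : C → B`. -/
def diff (d₁ : B →ₗ[ℝ] A) (d₂ : C →ₗ[ℝ] B) : Tot A B C →ₗ[ℝ] Tot A B C where
  toFun v := (d₁ v.2.1, d₂ v.2.2, 0)
  map_add' v w := by simp
  map_smul' c v := by simp

/-- A linear endomorphism as an element of arity 1. -/
def unary (f : Tot A B C →ₗ[ℝ] Tot A B C) : Op A B C 1 :=
  MultilinearMap.ofSubsingleton ℝ _ _ (0 : Fin 1) f

/-- `μ` is homogeneous of degree `r`: it maps `L_{e 1} ⊗ ⋯ ⊗ L_{e n}` to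
`L_{e 1 + ⋯ + e n + r}`. -/
def IsHomog {n : ℕ} (r : ℕ) (μ : Op A B C n) : Prop :=
  ∀ (e : Fin n → Fin 3) (v : Fin n → Tot A B C) (j : Fin 3),
    (j : ℕ) ≠ (∑ i, (e i : ℕ)) + r → proj j (μ fun i => proj (e i) (v i)) = 0

/-- The Koszul sign `ε(σ; v)` of the permutation
`v_1 ⊗ ⋯ ⊗ v_n ↦ v_{σ⁻¹(1)} ⊗ ⋯ ⊗ v_{σ⁻¹(n)}` for `v_i` homogeneous of degree `e i`: every pair whose
order is reversed contributes `(-1)^{|v_i||v_j|}`. -/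
def koszulSign {n : ℕ} (σ : Equiv.Perm (Fin n)) (e : Fin n → Fin 3) : ℤ :=
  ∏ i, ∏ j, if i < j ∧ σ j < σ i then (-1) ^ ((e i : ℕ) * (e j : ℕ)) else 1

/-- The right action `μ^σ` of the symmetric group. On homogeneous elements it is
`μ^σ(v_1, …, v_n) = ε(σ; v_1, …, v_n) μ(v_{σ⁻¹(1)}, …, v_{σ⁻¹(n)})`; in general one sums over the
homogeneous components of the arguments. -/
def perm {n : ℕ} (σ : Equiv.Perm (Fin n)) (μ : Op A B C n) : Op A B C n :=
  ∑ e : Fin n → Fin 3,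
    koszulSign σ e • (μ.domDomCongr σ⁻¹).compLinearMap (fun i => proj (e i))

/-- The arguments which `μ ∘_i ν` hands to `μ`, where `ν` has degree parity `s` (the index `i` counts
from `0`): the arguments left of the `i`-th slot get the Koszul sign `(-1)^{s |v_j|}`. -/
def compArgs {m k : ℕ} (i : Fin (m + 1)) (s : ℕ) (ν : Op A B C k)
    (v : Fin (m + k) → Tot A B C) (j : Fin (m + 1)) : Tot A B C :=
  if h : j < i then (parity ^ s) (v ⟨j, by omega⟩)
  else if h' : i < j then v ⟨j - 1 + k, by omega⟩
  else ν fun l => v ⟨i + l, by omega⟩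

lemma compArgs_update {m k : ℕ} (i : Fin (m + 1)) (s : ℕ) (ν : Op A B C k)
    (v : Fin (m + k) → Tot A B C) (p : Fin (m + k)) :
    ∃ (j : Fin (m + 1)) (f : Tot A B C →ₗ[ℝ] Tot A B C), ∀ x,
      compArgs i s ν (Function.update v p x) = Function.update (compArgs i s ν v) j (f x) := by
  by_cases h1 : (p : ℕ) < i
  · refine ⟨⟨p, by omega⟩, parity ^ s, fun x => funext fun j => ?_⟩
    rcases eq_or_ne j ⟨p, by omega⟩ with rfl | hj
    · simp [compArgs, Fin.lt_def, h1]
    · have hj' : (j : ℕ) ≠ p := fun h => hj (Fin.ext h)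
      rw [Function.update_of_ne hj]
      unfold compArgs
      split_ifs with h2 h3
      · rw [Function.update_of_ne (by simpa [Fin.ext_iff] using hj')]
      · rw [Function.update_of_ne]
        simp only [Fin.lt_def] at h2 h3
        simp only [ne_eq, Fin.ext_iff]; omega
      · congr 1; funext l
        rw [Function.update_of_ne]
        simp only [ne_eq, Fin.ext_iff]; omega
  by_cases h2 : (p : ℕ) < i + k
  · refine ⟨i, ν.toLinearMap (fun l => v ⟨i + l, by omega⟩) ⟨p - i, by omega⟩,
      fun x => funext fun j => ?_⟩
    rcases eq_or_ne j i with rfl | hj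
    · simp only [compArgs, lt_irrefl, dite_false, Function.update_self,
        MultilinearMap.toLinearMap_apply]
      congr 1; funext l
      by_cases hl : (l : ℕ) = p - j
      · have e1 : l = ⟨p - j, by omega⟩ := Fin.ext hl
        have e2 : (⟨j + l, by omega⟩ : Fin (m + k)) = p := Fin.ext (by simp only; omega)
        rw [e2, e1, Function.update_self, Function.update_self]
      · rw [Function.update_of_ne, Function.update_of_ne]
        · simpa [Fin.ext_iff] using hl
        · simp only [ne_eq, Fin.ext_iff]; omega
    · have hj' : (j : ℕ) ≠ i := fun h => hj (Fin.ext h)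
      rw [Function.update_of_ne hj]
      unfold compArgs
      split_ifs with h3 h4
      · rw [Function.update_of_ne]
        simp only [Fin.lt_def] at h3
        simp only [ne_eq, Fin.ext_iff]; omega
      · rw [Function.update_of_ne]
        simp only [Fin.lt_def] at h3 h4
        simp only [ne_eq, Fin.ext_iff]; omega
      · simp only [Fin.lt_def] at h3 h4; omega
  · refine ⟨⟨p + 1 - k, by omega⟩, LinearMap.id, fun x => funext fun j => ?_⟩
    rcases eq_or_ne j ⟨p + 1 - k, by omega⟩ with rfl | hj
    · have e1 : ¬ ((⟨p + 1 - k, by omega⟩ : Fin (m + 1)) < i) := by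
        simp only [Fin.lt_def]; omega
      have e2 : i < (⟨p + 1 - k, by omega⟩ : Fin (m + 1)) := by
        simp only [Fin.lt_def]; omega
      have e3 : (⟨p + 1 - k - 1 + k, by omega⟩ : Fin (m + k)) = p := Fin.ext (by simp only; omega)
      simp only [compArgs, e1, e2, dite_true, dite_false, Function.update_self, LinearMap.id_coe,
        id_eq, e3]
    · have hj' : (j : ℕ) ≠ p + 1 - k := fun h => hj (Fin.ext h)
      rw [Function.update_of_ne hj]
      unfold compArgs
      split_ifs with h3 h4
      · rw [Function.update_of_ne]
        simp only [Fin.lt_def] at h3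
        simp only [ne_eq, Fin.ext_iff]; omega
      · rw [Function.update_of_ne]
        simp only [Fin.lt_def] at h3 h4
        simp only [ne_eq, Fin.ext_iff]; omega
      · congr 1; funext l
        rw [Function.update_of_ne]
        simp only [ne_eq, Fin.ext_iff]; omega

/-- The partial composition
`(μ ∘_i ν)(v_1, …) = (-1)^{|ν|(|v_1| + ⋯ + |v_{i-1}|)} μ(v_1, …, v_{i-1}, ν(v_i, …), …)` of the
endomorphism operad, for `ν` of degree congruent to `s` modulo 2. Slots are counted from `0`. -/
def comp {m k : ℕ} (μ : Op A B C (m + 1)) (i : Fin (m + 1)) (s : ℕ) (ν : Op A B C k) :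
    Op A B C (m + k) :=
  MultilinearMap.mk' (fun v => μ (compArgs i s ν v))
    (fun v p x y => by
      obtain ⟨j, f, hf⟩ := compArgs_update i s ν v p
      simp only [hf, map_add, MultilinearMap.map_update_add])
    (fun v p c x => by
      obtain ⟨j, f, hf⟩ := compArgs_update i s ν v p
      simp only [hf, map_smul, MultilinearMap.map_update_smul])

/-- The differential `∂μ = d ∘ μ - (-1)^r μ ∘ d^{⊗ n}` of the endomorphism operad, for `μ` of degree
`r`; here `μ ∘ d^{⊗ n}` stands for `∑_i μ ∘_i d`. -/
def bdry {m : ℕ} (d : Tot A B C →ₗ[ℝ] Tot A B C) (r : ℕ) (μ : Op A B C (m + 1)) :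
    Op A B C (m + 1) :=
  d.compMultilinearMap μ - (-1 : ℝ) ^ r • ∑ i : Fin (m + 1), comp μ i 1 (unary d)

/-- The signed sum `∑_{σ ∈ S_n} (-1)^{|σ|} μ^σ`. -/
def alt {n : ℕ} (μ : Op A B C n) : Op A B C n :=
  ∑ σ : Equiv.Perm (Fin n), (Equiv.Perm.sign σ : ℤ) • perm σ μ

/-- The inverses of `(p, n - p)`-shuffles: permutations `σ` of `n` letters with
`σ⁻¹(1) < ⋯ < σ⁻¹(p)` and `σ⁻¹(p + 1) < ⋯ < σ⁻¹(n)`. -/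
def unshuffles (n p : ℕ) : Finset (Equiv.Perm (Fin n)) :=
  Finset.univ.filter fun σ => ∀ a b : Fin n, a < b →
    ((b : ℕ) < p ∨ p ≤ (a : ℕ)) → σ⁻¹ a < σ⁻¹ b

/-- The signed sum `∑_{σ ∈ Sh⁻¹(p, n - p)} (-1)^{|σ|} μ^σ` over unshuffles. -/
def shSum {n : ℕ} (p : ℕ) (μ : Op A B C n) : Op A B C n :=
  ∑ σ ∈ unshuffles n p, (Equiv.Perm.sign σ : ℤ) • perm σ μ

/-- `(L, d, l)` is a Leibniz 3-algebra (a homotopy Leibniz algebra on a 3-term complex): `d` comes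
from a 3-term complex `A ← B ← C`, the structure maps `l₂, l₃, l₄` have degrees 0, 1, 2 and satisfy the
generalized Jacobi identities. Permutations are written in cycle notation with letters `0, 1, …`. -/
structure IsLeibniz3 (d₁ : B →ₗ[ℝ] A) (d₂ : C →ₗ[ℝ] B)
    (l2 : Op A B C 2) (l3 : Op A B C 3) (l4 : Op A B C 4) : Prop where
  complex : d₁ ∘ₗ d₂ = 0
  homog2 : IsHomog 0 l2
  homog3 : IsHomog 1 l3
  homog4 : IsHomog 2 l4
  jacobi2 : bdry (diff d₁ d₂) 0 l2 = 0
  jacobi3 : bdry (diff d₁ d₂) 1 l3 =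
    comp l2 1 0 l2 - comp l2 0 0 l2 - perm (List.formPerm [0, 1]) (comp l2 1 0 l2)
  jacobi4 : bdry (diff d₁ d₂) 2 l4 =
    comp l2 0 1 l3 + comp l2 1 1 l3 - perm (List.formPerm [0, 1]) (comp l2 1 1 l3)
      + perm (List.formPerm [0, 1, 2]) (comp l2 1 1 l3) - comp l3 0 0 l2
      + comp l3 1 0 l2 - perm (List.formPerm [0, 1]) (comp l3 1 0 l2)
      - comp l3 2 0 l2 + perm (List.formPerm [1, 2]) (comp l3 2 0 l2)
      - perm (List.formPerm [0, 2, 1]) (comp l3 2 0 l2)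
  jacobi5 : (0 : Op A B C 5) =
    comp l2 0 2 l4 - comp l2 1 2 l4 + perm (List.formPerm [0, 1]) (comp l2 1 2 l4)
      - perm (List.formPerm [0, 1, 2]) (comp l2 1 2 l4)
      + perm (List.formPerm [0, 1, 2, 3]) (comp l2 1 2 l4)
      + comp l3 0 1 l3 + comp l3 1 1 l3 - perm (List.formPerm [0, 1]) (comp l3 1 1 l3)
      + perm (List.formPerm [0, 1, 2]) (comp l3 1 1 l3) + comp l3 2 1 l3
      - perm (List.formPerm [1, 2]) (comp l3 2 1 l3)
      + perm (List.formPerm [0, 2, 1]) (comp l3 2 1 l3)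
      + perm (List.formPerm [1, 2, 3]) (comp l3 2 1 l3)
      - perm (List.formPerm [0, 2, 3, 1]) (comp l3 2 1 l3)
      + perm (List.formPerm [0, 2] * List.formPerm [1, 3]) (comp l3 2 1 l3)
      + comp l4 0 0 l2 - comp l4 1 0 l2 + perm (List.formPerm [0, 1]) (comp l4 1 0 l2)
      + comp l4 2 0 l2 - perm (List.formPerm [1, 2]) (comp l4 2 0 l2)
      + perm (List.formPerm [0, 2, 1]) (comp l4 2 0 l2) - comp l4 3 0 l2
      + perm (List.formPerm [2, 3]) (comp l4 3 0 l2)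
      - perm (List.formPerm [1, 3, 2]) (comp l4 3 0 l2)
      + perm (List.formPerm [0, 3, 2, 1]) (comp l4 3 0 l2)

variable (A B C) in
/-- The structure maps of a weak Lie 3-algebra on `A ← B ← C`. -/
structure WeakLie3Data where
  d₁ : B →ₗ[ℝ] A
  d₂ : C →ₗ[ℝ] B
  l2 : Op A B C 2
  l21 : Op A B C 2
  l211 : Op A B C 2
  l3 : Op A B C 3
  l31 : Op A B C 3
  l32 : Op A B C 3
  l4 : Op A B C 4

/-- The laws of a weak Lie 3-algebra. -/
structure WeakLie3Data.IsWeakLie3 (L : WeakLie3Data A B C) : Prop where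
  leibniz : IsLeibniz3 L.d₁ L.d₂ L.l2 L.l3 L.l4
  homog21 : IsHomog 1 L.l21
  homog211 : IsHomog 2 L.l211
  homog31 : IsHomog 2 L.l31
  homog32 : IsHomog 2 L.l32
  eq21 : bdry (diff L.d₁ L.d₂) 1 L.l21 = L.l2 + perm (List.formPerm [0, 1]) L.l2
  eq211 : bdry (diff L.d₁ L.d₂) 2 L.l211 = L.l21 - perm (List.formPerm [0, 1]) L.l21
  eq31 : bdry (diff L.d₁ L.d₂) 2 L.l31 =
    L.l3 + perm (List.formPerm [0, 1]) L.l3 + comp L.l2 0 1 L.l21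
  eq32 : bdry (diff L.d₁ L.d₂) 2 L.l32 =
    L.l3 + perm (List.formPerm [1, 2]) L.l3 - comp L.l2 1 1 L.l21 + comp L.l21 0 0 L.l2
      + perm (List.formPerm [0, 1]) (comp L.l21 1 0 L.l2)
  eq2111 : L.l211 + perm (List.formPerm [0, 1]) L.l211 = 0
  eq311 : L.l31 - perm (List.formPerm [0, 1]) L.l31 = comp L.l2 0 2 L.l211
  eq312 : L.l31 - perm (List.formPerm [0, 1]) L.l32 + perm (List.formPerm [0, 2, 1]) L.l31
      - L.l32 + perm (List.formPerm [1, 2]) L.l31 - perm (List.formPerm [0, 1, 2]) L.l32 =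
    comp L.l21 1 1 L.l21 + comp L.l21 0 1 L.l21 + perm (List.formPerm [0, 1]) (comp L.l21 1 1 L.l21)
      + perm (List.formPerm [0, 2, 1]) (comp L.l211 1 0 L.l2)
  eq322 : L.l32 - perm (List.formPerm [1, 2]) L.l32 =
    -comp L.l2 1 2 L.l211 + comp L.l211 0 0 L.l2
      + perm (List.formPerm [0, 1]) (comp L.l211 1 0 L.l2)
  eq41 : L.l4 + perm (List.formPerm [0, 1]) L.l4 =
    comp L.l2 0 2 L.l31 - comp L.l31 2 0 L.l2 + perm (List.formPerm [0, 1, 2]) (comp L.l2 1 2 L.l31)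
      + comp L.l3 0 1 L.l21
  eq42 : L.l4 + perm (List.formPerm [1, 2]) L.l4 =
    comp L.l2 0 2 L.l32 - comp L.l3 1 1 L.l21 + comp L.l2 1 2 L.l31 - comp L.l31 0 0 L.l2
      - perm (List.formPerm [0, 1]) (comp L.l31 1 0 L.l2)
      - perm (List.formPerm [0, 2, 1]) (comp L.l31 2 0 L.l2)
  eq43 : L.l4 + perm (List.formPerm [2, 3]) L.l4 =
    comp L.l21 0 1 L.l3 - comp L.l32 0 0 L.l2 + comp L.l32 1 0 L.l2
      - perm (List.formPerm [0, 1]) (comp L.l32 1 0 L.l2) + comp L.l3 2 1 L.l21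
      + perm (List.formPerm [1, 2]) (comp L.l32 2 0 L.l2)
      - perm (List.formPerm [0, 2, 1]) (comp L.l32 2 0 L.l2)
      + comp L.l2 1 2 L.l32 - perm (List.formPerm [0, 1]) (comp L.l2 1 2 L.l32)
      + perm (List.formPerm [0, 1, 2]) (comp L.l21 1 1 L.l3)

variable (A B C) in
/-- The structure maps of a Lie 3-algebra on `A ← B ← C`. -/
structure Lie3Data where
  d₁ : B →ₗ[ℝ] A
  d₂ : C →ₗ[ℝ] B
  l2 : Op A B C 2
  l3 : Op A B C 3
  l4 : Op A B C 4

/-- The laws of a (semi-strict) Lie 3-algebra, i.e. of an `L_∞`-algebra on a 3-term complex: the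
structure maps are graded skew-symmetric, `l_n^σ = (-1)^{|σ|} l_n`, of degree `n - 2`, and satisfy
`∂ l_n = - ∑_{i + j = n + 1} (-1)^{(j - 1) i} ∑_{σ ∈ Sh⁻¹(i, j - 1)} (-1)^{|σ|} (l_j ∘_1 l_i)^σ`
(with `i, j ≥ 2`), which is trivial for `n ≥ 6`, and where `l_5 = 0`. -/
structure Lie3Data.IsLie3 (L : Lie3Data A B C) : Prop where
  complex : L.d₁ ∘ₗ L.d₂ = 0
  homog2 : IsHomog 0 L.l2
  homog3 : IsHomog 1 L.l3
  homog4 : IsHomog 2 L.l4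
  skew2 : ∀ σ, perm σ L.l2 = (Equiv.Perm.sign σ : ℤ) • L.l2
  skew3 : ∀ σ, perm σ L.l3 = (Equiv.Perm.sign σ : ℤ) • L.l3
  skew4 : ∀ σ, perm σ L.l4 = (Equiv.Perm.sign σ : ℤ) • L.l4
  jacobi2 : bdry (diff L.d₁ L.d₂) 0 L.l2 = 0
  jacobi3 : bdry (diff L.d₁ L.d₂) 1 L.l3 = -shSum 2 (comp L.l2 0 0 L.l2)
  jacobi4 : bdry (diff L.d₁ L.d₂) 2 L.l4 =
    -shSum 2 (comp L.l3 0 0 L.l2) + shSum 3 (comp L.l2 0 1 L.l3)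
  jacobi5 : (0 : Op A B C 5) =
    -shSum 2 (comp L.l4 0 0 L.l2) - shSum 3 (comp L.l3 0 1 L.l3)
      - shSum 4 (comp L.l2 0 2 L.l4)

/-- The skew-symmetrization of a weak Lie 3-algebra. -/
def WeakLie3Data.skewSymm (L : WeakLie3Data A B C) : Lie3Data A B C where
  d₁ := L.d₁
  d₂ := L.d₂
  l2 := (1 / 2 : ℝ) • alt L.l2
  l3 := (1 / 6 : ℝ) • alt L.l3 - (1 / 24 : ℝ) • alt (comp L.l21 0 0 L.l2 + comp L.l21 1 0 L.l2)
  l4 := (1 / 24 : ℝ) • alt L.l4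
    + (1 / 48 : ℝ) • alt (comp L.l21 0 1 L.l3 - comp L.l31 0 0 L.l2 + comp L.l32 1 0 L.l2
      - comp L.l21 1 1 L.l3 - comp L.l31 1 0 L.l2 + comp L.l32 2 0 L.l2)

/-- The graded operation of degree 0 on `Tot A B C` with the given components
`A ⊗ A → A`, `A ⊗ B → B`, `B ⊗ A → B` and all other components zero. -/
def bilinOp (c₀₀ : A →ₗ[ℝ] A →ₗ[ℝ] A) (c₀₁ : A →ₗ[ℝ] B →ₗ[ℝ] B) (c₁₀ : B →ₗ[ℝ] A →ₗ[ℝ] B) :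
    Op A B C 2 :=
  MultilinearMap.mk'
    (fun v => (c₀₀ (v 0).1 (v 1).1, c₀₁ (v 0).1 (v 1).2.1 + c₁₀ (v 0).2.1 (v 1).1, 0))
    (fun v i x y => by
      fin_cases i <;> simp [add_add_add_comm])
    (fun v i c x => by
      fin_cases i <;> simp)

/-- The operation of degree 1 on `Tot A B C` given by a pairing `A ⊗ B → C`, extended symmetrically
and by zero on `A ⊗ A` and `B ⊗ B`. -/
def pairOp (s : A →ₗ[ℝ] B →ₗ[ℝ] C) : Op A B C 2 :=
  MultilinearMap.mk' (fun v => (0, 0, s (v 0).1 (v 1).2.1 + s (v 1).1 (v 0).2.1))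
    (fun v i x y => by
      fin_cases i <;> simp [add_add_add_comm])
    (fun v i c x => by
      fin_cases i <;> simp)

/-- The operation of degree 1 on `Tot A B C` given by a trilinear map `A ⊗ A ⊗ A → B`. -/
def triOp (o : MultilinearMap ℝ (fun _ : Fin 3 => A) B) : Op A B C 3 :=
  (LinearMap.inr ℝ A (B × C) ∘ₗ LinearMap.inl ℝ B C).compMultilinearMap
    (o.compLinearMap fun _ => LinearMap.fst ℝ A (B × C))

end Operad

/-! ## CLWX 2-algebroids -/

section CLWX

variable (E : Type*) [NormedAddCommGroup E] [NormedSpace ℝ E]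
  {M : Type*} [TopologicalSpace M] [ChartedSpace E M] [IsManifold 𝓘(ℝ, E) ∞ M]
  (F₀ : Type*) [NormedAddCommGroup F₀] [NormedSpace ℝ F₀] [FiniteDimensional ℝ F₀]
  (F₁ : Type*) [NormedAddCommGroup F₁] [NormedSpace ℝ F₁] [FiniteDimensional ℝ F₁]
  (E₀ : M → Type*) [∀ x, AddCommGroup (E₀ x)] [∀ x, Module ℝ (E₀ x)]
  [∀ x, TopologicalSpace (E₀ x)] [∀ x, IsTopologicalAddGroup (E₀ x)]
  [∀ x, ContinuousSMul ℝ (E₀ x)] [TopologicalSpace (TotalSpace F₀ E₀)]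
  [FiberBundle F₀ E₀] [VectorBundle ℝ F₀ E₀] [ContMDiffVectorBundle ∞ F₀ E₀ 𝓘(ℝ, E)]
  (E₁ : M → Type*) [∀ x, AddCommGroup (E₁ x)] [∀ x, Module ℝ (E₁ x)]
  [∀ x, TopologicalSpace (E₁ x)] [∀ x, IsTopologicalAddGroup (E₁ x)]
  [∀ x, ContinuousSMul ℝ (E₁ x)] [TopologicalSpace (TotalSpace F₁ E₁)]
  [FiberBundle F₁ E₁] [VectorBundle ℝ F₁ E₁] [ContMDiffVectorBundle ∞ F₁ E₁ 𝓘(ℝ, E)]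

/-- The data underlying a CLWX 2-algebroid on smooth real vector bundles `E₀`, `E₁` of finite rank over
a manifold `M` modelled on `E`: the differential and the anchor, both of which are bundle maps over the
identity; a graded real bilinear operation `∘` on sections, given by its components
`ΓE₀ ⊗ ΓE₀ → ΓE₀`, `ΓE₀ ⊗ ΓE₁ → ΓE₁`, `ΓE₁ ⊗ ΓE₀ → ΓE₁` (the product of two sections of `E₁` has degree 2,
hence vanishes); a 3-form `Ω` on `E₀` with values in `E₁` (the only component of degree 1); and a
non-degenerate symmetric bilinear form on `E₀ ⊕ E₁` for which `E₀` and `E₁` are isotropic, i.e. a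
non-degenerate pairing of `E₀` with `E₁`. -/
structure CLWXData where
  /-- the differential `∂` of `E₀ ← E₁` -/
  del : ∀ x, E₁ x →L[ℝ] E₀ x
  contMDiff_del : ContMDiff 𝓘(ℝ, E) (𝓘(ℝ, E).prod 𝓘(ℝ, F₁ →L[ℝ] F₀)) ∞
    (fun x => TotalSpace.mk' (F₁ →L[ℝ] F₀) (E := fun x => E₁ x →L[ℝ] E₀ x) x (del x))
  /-- the anchor; it vanishes on `E₁`, because `TM` sits in degree 0 -/
  rho : ∀ x, E₀ x →L[ℝ] TangentSpace 𝓘(ℝ, E) x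
  contMDiff_rho : ContMDiff 𝓘(ℝ, E) (𝓘(ℝ, E).prod 𝓘(ℝ, F₀ →L[ℝ] E)) ∞
    (fun x => TotalSpace.mk' (F₀ →L[ℝ] E)
      (E := fun x => E₀ x →L[ℝ] TangentSpace 𝓘(ℝ, E) x) x (rho x))
  /-- the anchor is a chain map -/
  rho_del : ∀ x v, rho x (del x v) = 0
  circ₀₀ : ContMDiffSection 𝓘(ℝ, E) F₀ ∞ E₀ →ₗ[ℝ] ContMDiffSection 𝓘(ℝ, E) F₀ ∞ E₀ →ₗ[ℝ]
    ContMDiffSection 𝓘(ℝ, E) F₀ ∞ E₀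
  circ₀₁ : ContMDiffSection 𝓘(ℝ, E) F₀ ∞ E₀ →ₗ[ℝ] ContMDiffSection 𝓘(ℝ, E) F₁ ∞ E₁ →ₗ[ℝ]
    ContMDiffSection 𝓘(ℝ, E) F₁ ∞ E₁
  circ₁₀ : ContMDiffSection 𝓘(ℝ, E) F₁ ∞ E₁ →ₗ[ℝ] ContMDiffSection 𝓘(ℝ, E) F₀ ∞ E₀ →ₗ[ℝ]
    ContMDiffSection 𝓘(ℝ, E) F₁ ∞ E₁
  circ₀₀_skew : ∀ x y, circ₀₀ x y = -circ₀₀ y x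
  omega : ∀ x, E₀ x [⋀^Fin 3]→ₗ[ℝ] E₁ x
  /-- `Ω` is smooth, i.e. it maps smooth sections to smooth sections -/
  contMDiff_omega : ∀ s : Fin 3 → ContMDiffSection 𝓘(ℝ, E) F₀ ∞ E₀,
    ContMDiff 𝓘(ℝ, E) (𝓘(ℝ, E).prod 𝓘(ℝ, F₁)) ∞
      (fun x => TotalSpace.mk' F₁ x (omega x fun i => s i x))
  /-- the form `S`, restricted to `E₀ ⊗ E₁` -/
  pairing : ∀ x, E₀ x →L[ℝ] E₁ x →L[ℝ] ℝ
  contMDiff_pairing : ContMDiff 𝓘(ℝ, E) (𝓘(ℝ, E).prod 𝓘(ℝ, F₀ →L[ℝ] F₁ →L[ℝ] ℝ)) ∞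
    (fun x => TotalSpace.mk' (F₀ →L[ℝ] F₁ →L[ℝ] ℝ)
      (E := fun x => E₀ x →L[ℝ] E₁ x →L[ℝ] ℝ) x (pairing x))
  nondeg_left : ∀ x (u : E₀ x), (∀ w, pairing x u w = 0) → u = 0
  nondeg_right : ∀ x (w : E₁ x), (∀ u, pairing x u w = 0) → w = 0

namespace CLWXData

variable {E F₀ F₁ E₀ E₁}

lemma finrank_eq (P : CLWXData E F₀ F₁ E₀ E₁) (x : M) :
    FiniteDimensional ℝ (E₀ x) ∧ FiniteDimensional ℝ (E₁ x) ∧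
    Module.finrank ℝ (E₀ x) = Module.finrank ℝ (E₁ x) := by
  let e0 := (trivializationAt F₀ E₀ x).continuousLinearEquivAt ℝ x (FiberBundle.mem_baseSet_trivializationAt' x)
  let e1 := (trivializationAt F₁ E₁ x).continuousLinearEquivAt ℝ x (FiberBundle.mem_baseSet_trivializationAt' x)
  have i0 : FiniteDimensional ℝ (E₀ x) := e0.symm.toLinearEquiv.finiteDimensional
  have i1 : FiniteDimensional ℝ (E₁ x) := e1.symm.toLinearEquiv.finiteDimensional
  refine ⟨i0, i1, le_antisymm ?_ ?_⟩
  · let g : E₀ x →ₗ[ℝ] Module.Dual ℝ (E₁ x) :=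
      LinearMap.mk₂ ℝ (fun u w => P.pairing x u w) (by simp) (by simp) (by simp) (by simp)
    rw [← Subspace.dual_finrank_eq (V := E₁ x)]
    refine LinearMap.finrank_le_finrank_of_injective (f := g) ?_
    rw [← LinearMap.ker_eq_bot, LinearMap.ker_eq_bot']
    exact fun u hu => P.nondeg_left x u fun w => LinearMap.congr_fun hu w
  · let g : E₁ x →ₗ[ℝ] Module.Dual ℝ (E₀ x) :=
      LinearMap.mk₂ ℝ (fun w u => P.pairing x u w) (by simp) (by simp) (by simp) (by simp)
    rw [← Subspace.dual_finrank_eq (V := E₀ x)]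
    refine LinearMap.finrank_le_finrank_of_injective (f := g) ?_
    rw [← LinearMap.ker_eq_bot, LinearMap.ker_eq_bot']
    exact fun u hu => P.nondeg_right x u fun w => LinearMap.congr_fun hu w

lemma exists_pointwise (P : CLWXData E F₀ F₁ E₀ E₁) (x : M) (η : E₀ x →ₗ[ℝ] ℝ) : ∃ w : E₁ x, ∀ u, P.pairing x u w = η u := by
  obtain ⟨i0, i1, h⟩ := P.finrank_eq x
  let g : E₁ x →ₗ[ℝ] Module.Dual ℝ (E₀ x) :=
    LinearMap.mk₂ ℝ (fun w u => P.pairing x u w) (by simp) (by simp) (by simp) (by simp)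
  have hg : Function.Injective g := by
    rw [← LinearMap.ker_eq_bot, LinearMap.ker_eq_bot']
    exact fun u hu => P.nondeg_right x u fun w => LinearMap.congr_fun hu w
  have hs : Function.Surjective g :=
    (LinearMap.injective_iff_surjective_of_finrank_eq_finrank
      (by rw [Subspace.dual_finrank_eq, h])).1 hg
  obtain ⟨w, hw⟩ := hs η
  exact ⟨w, fun u => LinearMap.congr_fun hw u⟩

lemma contMDiff_mvfderiv_apply {f : M → ℝ} (hf : ContMDiff 𝓘(ℝ, E) 𝓘(ℝ) ∞ f) {x₀ : M}
    (X : ∀ x : M, TangentSpace 𝓘(ℝ, E) x)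
    (hX : ContMDiffAt 𝓘(ℝ, E) (𝓘(ℝ, E).prod 𝓘(ℝ, E)) ∞
      (fun x => TotalSpace.mk' E x (X x)) x₀) :
    ContMDiffAt 𝓘(ℝ, E) 𝓘(ℝ) ∞ (fun x => mvfderiv 𝓘(ℝ, E) f x (X x)) x₀ := by
  have h1 : ContMDiff 𝓘(ℝ, E).tangent 𝓘(ℝ).tangent ∞ (tangentMap 𝓘(ℝ, E) 𝓘(ℝ) f) :=
    hf.contMDiff_tangentMap (by simp)
  have h2 := h1.contMDiffAt.comp x₀ hX
  exact (contMDiff_snd_tangentBundle_modelSpace ℝ 𝓘(ℝ)).contMDiffAt.comp x₀ h2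

theorem exists_D (P : CLWXData E F₀ F₁ E₀ E₁) (f : C^∞⟮𝓘(ℝ, E), M; ℝ⟯) :
    ∃ s : ContMDiffSection 𝓘(ℝ, E) F₁ ∞ E₁, ∀ x (u : E₀ x),
      P.pairing x u (s x) = mvfderiv 𝓘(ℝ, E) f x (P.rho x u) := by
  choose s hs using fun x => P.exists_pointwise x
    (((mvfderiv 𝓘(ℝ, E) f x).comp (P.rho x)) : E₀ x →ₗ[ℝ] ℝ)
  refine ⟨⟨s, fun x₀ => ?_⟩, fun x u => hs x u⟩
  set e0 := trivializationAt F₀ E₀ x₀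
  set e1 := trivializationAt F₁ E₁ x₀
  have m0 : x₀ ∈ e0.baseSet := FiberBundle.mem_baseSet_trivializationAt' x₀
  have m1 : x₀ ∈ e1.baseSet := FiberBundle.mem_baseSet_trivializationAt' x₀
  have hr : Module.finrank ℝ F₁ = Module.finrank ℝ F₀ := by
    rw [← (e0.continuousLinearEquivAt ℝ x₀ m0).toLinearEquiv.finrank_eq,
      ← (e1.continuousLinearEquivAt ℝ x₀ m1).toLinearEquiv.finrank_eq]
    exact (P.finrank_eq x₀).2.2.symm
  let b0 := Module.finBasis ℝ F₀
  let b1 := Module.finBasisOfFinrankEq ℝ F₁ hr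
  let N := Module.finrank ℝ F₀
  let t0 := e0.localFrame b0
  let t1 := e1.localFrame b1
  let a : M → Fin N → Fin N → ℝ := fun x i j => P.pairing x (t0 i x) (t1 j x)
  let A : M → Matrix (Fin N) (Fin N) ℝ := fun x => Matrix.of (a x)
  let β : M → Fin N → ℝ := fun x i => mvfderiv 𝓘(ℝ, E) f x (P.rho x (t0 i x))
  have hA : ContMDiffAt 𝓘(ℝ, E) 𝓘(ℝ, Fin N → Fin N → ℝ) ∞ a x₀ := by
    rw [contMDiffAt_pi_space]; intro i
    rw [contMDiffAt_pi_space]; intro j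
    have h := ContMDiffAt.clm_bundle_apply₂ (F₁ := F₀) (F₂ := F₁) (F₃ := ℝ) (E₃ := Bundle.Trivial M ℝ)
      (P.contMDiff_pairing x₀)
      (contMDiffAt_localFrame_of_mem (I := 𝓘(ℝ, E)) ∞ e0 b0 i m0)
      (contMDiffAt_localFrame_of_mem (I := 𝓘(ℝ, E)) ∞ e1 b1 j m1)
    rw [contMDiffAt_totalSpace] at h
    exact h.2
  have hβ : ContMDiffAt 𝓘(ℝ, E) 𝓘(ℝ, Fin N → ℝ) ∞ β x₀ := by
    rw [contMDiffAt_pi_space]; intro i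
    exact contMDiff_mvfderiv_apply f.contMDiff _ (ContMDiffAt.clm_bundle_apply (F₁ := F₀) (F₂ := E)
      (P.contMDiff_rho x₀) (contMDiffAt_localFrame_of_mem (I := 𝓘(ℝ, E)) ∞ e0 b0 i m0))
  have hev : ∀ x ∈ e0.baseSet ∩ e1.baseSet,
      (A x).det ≠ 0 ∧ ∀ i, (e1.isLocalFrameOn_localFrame_baseSet 𝓘(ℝ, E) ∞ b1).coeff i x (s x) =
        ((A x).det)⁻¹ * (A x).cramer (β x) i := by
    rintro x ⟨hx0, hx1⟩
    set fr0 := e0.isLocalFrameOn_localFrame_baseSet 𝓘(ℝ, E) ∞ b0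
    set fr1 := e1.isLocalFrameOn_localFrame_baseSet 𝓘(ℝ, E) ∞ b1
    have hdet : (A x).det ≠ 0 := by
      intro h0
      obtain ⟨v, hv, hv0⟩ := Matrix.exists_mulVec_eq_zero_iff.2 h0
      have hw : ∑ j, v j • t1 j x = 0 := by
        refine P.nondeg_right x _ fun u => ?_
        have hz : ∀ i, P.pairing x (t0 i x) (∑ j, v j • t1 j x) = 0 := fun i => by
          have := congrFun hv0 i
          simp only [Matrix.mulVec, dotProduct, Pi.zero_apply] at this
          rw [map_sum, ← this]
          exact Finset.sum_congr rfl fun j _ => by rw [map_smul, smul_eq_mul, mul_comm]; rfl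
        let g : E₀ x →ₗ[ℝ] ℝ :=
          { toFun := fun u => P.pairing x u (∑ j, v j • t1 j x)
            map_add' := fun u u' => by rw [map_add]; rfl
            map_smul' := fun c u => by rw [map_smul]; rfl }
        have hg : g = 0 := (fr0.toBasisAt hx0).ext fun i => by
          rw [fr0.toBasisAt_coe]; exact hz i
        exact LinearMap.congr_fun hg u
      refine hv (funext fun j => ?_)
      exact Fintype.linearIndependent_iff.1 (fr1.linearIndependent hx1) v hw j
    refine ⟨hdet, fun i => ?_⟩
    have hAc : (A x).mulVec (fun j => fr1.coeff j x (s x)) = β x := by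
      funext i
      have h := hs x (t0 i x)
      rw [fr1.coeff_sum_eq s hx1, map_sum] at h
      refine Eq.trans ?_ h
      change ∑ j, a x i j * fr1.coeff j x (s x) = _
      refine Finset.sum_congr rfl fun j _ => ?_
      rw [map_smul, smul_eq_mul, mul_comm]
    have := congrArg ((A x).cramer) hAc
    rw [Matrix.cramer_eq_adjugate_mulVec, Matrix.mulVec_mulVec, Matrix.adjugate_mul] at this
    have := congrFun this i
    rw [← this]
    simp [Matrix.smul_mulVec]
    field_simp
  refine (e1.isLocalFrameOn_localFrame_baseSet 𝓘(ℝ, E) ∞ b1).contMDiffAt_of_coeff (fun i => ?_)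
    (e1.open_baseSet.mem_nhds m1)
  have hopen : e0.baseSet ∩ e1.baseSet ∈ nhds x₀ :=
    Filter.inter_mem (e0.open_baseSet.mem_nhds m0) (e1.open_baseSet.mem_nhds m1)
  have hg : ContDiffAt ℝ ∞ (fun q : (Fin N → Fin N → ℝ) × (Fin N → ℝ) =>
      (Matrix.det (Matrix.of q.1))⁻¹ * Matrix.cramer (Matrix.of q.1) q.2 i) (a x₀, β x₀) := by
    refine ContDiffAt.mul (ContDiffAt.inv ?_ (hev x₀ ⟨m0, m1⟩).1) ?_
    · simp only [Matrix.det_apply, Matrix.of_apply]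
      fun_prop
    · simp only [Matrix.cramer_apply, Matrix.det_apply, Matrix.updateCol_apply, Matrix.of_apply]
      refine ContDiffAt.sum fun σ _ => ContDiffAt.const_smul _ (contDiffAt_prod fun j _ => ?_)
      split_ifs <;> fun_prop
  refine (hg.contMDiffAt.comp x₀ (hA.prodMk_space hβ : ContMDiffAt 𝓘(ℝ, E) _ ∞ (fun x => (a x, β x)) x₀)).congr_of_eventuallyEq ?_
  filter_upwards [hopen] with x hx
  exact (hev x hx).2 i

/-- The map `∂ : ΓE₁ → ΓE₀`. -/
def delSec (P : CLWXData E F₀ F₁ E₀ E₁) :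
    ContMDiffSection 𝓘(ℝ, E) F₁ ∞ E₁ →ₗ[ℝ] ContMDiffSection 𝓘(ℝ, E) F₀ ∞ E₀ where
  toFun s := ⟨fun x => P.del x (s x), P.contMDiff_del.clm_bundle_apply s.contMDiff⟩
  map_add' s t := by ext x; simp
  map_smul' c s := by ext x; simp

/-- The function `ρ(e)(f)`, for `e ∈ ΓE₀`. -/
def anchorDeriv (P : CLWXData E F₀ F₁ E₀ E₁) (e : ContMDiffSection 𝓘(ℝ, E) F₀ ∞ E₀)
    (f : C^∞⟮𝓘(ℝ, E), M; ℝ⟯) : M → ℝ :=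
  fun x => mvfderiv 𝓘(ℝ, E) f x (P.rho x (e x))

lemma contMDiff_pairing_apply (P : CLWXData E F₀ F₁ E₀ E₁)
    (s : ContMDiffSection 𝓘(ℝ, E) F₀ ∞ E₀) (t : ContMDiffSection 𝓘(ℝ, E) F₁ ∞ E₁) :
    ContMDiff 𝓘(ℝ, E) 𝓘(ℝ) ∞ fun x => P.pairing x (s x) (t x) := fun x₀ => by
  have h := ContMDiffAt.clm_bundle_apply₂ (F₁ := F₀) (F₂ := F₁) (F₃ := ℝ)
    (E₃ := Bundle.Trivial M ℝ) (P.contMDiff_pairing x₀) (s.contMDiff x₀) (t.contMDiff x₀)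
  rw [contMDiffAt_totalSpace] at h
  exact h.2

/-- The pairing `S : ΓE₀ ⊗ ΓE₁ → C^∞(M)`. -/
def pairSec (P : CLWXData E F₀ F₁ E₀ E₁) :
    ContMDiffSection 𝓘(ℝ, E) F₀ ∞ E₀ →ₗ[ℝ] ContMDiffSection 𝓘(ℝ, E) F₁ ∞ E₁ →ₗ[ℝ]
      C^∞⟮𝓘(ℝ, E), M; ℝ⟯ :=
  LinearMap.mk₂ ℝ (fun s t => ⟨fun x => P.pairing x (s x) (t x), P.contMDiff_pairing_apply s t⟩)
    (fun s s' t => by ext x; simp; rfl) (fun c s t => by ext x; simp; rfl)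
    (fun s t t' => by ext x; simp; rfl) (fun c s t => by ext x; simp; rfl)

/-- The trilinear map `Ω : ΓE₀ ⊗ ΓE₀ ⊗ ΓE₀ → ΓE₁`. -/
def omegaSec (P : CLWXData E F₀ F₁ E₀ E₁) :
    MultilinearMap ℝ (fun _ : Fin 3 => ContMDiffSection 𝓘(ℝ, E) F₀ ∞ E₀)
      (ContMDiffSection 𝓘(ℝ, E) F₁ ∞ E₁) :=
  MultilinearMap.mk' (fun s => ⟨fun x => P.omega x fun i => s i x, P.contMDiff_omega s⟩)
    (fun s i a b => by
      ext x
      have h : ∀ c : ContMDiffSection 𝓘(ℝ, E) F₀ ∞ E₀, (fun j => Function.update s i c j x) =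
          Function.update (fun j => s j x) i (c x) := fun c => by
        funext j
        rcases eq_or_ne j i with rfl | hj
        · simp
        · simp [hj]
      simp [h])
    (fun s i r a => by
      ext x
      have h : ∀ c : ContMDiffSection 𝓘(ℝ, E) F₀ ∞ E₀, (fun j => Function.update s i c j x) =
          Function.update (fun j => s j x) i (c x) := fun c => by
        funext j
        rcases eq_or_ne j i with rfl | hj
        · simp
        · simp [hj]
      simp [h])

lemma eq_of_pairing_eq (P : CLWXData E F₀ F₁ E₀ E₁) {s t : ContMDiffSection 𝓘(ℝ, E) F₁ ∞ E₁}
    (h : ∀ x u, P.pairing x u (s x) = P.pairing x u (t x)) : s = t := by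
  ext x
  exact sub_eq_zero.1 (P.nondeg_right x _ fun u => by rw [map_sub, h, sub_self])

/-- The map `D : C^∞(M) → ΓE₁`; `D f` is the unique section with `S(e, D f) = ρ(e)(f)`. -/
def D (P : CLWXData E F₀ F₁ E₀ E₁) :
    C^∞⟮𝓘(ℝ, E), M; ℝ⟯ →ₗ[ℝ] ContMDiffSection 𝓘(ℝ, E) F₁ ∞ E₁ where
  toFun f := (P.exists_D f).choose
  map_add' f g := P.eq_of_pairing_eq fun x u => by
    rw [(P.exists_D (f + g)).choose_spec, ContMDiffSection.coe_add, Pi.add_apply, map_add,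
      (P.exists_D f).choose_spec, (P.exists_D g).choose_spec, ContMDiffMap.coe_add,
      mvfderiv_add (f.contMDiff.mdifferentiable (by simp) x)
        (g.contMDiff.mdifferentiable (by simp) x)]
    rfl
  map_smul' c f := P.eq_of_pairing_eq fun x u => by
    rw [(P.exists_D (c • f)).choose_spec, ContMDiffSection.coe_smul, Pi.smul_apply,
      RingHom.id_apply, map_smul, (P.exists_D f).choose_spec, ContMDiffMap.coe_smul,
      show c • (f : M → ℝ) = (fun _ : M => c) • (f : M → ℝ) from rfl,
      mvfderiv_smul mdifferentiableAt_const (f.contMDiff.mdifferentiable (by simp) x)]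
    have hc : mvfderiv 𝓘(ℝ, E) (fun _ : M => c) x = 0 := by simp [mvfderiv, mfderiv_const]
    simp [hc]

theorem pairing_D (P : CLWXData E F₀ F₁ E₀ E₁) (f : C^∞⟮𝓘(ℝ, E), M; ℝ⟯) (x : M) (u : E₀ x) :
    P.pairing x u (P.D f x) = mvfderiv 𝓘(ℝ, E) f x (P.rho x u) :=
  (P.exists_D f).choose_spec x u

/-- The symmetric form `S` on `ΓE = ΓE₀ ⊕ ΓE₁`. -/
def S (P : CLWXData E F₀ F₁ E₀ E₁)
    (e e' : ContMDiffSection 𝓘(ℝ, E) F₀ ∞ E₀ × ContMDiffSection 𝓘(ℝ, E) F₁ ∞ E₁) :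
    C^∞⟮𝓘(ℝ, E), M; ℝ⟯ :=
  P.pairSec e.1 e'.2 + P.pairSec e'.1 e.2

/-- The operation `∘` on `ΓE = ΓE₀ ⊕ ΓE₁`. -/
def circ (P : CLWXData E F₀ F₁ E₀ E₁)
    (e e' : ContMDiffSection 𝓘(ℝ, E) F₀ ∞ E₀ × ContMDiffSection 𝓘(ℝ, E) F₁ ∞ E₁) :
    ContMDiffSection 𝓘(ℝ, E) F₀ ∞ E₀ × ContMDiffSection 𝓘(ℝ, E) F₁ ∞ E₁ :=
  (P.circ₀₀ e.1 e'.1, P.circ₀₁ e.1 e'.2 + P.circ₁₀ e.2 e'.1)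

/-- The differential `∂` on `ΓE = ΓE₀ ⊕ ΓE₁`. -/
def bd (P : CLWXData E F₀ F₁ E₀ E₁)
    (e : ContMDiffSection 𝓘(ℝ, E) F₀ ∞ E₀ × ContMDiffSection 𝓘(ℝ, E) F₁ ∞ E₁) :
    ContMDiffSection 𝓘(ℝ, E) F₀ ∞ E₀ × ContMDiffSection 𝓘(ℝ, E) F₁ ∞ E₁ :=
  (P.delSec e.2, 0)

/-- The 3-form `Ω` on `ΓE = ΓE₀ ⊕ ΓE₁`. -/
def Om (P : CLWXData E F₀ F₁ E₀ E₁)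
    (e₁ e₂ e₃ : ContMDiffSection 𝓘(ℝ, E) F₀ ∞ E₀ × ContMDiffSection 𝓘(ℝ, E) F₁ ∞ E₁) :
    ContMDiffSection 𝓘(ℝ, E) F₀ ∞ E₀ × ContMDiffSection 𝓘(ℝ, E) F₁ ∞ E₁ :=
  (0, P.omegaSec ![e₁.1, e₂.1, e₃.1])

/-- The defining conditions of a CLWX 2-algebroid (isotropy of `E₀` and `E₁` is built into `S`). The
first one says that `(ΓE₀ ← ΓE₁, ∘, Ω)` is a Leibniz 2-algebra, i.e. a Leibniz 3-algebra on a complex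
with zero component of degree 2. -/
structure IsCLWX2 (P : CLWXData E F₀ F₁ E₀ E₁) : Prop where
  leibniz2 : IsLeibniz3 P.delSec (0 : Unit →ₗ[ℝ] ContMDiffSection 𝓘(ℝ, E) F₁ ∞ E₁)
    (bilinOp P.circ₀₀ P.circ₀₁ P.circ₁₀) (triOp P.omegaSec) 0
  circ_self : ∀ e, P.circ e e = (0, (1 / 2 : ℝ) • P.D (P.S e e))
  S_bd : ∀ e₁ e₂, P.S (P.bd e₁) e₂ = P.S e₁ (P.bd e₂)
  anchor_S : ∀ e₁ e₂ e₃, P.anchorDeriv e₁.1 (P.S e₂ e₃) =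
    P.S (P.circ e₁ e₂) e₃ + P.S e₂ (P.circ e₁ e₃)
  S_Om : ∀ e₁ e₂ e₃ e₄, P.S (P.Om e₁ e₂ e₃) e₄ = -P.S e₃ (P.Om e₁ e₂ e₄)

/-! ### The operations on `ΓE₀ ← ΓE₁ ← C^∞(M)` -/

/-- `∘` as an operation on `ΓE₀ ⊕ ΓE₁ ⊕ C^∞(M)`. -/
def circOp (P : CLWXData E F₀ F₁ E₀ E₁) :
    Op (ContMDiffSection 𝓘(ℝ, E) F₀ ∞ E₀) (ContMDiffSection 𝓘(ℝ, E) F₁ ∞ E₁)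
      C^∞⟮𝓘(ℝ, E), M; ℝ⟯ 2 :=
  bilinOp P.circ₀₀ P.circ₀₁ P.circ₁₀

/-- `S` as an operation of degree 1 on `ΓE₀ ⊕ ΓE₁ ⊕ C^∞(M)`. -/
def SOp (P : CLWXData E F₀ F₁ E₀ E₁) :
    Op (ContMDiffSection 𝓘(ℝ, E) F₀ ∞ E₀) (ContMDiffSection 𝓘(ℝ, E) F₁ ∞ E₁)
      C^∞⟮𝓘(ℝ, E), M; ℝ⟯ 2 :=
  pairOp P.pairSec

/-- `Ω` as an operation of degree 1 on `ΓE₀ ⊕ ΓE₁ ⊕ C^∞(M)`. -/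
def OmOp (P : CLWXData E F₀ F₁ E₀ E₁) :
    Op (ContMDiffSection 𝓘(ℝ, E) F₀ ∞ E₀) (ContMDiffSection 𝓘(ℝ, E) F₁ ∞ E₁)
      C^∞⟮𝓘(ℝ, E), M; ℝ⟯ 3 :=
  triOp P.omegaSec

/-- `D` as an operation of arity 1 and degree `-1` on `ΓE₀ ⊕ ΓE₁ ⊕ C^∞(M)` (zero on `ΓE₀ ⊕ ΓE₁`). -/
def DOp (P : CLWXData E F₀ F₁ E₀ E₁) :
    Op (ContMDiffSection 𝓘(ℝ, E) F₀ ∞ E₀) (ContMDiffSection 𝓘(ℝ, E) F₁ ∞ E₁)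
      C^∞⟮𝓘(ℝ, E), M; ℝ⟯ 1 :=
  unary (diff 0 P.D)

/-- The complex `ΓE₀ ← ΓE₁ ← C^∞(M)` with differentials `∂` and `D` and the structure maps of the
weak Lie 3-algebra associated to a CLWX 2-algebroid: `λ_2 = ∘ + S ∘_2 D`, `λ_{2;1} = S`, `λ_3 = Ω`, and
all others zero. -/
def weakLie3 (P : CLWXData E F₀ F₁ E₀ E₁) :
    WeakLie3Data (ContMDiffSection 𝓘(ℝ, E) F₀ ∞ E₀) (ContMDiffSection 𝓘(ℝ, E) F₁ ∞ E₁)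
      C^∞⟮𝓘(ℝ, E), M; ℝ⟯ where
  d₁ := P.delSec
  d₂ := P.D
  l2 := P.circOp + comp P.SOp 1 1 P.DOp
  l21 := P.SOp
  l211 := 0
  l3 := P.OmOp
  l31 := 0
  l32 := 0
  l4 := 0

/-- The degree 1 component of the bracket of Liu and Sheng's Lie 3-algebra,
`[e⁰, e¹] = (e⁰ ∘ e¹ - e¹ ∘ e⁰) / 2`. -/
def lsBracket (P : CLWXData E F₀ F₁ E₀ E₁) (e : ContMDiffSection 𝓘(ℝ, E) F₀ ∞ E₀)
    (a : ContMDiffSection 𝓘(ℝ, E) F₁ ∞ E₁) : ContMDiffSection 𝓘(ℝ, E) F₁ ∞ E₁ :=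
  (1 / 2 : ℝ) • (P.circ₀₁ e a - P.circ₁₀ a e)

/-- `l` has the structure maps of the Lie 3-algebra which Liu and Sheng assign to a CLWX 2-algebroid.
The values are listed on homogeneous arguments ordered by degree, and all values on tuples whose
degrees are not listed vanish; the other orders are determined by graded skew-symmetry. -/
structure IsLiuSheng (P : CLWXData E F₀ F₁ E₀ E₁)
    (l : Lie3Data (ContMDiffSection 𝓘(ℝ, E) F₀ ∞ E₀) (ContMDiffSection 𝓘(ℝ, E) F₁ ∞ E₁)
      C^∞⟮𝓘(ℝ, E), M; ℝ⟯) : Prop where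
  d₁_eq : l.d₁ = P.delSec
  d₂_eq : l.d₂ = P.D
  l2_00 : ∀ x y, l.l2 ![(x, 0, 0), (y, 0, 0)] = (P.circ₀₀ x y, 0, 0)
  l2_01 : ∀ x a, l.l2 ![(x, 0, 0), (0, a, 0)] = (0, P.lsBracket x a, 0)
  l2_02 : ∀ x f, l.l2 ![(x, 0, 0), (0, 0, f)] = (0, 0, (1 / 2 : ℝ) • P.pairSec x (P.D f))
  l2_11 : ∀ a b, l.l2 ![(0, a, 0), (0, b, 0)] = 0
  l3_000 : ∀ x y z, l.l3 ![(x, 0, 0), (y, 0, 0), (z, 0, 0)] = (0, P.omegaSec ![x, y, z], 0)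
  l3_001 : ∀ x y a, l.l3 ![(x, 0, 0), (y, 0, 0), (0, a, 0)] =
    (0, 0, -((1 / 6 : ℝ) • (P.pairSec x (P.lsBracket y a) + P.pairSec (P.circ₀₀ x y) a
      - P.pairSec y (P.lsBracket x a))))
  l4_0000 : ∀ x y z w, l.l4 ![(x, 0, 0), (y, 0, 0), (z, 0, 0), (w, 0, 0)] =
    (0, 0, P.pairSec w (P.omegaSec ![x, y, z]))
  homog2 : IsHomog 0 l.l2
  homog3 : IsHomog 1 l.l3
  homog4 : IsHomog 2 l.l4
  skew2 : ∀ σ, perm σ l.l2 = (Equiv.Perm.sign σ : ℤ) • l.l2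
  skew3 : ∀ σ, perm σ l.l3 = (Equiv.Perm.sign σ : ℤ) • l.l3
  skew4 : ∀ σ, perm σ l.l4 = (Equiv.Perm.sign σ : ℤ) • l.l4

end CLWXData

end CLWX

end WeakLie

end

/-! Everything is a consequence of finitely many identities between `∂`, `D`, `∘`, `S` and `Ω` on
sections; they are collected in `CLWXAlgebra`, and from there on the geometry plays no role. Two of
them are not axioms but have to be derived.

The first is `∂D = 0` (`delSec_D`): `S(∂Df, a) = S(∂a, Df) = ρ(∂a)f = 0` for every section `a`, and
`S` is non-degenerate on sections because there is a global section through every vector. The second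
is `Df ∘ z = 0` (`circ₁₀_D`). Skew-symmetry of `Ω` allows the Leibniz identities for `Ω(x, ∂a, y)`
and `Ω(∂a, x, y)` to be compared, which gives `D S(x, a) ∘ y = 0`. To pass from functions of the
form `S(x, a)` to all functions, note that `f ↦ S(y, Df ∘ z)` is a derivation, namely a commutator
of vector fields plus a vector field. With `h = S(y, Df ∘ z)`, both `h` and `f h` are of the form
`S(y, b)`, so the derivation kills them, and the product rule for `f h` leaves `h² = 0`. It follows
that the anchor respects brackets (`s_d₂_comm`).

An identity between operations of the same degree need only be checked on homogeneous arguments for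
which the output degree is 0, 1 or 2 (`HomDeg.ext`). This leaves a short list of degree patterns for
each axiom. The weak Lie axioms (`isWeakLie3`) then say that `Ω` and `S` are compatible as in the
definition of a CLWX 2-algebroid, or hold because the composites in question vanish.

For the skew-symmetrization the three antisymmetrized sums are first evaluated to closed forms
(`CLWXAlgebra.skewSymm_eq`). The Lie 3-algebra identities are then verified directly. The invariance
axiom `anchor` eliminates all expressions `S(y, x ∘ a)`, after which each pattern is linear algebra
(`bdry_lie2`, `bdry_lie3`, `bdry_lie4`). The last identity (`zero_eq_shSum`) is a multiple of the
closedness relation `o_bracket` for `Ω`, paired with the fifth argument. -/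

noncomputable section

set_option linter.unusedSectionVars false
set_option linter.unusedSimpArgs false
set_option linter.unnecessarySeqFocus false

namespace WeakLie

/-! ### Homogeneous operations and their degrees -/

section Homogeneous

variable {A B C : Type*} [AddCommGroup A] [Module ℝ A] [AddCommGroup B] [Module ℝ B]
  [AddCommGroup C] [Module ℝ C]

lemma proj_zero_apply (v : Tot A B C) : proj 0 v = (v.1, 0, 0) := rfl

lemma proj_one_apply (v : Tot A B C) : proj 1 v = (0, v.2.1, 0) := rfl

lemma proj_two_apply (v : Tot A B C) : proj 2 v = (0, 0, v.2.2) := rfl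

lemma parity_apply (v : Tot A B C) : parity v = (v.1, -v.2.1, v.2.2) := rfl

lemma diff_apply (d₁ : B →ₗ[ℝ] A) (d₂ : C →ₗ[ℝ] B) (v : Tot A B C) :
    diff d₁ d₂ v = (d₁ v.2.1, d₂ v.2.2, 0) := rfl

lemma unary_apply (f : Tot A B C →ₗ[ℝ] Tot A B C) (v : Fin 1 → Tot A B C) :
    unary f v = f (v 0) := rfl

lemma sum_proj (v : Tot A B C) : ∑ j, proj j v = v := by
  simp [Fin.sum_univ_three, proj_zero_apply, proj_one_apply, proj_two_apply]

lemma proj_proj (j : Fin 3) (v : Tot A B C) : proj j (proj j v) = proj j v := by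
  fin_cases j <;> rfl

lemma proj_proj_of_ne {i j : Fin 3} (h : i ≠ j) (v : Tot A B C) : proj i (proj j v) = 0 := by
  fin_cases i <;> fin_cases j <;> first | exact absurd rfl h | rfl

/-- The automorphism acting on the component of degree `j` by `2 ^ j`. -/
def weight : Tot A B C →ₗ[ℝ] Tot A B C :=
  LinearMap.prodMap LinearMap.id
    (LinearMap.prodMap ((2 : ℝ) • LinearMap.id) ((4 : ℝ) • LinearMap.id))

lemma weight_apply (v : Tot A B C) :
    weight v = (v.1, (2 : ℝ) • v.2.1, (4 : ℝ) • v.2.2) := rfl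

lemma weight_proj (j : Fin 3) (v : Tot A B C) :
    weight (proj j v) = (2 : ℝ) ^ (j : ℕ) • proj j v := by
  fin_cases j <;>
    simp [weight_apply, proj_zero_apply, proj_one_apply, proj_two_apply] <;> norm_num

lemma proj_weight (j : Fin 3) (v : Tot A B C) :
    proj j (weight v) = (2 : ℝ) ^ (j : ℕ) • proj j v := by
  fin_cases j <;>
    simp [weight_apply, proj_zero_apply, proj_one_apply, proj_two_apply] <;> norm_num

lemma parity_pow_weight (s : ℕ) (v : Tot A B C) :
    (parity ^ s) (weight v) = weight ((parity ^ s) v) := by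
  induction s generalizing v with
  | zero => rfl
  | succ s ih =>
    rw [pow_succ, Module.End.mul_apply, Module.End.mul_apply, ← ih]
    simp [weight_apply, parity_apply]

/-- `μ` has degree `r`, expressed through the action of `weight`; unlike in `IsHomog`, the degree may
be negative. -/
def HomDeg {n : ℕ} (r : ℤ) (μ : Op A B C n) : Prop :=
  ∀ v, weight (μ v) = (2 : ℝ) ^ r • μ fun i => weight (v i)

namespace HomDeg

variable {n m k : ℕ} {r s : ℤ} {μ ν : Op A B C n}

lemma zero (r : ℤ) : HomDeg r (0 : Op A B C n) := fun v => by simp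

protected lemma add (hμ : HomDeg r μ) (hν : HomDeg r ν) : HomDeg r (μ + ν) := fun v => by
  simp only [add_apply, map_add, hμ v, hν v, smul_add]

lemma smul (c : ℝ) (hμ : HomDeg r μ) : HomDeg r (c • μ) := fun v => by
  simp only [smul_apply, map_smul, hμ v, smul_comm c]

lemma zsmul (c : ℤ) (hμ : HomDeg r μ) : HomDeg r (c • μ) := by
  rw [← Int.cast_smul_eq_zsmul ℝ]; exact hμ.smul _

lemma neg (hμ : HomDeg r μ) : HomDeg r (-μ) := by
  simpa using hμ.zsmul (-1)

lemma sub (hμ : HomDeg r μ) (hν : HomDeg r ν) : HomDeg r (μ - ν) := by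
  rw [sub_eq_add_neg]; exact hμ.add hν.neg

lemma sum {ι : Type*} {t : Finset ι} {f : ι → Op A B C n} (h : ∀ i ∈ t, HomDeg r (f i)) :
    HomDeg r (∑ i ∈ t, f i) := by
  classical
  induction t using Finset.induction_on with
  | empty => simpa using zero r
  | insert a t ha ih =>
    rw [Finset.sum_insert ha]
    exact (h a (by simp)).add (ih fun i hi => h i (by simp [hi]))

lemma perm (σ : Equiv.Perm (Fin n)) (hμ : HomDeg r μ) : HomDeg r (perm σ μ) := by
  refine sum fun e _ => zsmul _ fun v => ?_
  simp only [MultilinearMap.compLinearMap_apply, MultilinearMap.domDomCongr_apply, hμ _,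
    weight_proj, ← proj_weight]

lemma alt (hμ : HomDeg r μ) : HomDeg r (alt μ) := sum fun σ _ => (hμ.perm σ).zsmul _

lemma shSum (p : ℕ) (hμ : HomDeg r μ) : HomDeg r (shSum p μ) := sum fun σ _ => (hμ.perm σ).zsmul _

/-- `weight` commutes with the parity signs. Hence weighting the arguments changes what `μ` receives
only by a weight in each slot and a factor `2 ^ s` in slot `i`, and multilinearity pulls that factor
out. -/
lemma comp {μ : Op A B C (m + 1)} {ν : Op A B C k} (hμ : HomDeg r μ) (i : Fin (m + 1)) (p : ℕ)
    (hν : HomDeg s ν) : HomDeg (r + s) (comp μ i p ν) := fun v => by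
  change weight (μ (compArgs i p ν v)) = _ • μ (compArgs i p ν fun i => weight (v i))
  have h : (fun j => weight (compArgs i p ν v j)) =
      Function.update (compArgs i p ν fun i => weight (v i)) i
        ((2 : ℝ) ^ s • compArgs i p ν (fun i => weight (v i)) i) := by
    funext j
    rcases eq_or_ne j i with rfl | hj
    · simp [compArgs, hν _]
    · rw [Function.update_of_ne hj]
      unfold compArgs
      split_ifs with h1 h2
      · rw [parity_pow_weight]
      · rfl
      · exact absurd (le_antisymm (not_lt.1 h2) (not_lt.1 h1)) hj
  rw [hμ, h, MultilinearMap.map_update_smul, Function.update_eq_self, smul_smul,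
    ← zpow_add₀ (by norm_num)]

lemma unary_diff (d₁ : B →ₗ[ℝ] A) (d₂ : C →ₗ[ℝ] B) : HomDeg (-1) (unary (diff d₁ d₂)) := fun v => by
  simp only [unary_apply, diff_apply, weight_apply, map_smul]
  simp [smul_smul]
  norm_num

lemma bdry {μ : Op A B C (m + 1)} (hμ : HomDeg r μ) (d₁ : B →ₗ[ℝ] A) (d₂ : C →ₗ[ℝ] B) (p : ℕ) :
    HomDeg (r - 1) (bdry (diff d₁ d₂) p μ) := by
  refine sub (fun v => ?_) (smul _ (sum fun i _ => hμ.comp i 1 (unary_diff d₁ d₂)))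
  have h := unary_diff d₁ d₂ (fun _ => μ v)
  simp only [unary_apply] at h
  rw [LinearMap.compMultilinearMap_apply, LinearMap.compMultilinearMap_apply, h, hμ, map_smul,
    smul_smul, ← zpow_add₀ (by norm_num)]
  congr 2
  ring

/-- Applying `weight` to the component of degree `j` gives the factor `2 ^ j`, while homogeneity
gives 2 to the expected degree. Distinct powers of 2 differ, so the component vanishes. -/
lemma proj_eq_zero (hμ : HomDeg r μ) (e : Fin n → Fin 3) (v : Fin n → Tot A B C) (j : Fin 3)
    (hj : (j : ℤ) ≠ ∑ i, (e i : ℤ) + r) : proj j (μ fun i => proj (e i) (v i)) = 0 := by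
  have h := congrArg (proj j) (hμ fun i => proj (e i) (v i))
  simp only [weight_proj] at h
  rw [MultilinearMap.map_smul_univ, proj_weight, map_smul, map_smul, smul_smul] at h
  have h2 : (2 : ℝ) ^ r * ∏ i, (2 : ℝ) ^ (e i : ℕ) = 2 ^ (∑ i, (e i : ℤ) + r) := by
    rw [zpow_add₀ (by norm_num), mul_comm, Finset.prod_pow_eq_pow_sum, ← zpow_natCast]
    push_cast
    rfl
  rw [h2, ← zpow_natCast, ← sub_eq_zero, ← sub_smul, smul_eq_zero] at h
  refine h.resolve_left fun h0 => hj ?_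
  exact zpow_right_injective₀ (by norm_num) (by norm_num) (sub_eq_zero.1 h0)

lemma isHomog {p : ℕ} (hμ : HomDeg (p : ℤ) μ) : IsHomog p μ := fun e v j hj =>
  hμ.proj_eq_zero e v j fun h => hj (by exact_mod_cast h)

lemma apply_eq_zero (hμ : HomDeg r μ) (e : Fin n → Fin 3) (v : Fin n → Tot A B C)
    (hj : ∑ i, (e i : ℤ) + r < 0 ∨ 2 < ∑ i, (e i : ℤ) + r) :
    (μ fun i => proj (e i) (v i)) = 0 := by
  rw [← sum_proj (μ _)]
  exact Finset.sum_eq_zero fun j _ => hμ.proj_eq_zero e v j (by omega)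

end HomDeg

lemma op_ext {n : ℕ} {μ ν : Op A B C n}
    (h : ∀ (e : Fin n → Fin 3) (v : Fin n → Tot A B C), (μ fun i => proj (e i) (v i)) = ν fun i => proj (e i) (v i)) :
    μ = ν := by
  ext1 v
  have hv : v = fun i => ∑ j, proj j (v i) := funext fun i => (sum_proj _).symm
  rw [hv, MultilinearMap.map_sum, MultilinearMap.map_sum]
  exact Finset.sum_congr rfl fun e _ => h e v

/-- Degree patterns whose output degree falls outside 0, 1, 2 need no check, as both sides vanish
there. The variants below list the surviving patterns for a fixed arity and degree. -/
lemma HomDeg.ext {n : ℕ} {r : ℤ} {μ ν : Op A B C n} (hμ : HomDeg r μ) (hν : HomDeg r ν)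
    (h : ∀ (e : Fin n → Fin 3) (v : Fin n → Tot A B C), 0 ≤ ∑ i, (e i : ℤ) + r → ∑ i, (e i : ℤ) + r ≤ 2 →
      (μ fun i => proj (e i) (v i)) = ν fun i => proj (e i) (v i)) : μ = ν := by
  refine op_ext fun e v => ?_
  by_cases h1 : 0 ≤ ∑ i, (e i : ℤ) + r
  · by_cases h2 : ∑ i, (e i : ℤ) + r ≤ 2
    · exact h e v h1 h2
    · rw [hμ.apply_eq_zero e v (by omega), hν.apply_eq_zero e v (by omega)]
  · rw [hμ.apply_eq_zero e v (by omega), hν.apply_eq_zero e v (by omega)]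

lemma eta_two {α : Type*} (f : Fin 2 → α) : f = ![f 0, f 1] := by
  funext i; fin_cases i <;> rfl

lemma eta_three {α : Type*} (f : Fin 3 → α) : f = ![f 0, f 1, f 2] := by
  funext i; fin_cases i <;> rfl

lemma eta_four {α : Type*} (f : Fin 4 → α) : f = ![f 0, f 1, f 2, f 3] := by
  funext i; fin_cases i <;> rfl

lemma eta_five {α : Type*} (f : Fin 5 → α) : f = ![f 0, f 1, f 2, f 3, f 4] := by
  funext i; fin_cases i <;> rfl

namespace HomDeg

lemma ext_two {r : ℤ} {μ ν : Op A B C 2} (hμ : HomDeg r μ) (hν : HomDeg r ν)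
    (h : ∀ i j : Fin 3, 0 ≤ (i : ℤ) + j + r → (i : ℤ) + j + r ≤ 2 → ∀ x y : Tot A B C,
      μ ![proj i x, proj j y] = ν ![proj i x, proj j y]) : μ = ν := by
  refine hμ.ext hν fun e v h0 h2 => ?_
  rw [Fin.sum_univ_two] at h0 h2
  rw [eta_two fun i => proj (e i) (v i)]
  exact h _ _ h0 h2 _ _

lemma ext_three {r : ℤ} {μ ν : Op A B C 3} (hμ : HomDeg r μ) (hν : HomDeg r ν)
    (h : ∀ i j k : Fin 3, 0 ≤ (i : ℤ) + j + k + r → (i : ℤ) + j + k + r ≤ 2 →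
      ∀ x y z : Tot A B C,
        μ ![proj i x, proj j y, proj k z] = ν ![proj i x, proj j y, proj k z]) : μ = ν := by
  refine hμ.ext hν fun e v h0 h2 => ?_
  rw [Fin.sum_univ_three] at h0 h2
  rw [eta_three fun i => proj (e i) (v i)]
  exact h _ _ _ h0 h2 _ _ _

lemma ext_two_zero {μ ν : Op A B C 2} (hμ : HomDeg 0 μ) (hν : HomDeg 0 ν)
    (h00 : ∀ x y, μ ![proj 0 x, proj 0 y] = ν ![proj 0 x, proj 0 y])
    (h01 : ∀ x y, μ ![proj 0 x, proj 1 y] = ν ![proj 0 x, proj 1 y])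
    (h10 : ∀ x y, μ ![proj 1 x, proj 0 y] = ν ![proj 1 x, proj 0 y])
    (h02 : ∀ x y, μ ![proj 0 x, proj 2 y] = ν ![proj 0 x, proj 2 y])
    (h20 : ∀ x y, μ ![proj 2 x, proj 0 y] = ν ![proj 2 x, proj 0 y])
    (h11 : ∀ x y, μ ![proj 1 x, proj 1 y] = ν ![proj 1 x, proj 1 y]) : μ = ν := by
  refine hμ.ext_two hν fun i j h1 h2 x y => ?_
  fin_cases i <;> fin_cases j <;> simp at h1 h2 <;>
    first | exact h00 _ _ | exact h01 _ _ | exact h10 _ _ | exact h02 _ _ | exact h20 _ _ |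
      exact h11 _ _

lemma ext_two_neg_one {μ ν : Op A B C 2} (hμ : HomDeg (-1) μ) (hν : HomDeg (-1) ν)
    (h01 : ∀ x y, μ ![proj 0 x, proj 1 y] = ν ![proj 0 x, proj 1 y])
    (h10 : ∀ x y, μ ![proj 1 x, proj 0 y] = ν ![proj 1 x, proj 0 y])
    (h02 : ∀ x y, μ ![proj 0 x, proj 2 y] = ν ![proj 0 x, proj 2 y])
    (h20 : ∀ x y, μ ![proj 2 x, proj 0 y] = ν ![proj 2 x, proj 0 y])
    (h11 : ∀ x y, μ ![proj 1 x, proj 1 y] = ν ![proj 1 x, proj 1 y])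
    (h12 : ∀ x y, μ ![proj 1 x, proj 2 y] = ν ![proj 1 x, proj 2 y])
    (h21 : ∀ x y, μ ![proj 2 x, proj 1 y] = ν ![proj 2 x, proj 1 y]) : μ = ν := by
  refine hμ.ext_two hν fun i j h1 h2 x y => ?_
  fin_cases i <;> fin_cases j <;> simp at h1 h2 <;>
    first | exact h01 _ _ | exact h10 _ _ | exact h02 _ _ | exact h20 _ _ |
      exact h11 _ _ | exact h12 _ _ | exact h21 _ _

lemma ext_two_one {μ ν : Op A B C 2} (hμ : HomDeg 1 μ) (hν : HomDeg 1 ν)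
    (h00 : ∀ x y, μ ![proj 0 x, proj 0 y] = ν ![proj 0 x, proj 0 y])
    (h01 : ∀ x y, μ ![proj 0 x, proj 1 y] = ν ![proj 0 x, proj 1 y])
    (h10 : ∀ x y, μ ![proj 1 x, proj 0 y] = ν ![proj 1 x, proj 0 y]) : μ = ν := by
  refine hμ.ext_two hν fun i j h1 h2 x y => ?_
  fin_cases i <;> fin_cases j <;> simp at h1 h2 <;>
    first | exact h00 _ _ | exact h01 _ _ | exact h10 _ _

lemma ext_three_one {μ ν : Op A B C 3} (hμ : HomDeg 1 μ) (hν : HomDeg 1 ν)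
    (h000 : ∀ x y z, μ ![proj 0 x, proj 0 y, proj 0 z] = ν ![proj 0 x, proj 0 y, proj 0 z])
    (h001 : ∀ x y z, μ ![proj 0 x, proj 0 y, proj 1 z] = ν ![proj 0 x, proj 0 y, proj 1 z])
    (h010 : ∀ x y z, μ ![proj 0 x, proj 1 y, proj 0 z] = ν ![proj 0 x, proj 1 y, proj 0 z])
    (h100 : ∀ x y z, μ ![proj 1 x, proj 0 y, proj 0 z] = ν ![proj 1 x, proj 0 y, proj 0 z]) :
    μ = ν := by
  refine hμ.ext_three hν fun i j k h1 h2 x y z => ?_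
  fin_cases i <;> fin_cases j <;> fin_cases k <;> simp at h1 h2 <;>
    first | exact h000 _ _ _ | exact h001 _ _ _ | exact h010 _ _ _ | exact h100 _ _ _

lemma ext_three_zero {μ ν : Op A B C 3} (hμ : HomDeg 0 μ) (hν : HomDeg 0 ν)
    (h000 : ∀ x y z, μ ![proj 0 x, proj 0 y, proj 0 z] = ν ![proj 0 x, proj 0 y, proj 0 z])
    (h001 : ∀ x y z, μ ![proj 0 x, proj 0 y, proj 1 z] = ν ![proj 0 x, proj 0 y, proj 1 z])
    (h010 : ∀ x y z, μ ![proj 0 x, proj 1 y, proj 0 z] = ν ![proj 0 x, proj 1 y, proj 0 z])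
    (h100 : ∀ x y z, μ ![proj 1 x, proj 0 y, proj 0 z] = ν ![proj 1 x, proj 0 y, proj 0 z])
    (h002 : ∀ x y z, μ ![proj 0 x, proj 0 y, proj 2 z] = ν ![proj 0 x, proj 0 y, proj 2 z])
    (h020 : ∀ x y z, μ ![proj 0 x, proj 2 y, proj 0 z] = ν ![proj 0 x, proj 2 y, proj 0 z])
    (h200 : ∀ x y z, μ ![proj 2 x, proj 0 y, proj 0 z] = ν ![proj 2 x, proj 0 y, proj 0 z])
    (h011 : ∀ x y z, μ ![proj 0 x, proj 1 y, proj 1 z] = ν ![proj 0 x, proj 1 y, proj 1 z])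
    (h101 : ∀ x y z, μ ![proj 1 x, proj 0 y, proj 1 z] = ν ![proj 1 x, proj 0 y, proj 1 z])
    (h110 : ∀ x y z, μ ![proj 1 x, proj 1 y, proj 0 z] = ν ![proj 1 x, proj 1 y, proj 0 z]) :
    μ = ν := by
  refine hμ.ext_three hν fun i j k h1 h2 x y z => ?_
  fin_cases i <;> fin_cases j <;> fin_cases k <;> simp at h1 h2 <;>
    first | exact h000 _ _ _ | exact h001 _ _ _ | exact h010 _ _ _ | exact h100 _ _ _ |
      exact h002 _ _ _ | exact h020 _ _ _ | exact h200 _ _ _ | exact h011 _ _ _ |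
      exact h101 _ _ _ | exact h110 _ _ _

lemma ext_four_one {μ ν : Op A B C 4} (hμ : HomDeg 1 μ) (hν : HomDeg 1 ν)
    (h0000 : ∀ x y z w, μ ![proj 0 x, proj 0 y, proj 0 z, proj 0 w] =
      ν ![proj 0 x, proj 0 y, proj 0 z, proj 0 w])
    (h0001 : ∀ x y z w, μ ![proj 0 x, proj 0 y, proj 0 z, proj 1 w] =
      ν ![proj 0 x, proj 0 y, proj 0 z, proj 1 w])
    (h0010 : ∀ x y z w, μ ![proj 0 x, proj 0 y, proj 1 z, proj 0 w] =
      ν ![proj 0 x, proj 0 y, proj 1 z, proj 0 w])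
    (h0100 : ∀ x y z w, μ ![proj 0 x, proj 1 y, proj 0 z, proj 0 w] =
      ν ![proj 0 x, proj 1 y, proj 0 z, proj 0 w])
    (h1000 : ∀ x y z w, μ ![proj 1 x, proj 0 y, proj 0 z, proj 0 w] =
      ν ![proj 1 x, proj 0 y, proj 0 z, proj 0 w]) : μ = ν := by
  refine hμ.ext hν fun e v h1 h2 => ?_
  rw [Fin.sum_univ_four] at h1 h2
  rw [eta_four fun i => proj (e i) (v i)]
  generalize e 0 = i at *
  generalize e 1 = j at *
  generalize e 2 = k at *
  generalize e 3 = l at *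
  -- The degrees are non-negative and add up to at most 1.
  have hc : (i = 0 ∧ j = 0 ∧ k = 0 ∧ l = 0) ∨ (i = 0 ∧ j = 0 ∧ k = 0 ∧ l = 1) ∨
      (i = 0 ∧ j = 0 ∧ k = 1 ∧ l = 0) ∨ (i = 0 ∧ j = 1 ∧ k = 0 ∧ l = 0) ∨
      (i = 1 ∧ j = 0 ∧ k = 0 ∧ l = 0) := by
    simp only [Fin.ext_iff]
    simp
    omega
  rcases hc with ⟨rfl, rfl, rfl, rfl⟩ | ⟨rfl, rfl, rfl, rfl⟩ | ⟨rfl, rfl, rfl, rfl⟩ |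
    ⟨rfl, rfl, rfl, rfl⟩ | ⟨rfl, rfl, rfl, rfl⟩
  exacts [h0000 _ _ _ _, h0001 _ _ _ _, h0010 _ _ _ _, h0100 _ _ _ _, h1000 _ _ _ _]

/-- An operation of degree 2 can be non-zero only if all arguments have degree 0, since no component
of degree above 2 exists. -/
lemma ext_two_deg {n : ℕ} {μ ν : Op A B C n} (hμ : HomDeg 2 μ) (hν : HomDeg 2 ν)
    (h : ∀ v : Fin n → Tot A B C, (μ fun i => proj 0 (v i)) = ν fun i => proj 0 (v i)) : μ = ν := by
  refine hμ.ext hν fun e v h1 h2 => ?_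
  have he : ∀ i, e i = 0 := fun i => by
    have : (e i : ℤ) ≤ ∑ i, (e i : ℤ) :=
      Finset.single_le_sum (f := fun i => (e i : ℤ)) (fun i _ => by positivity) (Finset.mem_univ i)
    ext
    simp only [Fin.val_zero]
    omega
  simp only [he]
  exact h v

end HomDeg

end Homogeneous

/-! ### Koszul signs and the action of the symmetric group -/

section Permutations

lemma perm_inv_apply {n : ℕ} (σ : Equiv.Perm (Fin n)) (i : Fin n) : σ⁻¹ (σ i) = i :=
  σ.symm_apply_apply i

/-- The condition for an inversion is put in a form symmetric in `i` and `j`, so that the factor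
depends on the unordered pair only and the product can be relabelled by a permutation. -/
lemma koszulSign_eq_prod {n : ℕ} (σ : Equiv.Perm (Fin n)) (e : Fin n → Fin 3) :
    koszulSign σ e = ∏ j, ∏ i ∈ Finset.Iio j,
      if i < j ↔ σ i < σ j then 1 else (-1) ^ ((e i : ℕ) * (e j : ℕ)) := by
  rw [koszulSign, Finset.prod_comm]
  refine Finset.prod_congr rfl fun j _ => ?_
  rw [← Finset.prod_subset (Finset.subset_univ (Finset.Iio j))]
  · refine Finset.prod_congr rfl fun i hi => ?_
    have hij : i < j := Finset.mem_Iio.1 hi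
    have hne : σ i ≠ σ j := fun h => hij.ne (σ.injective h)
    rcases lt_or_gt_of_ne hne with h | h
    · rw [if_neg fun h' => (lt_asymm h h'.2).elim, if_pos ⟨fun _ => h, fun _ => hij⟩]
    · rw [if_pos ⟨hij, h⟩, if_neg fun h' => (lt_asymm h (h'.1 hij)).elim]
  · intro i _ hi
    rw [if_neg fun h => hi (Finset.mem_Iio.2 h.1)]

/-- A permutation acts on unordered pairs. The known antisymmetric version produces the sign of `σ`;
it is applied to `s` and to `s * H`, and the sign cancels. -/
lemma prod_Iio_comp_of_symm {n : ℕ} (σ : Equiv.Perm (Fin n)) (H : Fin n → Fin n → ℤ)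
    (hH : ∀ i j, H i j = H j i) :
    ∏ j, ∏ i ∈ Finset.Iio j, H (σ i) (σ j) = ∏ j, ∏ i ∈ Finset.Iio j, H i j := by
  -- An antisymmetric function whose product over all pairs `i < j` is 1.
  let s : Fin n → Fin n → ℤ := fun i j => if i < j then 1 else if j < i then -1 else 0
  have hs : ∀ i j, s i j = -s j i := fun i j => by
    rcases lt_trichotomy i j with h | h | h <;> simp [s, h, lt_asymm]
  have h1 := σ.prod_Iio_comp_eq_sign_mul_prod (f := s) hs
  have h2 := σ.prod_Iio_comp_eq_sign_mul_prod (f := fun i j => s i j * H i j)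
    fun i j => by rw [hs, hH, neg_mul]
  have h3 : ∏ j, ∏ i ∈ Finset.Iio j, s i j = 1 :=
    Finset.prod_eq_one fun j _ => Finset.prod_eq_one fun i hi => if_pos (Finset.mem_Iio.1 hi)
  simp only [Finset.prod_mul_distrib, h1, h3, mul_one, one_mul] at h2
  exact mul_left_cancel₀ (by simp) h2

/-- The cocycle property that makes `perm` an action: `σ * τ` reverses a pair exactly when one but
not both of `τ` and (on the relabelled pair) `σ` does, and two reversals contribute a square of
`±1`. -/
lemma koszulSign_mul {n : ℕ} (σ τ : Equiv.Perm (Fin n)) (e : Fin n → Fin 3) :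
    koszulSign (σ * τ) e = koszulSign τ e * koszulSign σ (fun i => e (τ⁻¹ i)) := by
  rw [koszulSign_eq_prod, koszulSign_eq_prod, koszulSign_eq_prod]
  rw [← prod_Iio_comp_of_symm τ (fun i j => if i < j ↔ σ i < σ j then (1 : ℤ) else
    (-1) ^ ((e (τ⁻¹ i) : ℕ) * (e (τ⁻¹ j) : ℕ)))]
  · rw [← Finset.prod_mul_distrib]
    refine Finset.prod_congr rfl fun j _ => ?_
    rw [← Finset.prod_mul_distrib]
    refine Finset.prod_congr rfl fun i _ => ?_
    simp only [perm_inv_apply, Equiv.Perm.mul_apply]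
    have hsq : ((-1 : ℤ) ^ ((e i : ℕ) * (e j : ℕ))) * (-1) ^ ((e i : ℕ) * (e j : ℕ)) = 1 := by
      rw [← mul_pow]; norm_num
    by_cases h1 : i < j <;> by_cases h2 : τ i < τ j <;> by_cases h3 : σ (τ i) < σ (τ j) <;>
      simp [h1, h2, h3, hsq]
  · intro i j
    rcases eq_or_ne i j with rfl | h
    · simp
    have hσ : σ i ≠ σ j := fun h' => h (σ.injective h')
    have h1 : j < i ↔ ¬ i < j := by rw [not_lt]; exact ⟨le_of_lt, fun h' => lt_of_le_of_ne h' h.symm⟩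
    have h2 : σ j < σ i ↔ ¬ σ i < σ j := by
      rw [not_lt]; exact ⟨le_of_lt, fun h' => lt_of_le_of_ne h' hσ.symm⟩
    simp only [h1, h2, not_iff_not, mul_comm (e (τ⁻¹ i) : ℕ)]

lemma koszulSign_one {n : ℕ} (e : Fin n → Fin 3) : koszulSign 1 e = 1 := by
  rw [koszulSign_eq_prod]
  simp

/-- Signs arise only from exchanging two odd arguments; the hypothesis says that at most one
argument is odd. -/
lemma koszulSign_of_even {n : ℕ} (σ : Equiv.Perm (Fin n)) (e : Fin n → Fin 3)
    (h : ∀ i j, i < j → (e i : ℕ) * (e j : ℕ) % 2 = 0) : koszulSign σ e = 1 := by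
  rw [koszulSign]
  refine Finset.prod_eq_one fun i _ => Finset.prod_eq_one fun j _ => ?_
  split_ifs with hij
  · exact (Nat.even_iff.2 (h i j hij.1)).neg_one_pow
  · rfl

variable {A B C : Type*} [AddCommGroup A] [Module ℝ A] [AddCommGroup B] [Module ℝ B]
  [AddCommGroup C] [Module ℝ C] {n : ℕ}

lemma perm_apply_proj (σ : Equiv.Perm (Fin n)) (μ : Op A B C n) (e : Fin n → Fin 3)
    (v : Fin n → Tot A B C) :
    (perm σ μ fun i => proj (e i) (v i)) =
      koszulSign σ e • μ fun i => proj (e (σ⁻¹ i)) (v (σ⁻¹ i)) := by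
  rw [perm, sum_apply, Finset.sum_eq_single e]
  · rw [smul_apply, MultilinearMap.compLinearMap_apply, MultilinearMap.domDomCongr_apply]
    simp only [proj_proj]
  · intro e' _ he'
    -- A multi-index other than `e` projects some argument to a wrong degree, and that zero sits in
    -- slot `σ i`.
    obtain ⟨i, hi⟩ := Function.ne_iff.1 he'
    rw [smul_apply, MultilinearMap.compLinearMap_apply, MultilinearMap.domDomCongr_apply,
      MultilinearMap.map_coord_zero _ (σ i), smul_zero]
    simp only [perm_inv_apply]
    exact proj_proj_of_ne hi _
  · simp

lemma perm_one (μ : Op A B C n) : perm 1 μ = μ := op_ext fun e v => by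
  rw [perm_apply_proj, koszulSign_one, one_smul]
  rfl

lemma perm_perm (σ τ : Equiv.Perm (Fin n)) (μ : Op A B C n) :
    perm τ (perm σ μ) = perm (σ * τ) μ := op_ext fun e v => by
  rw [perm_apply_proj, perm_apply_proj σ μ (fun i => e (τ⁻¹ i)), perm_apply_proj,
    koszulSign_mul, mul_smul]
  rfl

/-- Permuting the arguments, as an additive map. -/
def permHom (σ : Equiv.Perm (Fin n)) : Op A B C n →+ Op A B C n where
  toFun := perm σ
  map_zero' := by
    refine Finset.sum_eq_zero fun e _ => ?_
    ext1 v
    simp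
  map_add' μ ν := op_ext fun e v => by
    simp only [add_apply, perm_apply_proj, smul_add]

lemma perm_zero (σ : Equiv.Perm (Fin n)) : perm σ (0 : Op A B C n) = 0 := (permHom σ).map_zero

lemma perm_add (σ : Equiv.Perm (Fin n)) (μ ν : Op A B C n) :
    perm σ (μ + ν) = perm σ μ + perm σ ν := (permHom σ).map_add μ ν

lemma perm_neg (σ : Equiv.Perm (Fin n)) (μ : Op A B C n) :
    perm σ (-μ) = -perm σ μ := (permHom σ).map_neg μ

lemma perm_sub (σ : Equiv.Perm (Fin n)) (μ ν : Op A B C n) :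
    perm σ (μ - ν) = perm σ μ - perm σ ν := (permHom σ).map_sub μ ν

lemma perm_zsmul (σ : Equiv.Perm (Fin n)) (c : ℤ) (μ : Op A B C n) :
    perm σ (c • μ) = c • perm σ μ := (permHom σ).map_zsmul c μ

lemma perm_sum {ι : Type*} (σ : Equiv.Perm (Fin n)) (s : Finset ι) (f : ι → Op A B C n) :
    perm σ (∑ i ∈ s, f i) = ∑ i ∈ s, perm σ (f i) := map_sum (permHom σ) f s

lemma perm_smul (σ : Equiv.Perm (Fin n)) (c : ℝ) (μ : Op A B C n) :
    perm σ (c • μ) = c • perm σ μ := op_ext fun e v => by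
  simp only [smul_apply, perm_apply_proj, smul_comm c]

lemma alt_add (μ ν : Op A B C n) : alt (μ + ν) = alt μ + alt ν := by
  simp only [alt, perm_add, smul_add, Finset.sum_add_distrib]

lemma alt_zero : alt (0 : Op A B C n) = 0 := by simp [alt, perm_zero]

lemma alt_neg (μ : Op A B C n) : alt (-μ) = -alt μ := by
  simp only [alt, perm_neg, smul_neg, Finset.sum_neg_distrib]

lemma alt_sub (μ ν : Op A B C n) : alt (μ - ν) = alt μ - alt ν := by
  rw [sub_eq_add_neg, alt_add, alt_neg, ← sub_eq_add_neg]

/-- Graded skew-symmetric operations. -/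
def IsSkew (μ : Op A B C n) : Prop := ∀ σ, perm σ μ = (Equiv.Perm.sign σ : ℤ) • μ

lemma sign_mul_self (σ : Equiv.Perm (Fin n)) :
    (Equiv.Perm.sign σ : ℤ) * (Equiv.Perm.sign σ : ℤ) = 1 := by
  rw [← Units.val_mul, Int.units_mul_self, Units.val_one]

/-- Acting by `τ` only reindexes the sum by right multiplication, at the price of the sign of `τ`.
-/
lemma isSkew_alt (μ : Op A B C n) : IsSkew (alt μ) := fun τ => by
  rw [alt, perm_sum, Finset.smul_sum, ← Equiv.sum_comp (Equiv.mulRight τ)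
    (fun σ => (Equiv.Perm.sign τ : ℤ) • (Equiv.Perm.sign σ : ℤ) • perm σ μ)]
  refine Finset.sum_congr rfl fun σ _ => ?_
  rw [perm_zsmul, perm_perm, Equiv.coe_mulRight, Equiv.Perm.sign_mul, Units.val_mul, smul_smul,
    mul_comm, mul_assoc, sign_mul_self, mul_one]

lemma alt_perm (τ : Equiv.Perm (Fin n)) (μ : Op A B C n) :
    alt (perm τ μ) = (Equiv.Perm.sign τ : ℤ) • alt μ := by
  rw [alt, alt, Finset.smul_sum, ← Equiv.sum_comp (Equiv.mulLeft τ)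
    (fun σ => (Equiv.Perm.sign τ : ℤ) • (Equiv.Perm.sign σ : ℤ) • perm σ μ)]
  refine Finset.sum_congr rfl fun σ _ => ?_
  rw [perm_perm, Equiv.coe_mulLeft, Equiv.Perm.sign_mul, Units.val_mul, smul_smul,
    ← mul_assoc, sign_mul_self, one_mul]

lemma IsSkew.alt_eq {μ : Op A B C n} (h : IsSkew μ) : alt μ = (n.factorial : ℝ) • μ := by
  have : ∀ σ, (Equiv.Perm.sign σ : ℤ) • perm σ μ = μ := fun σ => by
    rw [h σ, smul_smul, sign_mul_self, one_smul]
  simp only [alt, this, Finset.sum_const, Finset.card_univ, Fintype.card_perm, Fintype.card_fin]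
  rw [← Nat.cast_smul_eq_nsmul ℝ]

lemma IsSkew.smul {μ : Op A B C n} (h : IsSkew μ) (c : ℝ) : IsSkew (c • μ) := fun σ => by
  rw [perm_smul, h σ, smul_comm]

lemma IsSkew.sub {μ ν : Op A B C n} (hμ : IsSkew μ) (hν : IsSkew ν) : IsSkew (μ - ν) := fun σ => by
  rw [perm_sub, hμ σ, hν σ, smul_sub]

lemma perm_apply_proj_of_even (σ : Equiv.Perm (Fin n)) (μ : Op A B C n) {e : Fin n → Fin 3}
    (h : ∀ i j, i < j → (e i : ℕ) * (e j : ℕ) % 2 = 0) (v : Fin n → Tot A B C) :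
    (perm σ μ fun i => proj (e i) (v i)) = μ fun i => proj (e (σ⁻¹ i)) (v (σ⁻¹ i)) := by
  rw [perm_apply_proj, koszulSign_of_even σ e h, one_smul]

lemma perm_apply_proj_zero (σ : Equiv.Perm (Fin n)) (μ : Op A B C n) (v : Fin n → Tot A B C) :
    (perm σ μ fun i => proj 0 (v i)) = μ fun i => proj 0 (v (σ⁻¹ i)) :=
  perm_apply_proj_of_even σ μ (e := fun _ => 0) (by simp) v

end Permutations

/-! ### Explicit values of permuted, composed and shuffled operations -/

section Evaluation

variable {A B C : Type*} [AddCommGroup A] [Module ℝ A] [AddCommGroup B] [Module ℝ B]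
  [AddCommGroup C] [Module ℝ C]

lemma parity_pow_zero (v : Tot A B C) : (parity ^ 0) v = v := rfl

lemma parity_pow_one (v : Tot A B C) : (parity ^ 1) v = parity v := by rw [pow_one]

/-- The digits in the names of these lemmas give the order in which the arguments reach `μ`. The
Koszul sign depends on the degrees alone, so it is settled by running through all degree patterns.
-/
lemma perm_apply_10 (μ : Op A B C 2) (i j : Fin 3) (x y : Tot A B C) :
    perm (List.formPerm [0, 1]) μ ![proj i x, proj j y] =
      (-1 : ℤ) ^ ((i : ℕ) * j) • μ ![proj j y, proj i x] := by
  have hk : koszulSign (List.formPerm [0, 1] : Equiv.Perm (Fin 2)) ![i, j] =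
      (-1 : ℤ) ^ ((i : ℕ) * j) := by
    revert i j
    decide +kernel
  have h := perm_apply_proj (List.formPerm [0, 1]) μ ![i, j] ![x, y]
  rw [hk] at h
  refine Eq.trans (congrArg (perm _ μ) (funext fun t => ?_))
    (h.trans (congrArg _ (congrArg μ (funext fun t => ?_)))) <;> fin_cases t <;> rfl

lemma perm_apply_102 (μ : Op A B C 3) (i j k : Fin 3) (x y z : Tot A B C) :
    perm (List.formPerm [0, 1]) μ ![proj i x, proj j y, proj k z] =
      (-1 : ℤ) ^ ((i : ℕ) * j) • μ ![proj j y, proj i x, proj k z] := by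
  have hk : koszulSign (List.formPerm [0, 1] : Equiv.Perm (Fin 3)) ![i, j, k] =
      (-1 : ℤ) ^ ((i : ℕ) * j) := by
    revert i j k
    decide +kernel
  have h := perm_apply_proj (List.formPerm [0, 1]) μ ![i, j, k] ![x, y, z]
  rw [hk] at h
  refine Eq.trans (congrArg (perm _ μ) (funext fun t => ?_))
    (h.trans (congrArg _ (congrArg μ (funext fun t => ?_)))) <;> fin_cases t <;> rfl

lemma perm_apply_021 (μ : Op A B C 3) (i j k : Fin 3) (x y z : Tot A B C) :
    perm (List.formPerm [1, 2]) μ ![proj i x, proj j y, proj k z] =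
      (-1 : ℤ) ^ ((j : ℕ) * k) • μ ![proj i x, proj k z, proj j y] := by
  have hk : koszulSign (List.formPerm [1, 2] : Equiv.Perm (Fin 3)) ![i, j, k] =
      (-1 : ℤ) ^ ((j : ℕ) * k) := by
    revert i j k
    decide +kernel
  have h := perm_apply_proj (List.formPerm [1, 2]) μ ![i, j, k] ![x, y, z]
  rw [hk] at h
  refine Eq.trans (congrArg (perm _ μ) (funext fun t => ?_))
    (h.trans (congrArg _ (congrArg μ (funext fun t => ?_)))) <;> fin_cases t <;> rfl

lemma perm_apply_120 (μ : Op A B C 3) (i j k : Fin 3) (x y z : Tot A B C) :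
    perm (List.formPerm [0, 2, 1]) μ ![proj i x, proj j y, proj k z] =
      (-1 : ℤ) ^ ((i : ℕ) * j + (i : ℕ) * k) • μ ![proj j y, proj k z, proj i x] := by
  have hk : koszulSign (List.formPerm [0, 2, 1] : Equiv.Perm (Fin 3)) ![i, j, k] =
      (-1 : ℤ) ^ ((i : ℕ) * j + (i : ℕ) * k) := by
    revert i j k
    decide +kernel
  have h := perm_apply_proj (List.formPerm [0, 2, 1]) μ ![i, j, k] ![x, y, z]
  rw [hk] at h
  refine Eq.trans (congrArg (perm _ μ) (funext fun t => ?_))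
    (h.trans (congrArg _ (congrArg μ (funext fun t => ?_)))) <;> fin_cases t <;> rfl

lemma perm_apply_1023 (μ : Op A B C 4) (i j k l : Fin 3) (x y z w : Tot A B C) :
    perm (List.formPerm [0, 1]) μ ![proj i x, proj j y, proj k z, proj l w] =
      (-1 : ℤ) ^ ((i : ℕ) * j) • μ ![proj j y, proj i x, proj k z, proj l w] := by
  have hk : koszulSign (List.formPerm [0, 1] : Equiv.Perm (Fin 4)) ![i, j, k, l] =
      (-1 : ℤ) ^ ((i : ℕ) * j) := by
    revert i j k l
    decide +kernel
  have h := perm_apply_proj (List.formPerm [0, 1]) μ ![i, j, k, l] ![x, y, z, w]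
  rw [hk] at h
  refine Eq.trans (congrArg (perm _ μ) (funext fun t => ?_))
    (h.trans (congrArg _ (congrArg μ (funext fun t => ?_)))) <;> fin_cases t <;> rfl

lemma perm_apply_0213 (μ : Op A B C 4) (i j k l : Fin 3) (x y z w : Tot A B C) :
    perm (List.formPerm [1, 2]) μ ![proj i x, proj j y, proj k z, proj l w] =
      (-1 : ℤ) ^ ((j : ℕ) * k) • μ ![proj i x, proj k z, proj j y, proj l w] := by
  have hk : koszulSign (List.formPerm [1, 2] : Equiv.Perm (Fin 4)) ![i, j, k, l] =
      (-1 : ℤ) ^ ((j : ℕ) * k) := by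
    revert i j k l
    decide +kernel
  have h := perm_apply_proj (List.formPerm [1, 2]) μ ![i, j, k, l] ![x, y, z, w]
  rw [hk] at h
  refine Eq.trans (congrArg (perm _ μ) (funext fun t => ?_))
    (h.trans (congrArg _ (congrArg μ (funext fun t => ?_)))) <;> fin_cases t <;> rfl

lemma perm_apply_2013 (μ : Op A B C 4) (i j k l : Fin 3) (x y z w : Tot A B C) :
    perm (List.formPerm [0, 1, 2]) μ ![proj i x, proj j y, proj k z, proj l w] =
      (-1 : ℤ) ^ ((i : ℕ) * k + (j : ℕ) * k) • μ ![proj k z, proj i x, proj j y, proj l w] := by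
  have hk : koszulSign (List.formPerm [0, 1, 2] : Equiv.Perm (Fin 4)) ![i, j, k, l] =
      (-1 : ℤ) ^ ((i : ℕ) * k + (j : ℕ) * k) := by
    revert i j k l
    decide +kernel
  have h := perm_apply_proj (List.formPerm [0, 1, 2]) μ ![i, j, k, l] ![x, y, z, w]
  rw [hk] at h
  refine Eq.trans (congrArg (perm _ μ) (funext fun t => ?_))
    (h.trans (congrArg _ (congrArg μ (funext fun t => ?_)))) <;> fin_cases t <;> rfl

lemma perm_apply_1203 (μ : Op A B C 4) (i j k l : Fin 3) (x y z w : Tot A B C) :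
    perm (List.formPerm [0, 2, 1]) μ ![proj i x, proj j y, proj k z, proj l w] =
      (-1 : ℤ) ^ ((i : ℕ) * j + (i : ℕ) * k) • μ ![proj j y, proj k z, proj i x, proj l w] := by
  have hk : koszulSign (List.formPerm [0, 2, 1] : Equiv.Perm (Fin 4)) ![i, j, k, l] =
      (-1 : ℤ) ^ ((i : ℕ) * j + (i : ℕ) * k) := by
    revert i j k l
    decide +kernel
  have h := perm_apply_proj (List.formPerm [0, 2, 1]) μ ![i, j, k, l] ![x, y, z, w]
  rw [hk] at h
  refine Eq.trans (congrArg (perm _ μ) (funext fun t => ?_))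
    (h.trans (congrArg _ (congrArg μ (funext fun t => ?_)))) <;> fin_cases t <;> rfl

/-- With at most one odd argument only the signs of the unshuffles remain. This covers every pattern
occurring in the identities of arity 4 and 5. -/
lemma shSum_four_two_apply (μ : Op A B C 4) {e : Fin 4 → Fin 3}
    (he : ∀ i j, i < j → (e i : ℕ) * (e j : ℕ) % 2 = 0) (v w : Fin 4 → Tot A B C)
    (hw : ∀ i, w i = proj (e i) (v i)) :
    shSum 2 μ w =
      μ ![w 0, w 1, w 2, w 3]
      - μ ![w 0, w 2, w 1, w 3]
      + μ ![w 0, w 3, w 1, w 2]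
      + μ ![w 1, w 2, w 0, w 3]
      - μ ![w 1, w 3, w 0, w 2]
      + μ ![w 2, w 3, w 0, w 1] := by
  -- The unshuffles in cycle notation; slot `a` receives the argument with index `σ⁻¹ a`.
  have hs : (unshuffles 4 2).val =
      {1, List.formPerm [1, 2], List.formPerm [1, 2, 3], List.formPerm [0, 2, 1], List.formPerm [0, 2, 3, 1], List.formPerm [0, 2] * List.formPerm [1, 3]} := by
    decide +kernel
  obtain rfl : w = fun i => proj (e i) (v i) := funext hw
  have hp : ∀ (σ : Equiv.Perm (Fin 4)) (f : Fin 4 → Tot A B C) (c : ℤ),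
      (Equiv.Perm.sign σ : ℤ) = c → (∀ i, f i = proj (e (σ⁻¹ i)) (v (σ⁻¹ i))) →
      ((Equiv.Perm.sign σ : ℤ) • perm σ μ) (fun i => proj (e i) (v i)) = c • μ f := by
    rintro σ f c rfl hf
    rw [smul_apply, perm_apply_proj_of_even σ μ he, funext hf]
  rw [shSum, sum_apply, Finset.sum, hs]
  simp only [Multiset.insert_eq_cons, Multiset.map_cons, Multiset.map_singleton,
    Multiset.sum_cons, Multiset.sum_singleton]
  rw [hp (1) ![proj (e 0) (v 0), proj (e 1) (v 1), proj (e 2) (v 2), proj (e 3) (v 3)] (1) (by decide +kernel)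
      (fun t => by fin_cases t <;> rfl),
    hp (List.formPerm [1, 2]) ![proj (e 0) (v 0), proj (e 2) (v 2), proj (e 1) (v 1), proj (e 3) (v 3)] (-1) (by decide +kernel)
      (fun t => by fin_cases t <;> rfl),
    hp (List.formPerm [1, 2, 3]) ![proj (e 0) (v 0), proj (e 3) (v 3), proj (e 1) (v 1), proj (e 2) (v 2)] (1) (by decide +kernel)
      (fun t => by fin_cases t <;> rfl),
    hp (List.formPerm [0, 2, 1]) ![proj (e 1) (v 1), proj (e 2) (v 2), proj (e 0) (v 0), proj (e 3) (v 3)] (1) (by decide +kernel)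
      (fun t => by fin_cases t <;> rfl),
    hp (List.formPerm [0, 2, 3, 1]) ![proj (e 1) (v 1), proj (e 3) (v 3), proj (e 0) (v 0), proj (e 2) (v 2)] (-1) (by decide +kernel)
      (fun t => by fin_cases t <;> rfl),
    hp (List.formPerm [0, 2] * List.formPerm [1, 3]) ![proj (e 2) (v 2), proj (e 3) (v 3), proj (e 0) (v 0), proj (e 1) (v 1)] (1) (by decide +kernel)
      (fun t => by fin_cases t <;> rfl)]
  module

lemma shSum_four_three_apply (μ : Op A B C 4) {e : Fin 4 → Fin 3}
    (he : ∀ i j, i < j → (e i : ℕ) * (e j : ℕ) % 2 = 0) (v w : Fin 4 → Tot A B C)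
    (hw : ∀ i, w i = proj (e i) (v i)) :
    shSum 3 μ w =
      μ ![w 0, w 1, w 2, w 3]
      - μ ![w 0, w 1, w 3, w 2]
      + μ ![w 0, w 2, w 3, w 1]
      - μ ![w 1, w 2, w 3, w 0] := by
  have hs : (unshuffles 4 3).val =
      {1, List.formPerm [2, 3], List.formPerm [1, 3, 2], List.formPerm [0, 3, 2, 1]} := by
    decide +kernel
  obtain rfl : w = fun i => proj (e i) (v i) := funext hw
  have hp : ∀ (σ : Equiv.Perm (Fin 4)) (f : Fin 4 → Tot A B C) (c : ℤ),
      (Equiv.Perm.sign σ : ℤ) = c → (∀ i, f i = proj (e (σ⁻¹ i)) (v (σ⁻¹ i))) →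
      ((Equiv.Perm.sign σ : ℤ) • perm σ μ) (fun i => proj (e i) (v i)) = c • μ f := by
    rintro σ f c rfl hf
    rw [smul_apply, perm_apply_proj_of_even σ μ he, funext hf]
  rw [shSum, sum_apply, Finset.sum, hs]
  simp only [Multiset.insert_eq_cons, Multiset.map_cons, Multiset.map_singleton,
    Multiset.sum_cons, Multiset.sum_singleton]
  rw [hp (1) ![proj (e 0) (v 0), proj (e 1) (v 1), proj (e 2) (v 2), proj (e 3) (v 3)] (1) (by decide +kernel)
      (fun t => by fin_cases t <;> rfl),
    hp (List.formPerm [2, 3]) ![proj (e 0) (v 0), proj (e 1) (v 1), proj (e 3) (v 3), proj (e 2) (v 2)] (-1) (by decide +kernel)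
      (fun t => by fin_cases t <;> rfl),
    hp (List.formPerm [1, 3, 2]) ![proj (e 0) (v 0), proj (e 2) (v 2), proj (e 3) (v 3), proj (e 1) (v 1)] (1) (by decide +kernel)
      (fun t => by fin_cases t <;> rfl),
    hp (List.formPerm [0, 3, 2, 1]) ![proj (e 1) (v 1), proj (e 2) (v 2), proj (e 3) (v 3), proj (e 0) (v 0)] (-1) (by decide +kernel)
      (fun t => by fin_cases t <;> rfl)]
  module

lemma shSum_five_two_apply (μ : Op A B C 5) {e : Fin 5 → Fin 3}
    (he : ∀ i j, i < j → (e i : ℕ) * (e j : ℕ) % 2 = 0) (v w : Fin 5 → Tot A B C)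
    (hw : ∀ i, w i = proj (e i) (v i)) :
    shSum 2 μ w =
      μ ![w 0, w 1, w 2, w 3, w 4]
      - μ ![w 0, w 2, w 1, w 3, w 4]
      + μ ![w 0, w 3, w 1, w 2, w 4]
      - μ ![w 0, w 4, w 1, w 2, w 3]
      + μ ![w 1, w 2, w 0, w 3, w 4]
      - μ ![w 1, w 3, w 0, w 2, w 4]
      + μ ![w 1, w 4, w 0, w 2, w 3]
      + μ ![w 2, w 3, w 0, w 1, w 4]
      - μ ![w 2, w 4, w 0, w 1, w 3]
      + μ ![w 3, w 4, w 0, w 1, w 2] := by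
  have hs : (unshuffles 5 2).val =
      {1, List.formPerm [1, 2], List.formPerm [1, 2, 3], List.formPerm [1, 2, 3, 4], List.formPerm [0, 2, 1], List.formPerm [0, 2, 3, 1], List.formPerm [0, 2, 3, 4, 1], List.formPerm [0, 2] * List.formPerm [1, 3], List.formPerm [0, 2] * List.formPerm [1, 3, 4], List.formPerm [0, 2, 4, 1, 3]} := by
    decide +kernel
  obtain rfl : w = fun i => proj (e i) (v i) := funext hw
  have hp : ∀ (σ : Equiv.Perm (Fin 5)) (f : Fin 5 → Tot A B C) (c : ℤ),
      (Equiv.Perm.sign σ : ℤ) = c → (∀ i, f i = proj (e (σ⁻¹ i)) (v (σ⁻¹ i))) →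
      ((Equiv.Perm.sign σ : ℤ) • perm σ μ) (fun i => proj (e i) (v i)) = c • μ f := by
    rintro σ f c rfl hf
    rw [smul_apply, perm_apply_proj_of_even σ μ he, funext hf]
  rw [shSum, sum_apply, Finset.sum, hs]
  simp only [Multiset.insert_eq_cons, Multiset.map_cons, Multiset.map_singleton,
    Multiset.sum_cons, Multiset.sum_singleton]
  rw [hp (1) ![proj (e 0) (v 0), proj (e 1) (v 1), proj (e 2) (v 2), proj (e 3) (v 3), proj (e 4) (v 4)] (1) (by decide +kernel)
      (fun t => by fin_cases t <;> rfl),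
    hp (List.formPerm [1, 2]) ![proj (e 0) (v 0), proj (e 2) (v 2), proj (e 1) (v 1), proj (e 3) (v 3), proj (e 4) (v 4)] (-1) (by decide +kernel)
      (fun t => by fin_cases t <;> rfl),
    hp (List.formPerm [1, 2, 3]) ![proj (e 0) (v 0), proj (e 3) (v 3), proj (e 1) (v 1), proj (e 2) (v 2), proj (e 4) (v 4)] (1) (by decide +kernel)
      (fun t => by fin_cases t <;> rfl),
    hp (List.formPerm [1, 2, 3, 4]) ![proj (e 0) (v 0), proj (e 4) (v 4), proj (e 1) (v 1), proj (e 2) (v 2), proj (e 3) (v 3)] (-1) (by decide +kernel)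
      (fun t => by fin_cases t <;> rfl),
    hp (List.formPerm [0, 2, 1]) ![proj (e 1) (v 1), proj (e 2) (v 2), proj (e 0) (v 0), proj (e 3) (v 3), proj (e 4) (v 4)] (1) (by decide +kernel)
      (fun t => by fin_cases t <;> rfl),
    hp (List.formPerm [0, 2, 3, 1]) ![proj (e 1) (v 1), proj (e 3) (v 3), proj (e 0) (v 0), proj (e 2) (v 2), proj (e 4) (v 4)] (-1) (by decide +kernel)
      (fun t => by fin_cases t <;> rfl),
    hp (List.formPerm [0, 2, 3, 4, 1]) ![proj (e 1) (v 1), proj (e 4) (v 4), proj (e 0) (v 0), proj (e 2) (v 2), proj (e 3) (v 3)] (1) (by decide +kernel)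
      (fun t => by fin_cases t <;> rfl),
    hp (List.formPerm [0, 2] * List.formPerm [1, 3]) ![proj (e 2) (v 2), proj (e 3) (v 3), proj (e 0) (v 0), proj (e 1) (v 1), proj (e 4) (v 4)] (1) (by decide +kernel)
      (fun t => by fin_cases t <;> rfl),
    hp (List.formPerm [0, 2] * List.formPerm [1, 3, 4]) ![proj (e 2) (v 2), proj (e 4) (v 4), proj (e 0) (v 0), proj (e 1) (v 1), proj (e 3) (v 3)] (-1) (by decide +kernel)
      (fun t => by fin_cases t <;> rfl),
    hp (List.formPerm [0, 2, 4, 1, 3]) ![proj (e 3) (v 3), proj (e 4) (v 4), proj (e 0) (v 0), proj (e 1) (v 1), proj (e 2) (v 2)] (1) (by decide +kernel)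
      (fun t => by fin_cases t <;> rfl)]
  module

lemma shSum_five_three_apply (μ : Op A B C 5) {e : Fin 5 → Fin 3}
    (he : ∀ i j, i < j → (e i : ℕ) * (e j : ℕ) % 2 = 0) (v w : Fin 5 → Tot A B C)
    (hw : ∀ i, w i = proj (e i) (v i)) :
    shSum 3 μ w =
      μ ![w 0, w 1, w 2, w 3, w 4]
      - μ ![w 0, w 1, w 3, w 2, w 4]
      + μ ![w 0, w 1, w 4, w 2, w 3]
      + μ ![w 0, w 2, w 3, w 1, w 4]
      - μ ![w 0, w 2, w 4, w 1, w 3]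
      + μ ![w 0, w 3, w 4, w 1, w 2]
      - μ ![w 1, w 2, w 3, w 0, w 4]
      + μ ![w 1, w 2, w 4, w 0, w 3]
      - μ ![w 1, w 3, w 4, w 0, w 2]
      + μ ![w 2, w 3, w 4, w 0, w 1] := by
  have hs : (unshuffles 5 3).val =
      {1, List.formPerm [2, 3], List.formPerm [2, 3, 4], List.formPerm [1, 3, 2], List.formPerm [1, 3, 4, 2], List.formPerm [1, 3] * List.formPerm [2, 4], List.formPerm [0, 3, 2, 1], List.formPerm [0, 3, 4, 2, 1], List.formPerm [0, 3, 1] * List.formPerm [2, 4], List.formPerm [0, 3, 1, 4, 2]} := by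
    decide +kernel
  obtain rfl : w = fun i => proj (e i) (v i) := funext hw
  have hp : ∀ (σ : Equiv.Perm (Fin 5)) (f : Fin 5 → Tot A B C) (c : ℤ),
      (Equiv.Perm.sign σ : ℤ) = c → (∀ i, f i = proj (e (σ⁻¹ i)) (v (σ⁻¹ i))) →
      ((Equiv.Perm.sign σ : ℤ) • perm σ μ) (fun i => proj (e i) (v i)) = c • μ f := by
    rintro σ f c rfl hf
    rw [smul_apply, perm_apply_proj_of_even σ μ he, funext hf]
  rw [shSum, sum_apply, Finset.sum, hs]
  simp only [Multiset.insert_eq_cons, Multiset.map_cons, Multiset.map_singleton,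
    Multiset.sum_cons, Multiset.sum_singleton]
  rw [hp (1) ![proj (e 0) (v 0), proj (e 1) (v 1), proj (e 2) (v 2), proj (e 3) (v 3), proj (e 4) (v 4)] (1) (by decide +kernel)
      (fun t => by fin_cases t <;> rfl),
    hp (List.formPerm [2, 3]) ![proj (e 0) (v 0), proj (e 1) (v 1), proj (e 3) (v 3), proj (e 2) (v 2), proj (e 4) (v 4)] (-1) (by decide +kernel)
      (fun t => by fin_cases t <;> rfl),
    hp (List.formPerm [2, 3, 4]) ![proj (e 0) (v 0), proj (e 1) (v 1), proj (e 4) (v 4), proj (e 2) (v 2), proj (e 3) (v 3)] (1) (by decide +kernel)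
      (fun t => by fin_cases t <;> rfl),
    hp (List.formPerm [1, 3, 2]) ![proj (e 0) (v 0), proj (e 2) (v 2), proj (e 3) (v 3), proj (e 1) (v 1), proj (e 4) (v 4)] (1) (by decide +kernel)
      (fun t => by fin_cases t <;> rfl),
    hp (List.formPerm [1, 3, 4, 2]) ![proj (e 0) (v 0), proj (e 2) (v 2), proj (e 4) (v 4), proj (e 1) (v 1), proj (e 3) (v 3)] (-1) (by decide +kernel)
      (fun t => by fin_cases t <;> rfl),
    hp (List.formPerm [1, 3] * List.formPerm [2, 4]) ![proj (e 0) (v 0), proj (e 3) (v 3), proj (e 4) (v 4), proj (e 1) (v 1), proj (e 2) (v 2)] (1) (by decide +kernel)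
      (fun t => by fin_cases t <;> rfl),
    hp (List.formPerm [0, 3, 2, 1]) ![proj (e 1) (v 1), proj (e 2) (v 2), proj (e 3) (v 3), proj (e 0) (v 0), proj (e 4) (v 4)] (-1) (by decide +kernel)
      (fun t => by fin_cases t <;> rfl),
    hp (List.formPerm [0, 3, 4, 2, 1]) ![proj (e 1) (v 1), proj (e 2) (v 2), proj (e 4) (v 4), proj (e 0) (v 0), proj (e 3) (v 3)] (1) (by decide +kernel)
      (fun t => by fin_cases t <;> rfl),
    hp (List.formPerm [0, 3, 1] * List.formPerm [2, 4]) ![proj (e 1) (v 1), proj (e 3) (v 3), proj (e 4) (v 4), proj (e 0) (v 0), proj (e 2) (v 2)] (-1) (by decide +kernel)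
      (fun t => by fin_cases t <;> rfl),
    hp (List.formPerm [0, 3, 1, 4, 2]) ![proj (e 2) (v 2), proj (e 3) (v 3), proj (e 4) (v 4), proj (e 0) (v 0), proj (e 1) (v 1)] (1) (by decide +kernel)
      (fun t => by fin_cases t <;> rfl)]
  module

lemma shSum_five_four_apply (μ : Op A B C 5) {e : Fin 5 → Fin 3}
    (he : ∀ i j, i < j → (e i : ℕ) * (e j : ℕ) % 2 = 0) (v w : Fin 5 → Tot A B C)
    (hw : ∀ i, w i = proj (e i) (v i)) :
    shSum 4 μ w =
      μ ![w 0, w 1, w 2, w 3, w 4]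
      - μ ![w 0, w 1, w 2, w 4, w 3]
      + μ ![w 0, w 1, w 3, w 4, w 2]
      - μ ![w 0, w 2, w 3, w 4, w 1]
      + μ ![w 1, w 2, w 3, w 4, w 0] := by
  have hs : (unshuffles 5 4).val =
      {1, List.formPerm [3, 4], List.formPerm [2, 4, 3], List.formPerm [1, 4, 3, 2], List.formPerm [0, 4, 3, 2, 1]} := by
    decide +kernel
  obtain rfl : w = fun i => proj (e i) (v i) := funext hw
  have hp : ∀ (σ : Equiv.Perm (Fin 5)) (f : Fin 5 → Tot A B C) (c : ℤ),
      (Equiv.Perm.sign σ : ℤ) = c → (∀ i, f i = proj (e (σ⁻¹ i)) (v (σ⁻¹ i))) →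
      ((Equiv.Perm.sign σ : ℤ) • perm σ μ) (fun i => proj (e i) (v i)) = c • μ f := by
    rintro σ f c rfl hf
    rw [smul_apply, perm_apply_proj_of_even σ μ he, funext hf]
  rw [shSum, sum_apply, Finset.sum, hs]
  simp only [Multiset.insert_eq_cons, Multiset.map_cons, Multiset.map_singleton,
    Multiset.sum_cons, Multiset.sum_singleton]
  rw [hp (1) ![proj (e 0) (v 0), proj (e 1) (v 1), proj (e 2) (v 2), proj (e 3) (v 3), proj (e 4) (v 4)] (1) (by decide +kernel)
      (fun t => by fin_cases t <;> rfl),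
    hp (List.formPerm [3, 4]) ![proj (e 0) (v 0), proj (e 1) (v 1), proj (e 2) (v 2), proj (e 4) (v 4), proj (e 3) (v 3)] (-1) (by decide +kernel)
      (fun t => by fin_cases t <;> rfl),
    hp (List.formPerm [2, 4, 3]) ![proj (e 0) (v 0), proj (e 1) (v 1), proj (e 3) (v 3), proj (e 4) (v 4), proj (e 2) (v 2)] (1) (by decide +kernel)
      (fun t => by fin_cases t <;> rfl),
    hp (List.formPerm [1, 4, 3, 2]) ![proj (e 0) (v 0), proj (e 2) (v 2), proj (e 3) (v 3), proj (e 4) (v 4), proj (e 1) (v 1)] (-1) (by decide +kernel)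
      (fun t => by fin_cases t <;> rfl),
    hp (List.formPerm [0, 4, 3, 2, 1]) ![proj (e 1) (v 1), proj (e 2) (v 2), proj (e 3) (v 3), proj (e 4) (v 4), proj (e 0) (v 0)] (1) (by decide +kernel)
      (fun t => by fin_cases t <;> rfl)]
  module

lemma alt_three_apply (μ : Op A B C 3) {e : Fin 3 → Fin 3}
    (he : ∀ i j, i < j → (e i : ℕ) * (e j : ℕ) % 2 = 0) (v w : Fin 3 → Tot A B C)
    (hw : ∀ i, w i = proj (e i) (v i)) :
    alt μ w =
      μ ![w 0, w 1, w 2]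
      - μ ![w 0, w 2, w 1]
      - μ ![w 1, w 0, w 2]
      + μ ![w 1, w 2, w 0]
      + μ ![w 2, w 0, w 1]
      - μ ![w 2, w 1, w 0] := by
  have hs : ((Finset.univ : Finset (Equiv.Perm (Fin 3)))).val =
      {1, List.formPerm [1, 2], List.formPerm [0, 1], List.formPerm [0, 2, 1], List.formPerm [0, 1, 2], List.formPerm [0, 2]} := by
    decide +kernel
  obtain rfl : w = fun i => proj (e i) (v i) := funext hw
  have hp : ∀ (σ : Equiv.Perm (Fin 3)) (f : Fin 3 → Tot A B C) (c : ℤ),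
      (Equiv.Perm.sign σ : ℤ) = c → (∀ i, f i = proj (e (σ⁻¹ i)) (v (σ⁻¹ i))) →
      ((Equiv.Perm.sign σ : ℤ) • perm σ μ) (fun i => proj (e i) (v i)) = c • μ f := by
    rintro σ f c rfl hf
    rw [smul_apply, perm_apply_proj_of_even σ μ he, funext hf]
  rw [alt, sum_apply, Finset.sum, hs]
  simp only [Multiset.insert_eq_cons, Multiset.map_cons, Multiset.map_singleton,
    Multiset.sum_cons, Multiset.sum_singleton]
  rw [hp (1) ![proj (e 0) (v 0), proj (e 1) (v 1), proj (e 2) (v 2)] (1) (by decide +kernel)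
      (fun t => by fin_cases t <;> rfl),
    hp (List.formPerm [1, 2]) ![proj (e 0) (v 0), proj (e 2) (v 2), proj (e 1) (v 1)] (-1) (by decide +kernel)
      (fun t => by fin_cases t <;> rfl),
    hp (List.formPerm [0, 1]) ![proj (e 1) (v 1), proj (e 0) (v 0), proj (e 2) (v 2)] (-1) (by decide +kernel)
      (fun t => by fin_cases t <;> rfl),
    hp (List.formPerm [0, 2, 1]) ![proj (e 1) (v 1), proj (e 2) (v 2), proj (e 0) (v 0)] (1) (by decide +kernel)
      (fun t => by fin_cases t <;> rfl),
    hp (List.formPerm [0, 1, 2]) ![proj (e 2) (v 2), proj (e 0) (v 0), proj (e 1) (v 1)] (1) (by decide +kernel)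
      (fun t => by fin_cases t <;> rfl),
    hp (List.formPerm [0, 2]) ![proj (e 2) (v 2), proj (e 1) (v 1), proj (e 0) (v 0)] (-1) (by decide +kernel)
      (fun t => by fin_cases t <;> rfl)]
  module

/-- Kept at the level of operations: the Jacobi identity of arity 3 also has patterns with two odd
arguments, where Koszul signs matter. -/
lemma shSum_three_two (μ : Op A B C 3) :
    shSum 2 μ = μ - perm (List.formPerm [1, 2]) μ + perm (List.formPerm [0, 2, 1]) μ := by
  have hs : (unshuffles 3 2).val = {1, List.formPerm [1, 2], List.formPerm [0, 2, 1]} := by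
    decide +kernel
  have h1 : (Equiv.Perm.sign (List.formPerm [1, 2] : Equiv.Perm (Fin 3)) : ℤ) = -1 := by
    decide +kernel
  have h2 : (Equiv.Perm.sign (List.formPerm [0, 2, 1] : Equiv.Perm (Fin 3)) : ℤ) = 1 := by
    decide +kernel
  rw [shSum, Finset.sum, hs]
  simp only [Multiset.insert_eq_cons, Multiset.map_cons, Multiset.map_singleton,
    Multiset.sum_cons, Multiset.sum_singleton, h1, h2, Equiv.Perm.sign_one, perm_one]
  simp only [Units.val_one, one_smul, neg_smul]
  abel

/-- In these names the two digits are the arities of `μ` and `ν`, and the last one is the slot. The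
powers of `parity` are the signs for moving `ν` past the arguments on its left. -/
lemma comp_21_apply_0 (μ : Op A B C 2) (s : ℕ) (ν : Op A B C 1) (x y : Tot A B C) :
    (comp μ 0 s ν : Op A B C 2) ![x, y] =
      μ ![ν ![x], y] := by
  refine congrArg μ (funext fun t => ?_)
  fin_cases t
  · exact congrArg ν (funext fun l => by fin_cases l <;> rfl)
  · rfl

lemma comp_21_apply_1 (μ : Op A B C 2) (s : ℕ) (ν : Op A B C 1) (x y : Tot A B C) :
    (comp μ 1 s ν : Op A B C 2) ![x, y] =
      μ ![(parity ^ s) x, ν ![y]] := by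
  refine congrArg μ (funext fun t => ?_)
  fin_cases t
  · rfl
  · exact congrArg ν (funext fun l => by fin_cases l <;> rfl)

lemma comp_22_apply_0 (μ : Op A B C 2) (s : ℕ) (ν : Op A B C 2) (x y z : Tot A B C) :
    (comp μ 0 s ν : Op A B C 3) ![x, y, z] =
      μ ![ν ![x, y], z] := by
  refine congrArg μ (funext fun t => ?_)
  fin_cases t
  · exact congrArg ν (funext fun l => by fin_cases l <;> rfl)
  · rfl

lemma comp_22_apply_1 (μ : Op A B C 2) (s : ℕ) (ν : Op A B C 2) (x y z : Tot A B C) :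
    (comp μ 1 s ν : Op A B C 3) ![x, y, z] =
      μ ![(parity ^ s) x, ν ![y, z]] := by
  refine congrArg μ (funext fun t => ?_)
  fin_cases t
  · rfl
  · exact congrArg ν (funext fun l => by fin_cases l <;> rfl)

lemma comp_23_apply_0 (μ : Op A B C 2) (s : ℕ) (ν : Op A B C 3) (x y z w : Tot A B C) :
    (comp μ 0 s ν : Op A B C 4) ![x, y, z, w] =
      μ ![ν ![x, y, z], w] := by
  refine congrArg μ (funext fun t => ?_)
  fin_cases t
  · exact congrArg ν (funext fun l => by fin_cases l <;> rfl)
  · rfl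

lemma comp_23_apply_1 (μ : Op A B C 2) (s : ℕ) (ν : Op A B C 3) (x y z w : Tot A B C) :
    (comp μ 1 s ν : Op A B C 4) ![x, y, z, w] =
      μ ![(parity ^ s) x, ν ![y, z, w]] := by
  refine congrArg μ (funext fun t => ?_)
  fin_cases t
  · rfl
  · exact congrArg ν (funext fun l => by fin_cases l <;> rfl)

lemma comp_31_apply_0 (μ : Op A B C 3) (s : ℕ) (ν : Op A B C 1) (x y z : Tot A B C) :
    (comp μ 0 s ν : Op A B C 3) ![x, y, z] =
      μ ![ν ![x], y, z] := by
  refine congrArg μ (funext fun t => ?_)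
  fin_cases t
  · exact congrArg ν (funext fun l => by fin_cases l <;> rfl)
  · rfl
  · rfl

lemma comp_31_apply_1 (μ : Op A B C 3) (s : ℕ) (ν : Op A B C 1) (x y z : Tot A B C) :
    (comp μ 1 s ν : Op A B C 3) ![x, y, z] =
      μ ![(parity ^ s) x, ν ![y], z] := by
  refine congrArg μ (funext fun t => ?_)
  fin_cases t
  · rfl
  · exact congrArg ν (funext fun l => by fin_cases l <;> rfl)
  · rfl

lemma comp_31_apply_2 (μ : Op A B C 3) (s : ℕ) (ν : Op A B C 1) (x y z : Tot A B C) :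
    (comp μ 2 s ν : Op A B C 3) ![x, y, z] =
      μ ![(parity ^ s) x, (parity ^ s) y, ν ![z]] := by
  refine congrArg μ (funext fun t => ?_)
  fin_cases t
  · rfl
  · rfl
  · exact congrArg ν (funext fun l => by fin_cases l <;> rfl)

lemma comp_32_apply_0 (μ : Op A B C 3) (s : ℕ) (ν : Op A B C 2) (x y z w : Tot A B C) :
    (comp μ 0 s ν : Op A B C 4) ![x, y, z, w] =
      μ ![ν ![x, y], z, w] := by
  refine congrArg μ (funext fun t => ?_)
  fin_cases t
  · exact congrArg ν (funext fun l => by fin_cases l <;> rfl)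
  · rfl
  · rfl

lemma comp_32_apply_1 (μ : Op A B C 3) (s : ℕ) (ν : Op A B C 2) (x y z w : Tot A B C) :
    (comp μ 1 s ν : Op A B C 4) ![x, y, z, w] =
      μ ![(parity ^ s) x, ν ![y, z], w] := by
  refine congrArg μ (funext fun t => ?_)
  fin_cases t
  · rfl
  · exact congrArg ν (funext fun l => by fin_cases l <;> rfl)
  · rfl

lemma comp_32_apply_2 (μ : Op A B C 3) (s : ℕ) (ν : Op A B C 2) (x y z w : Tot A B C) :
    (comp μ 2 s ν : Op A B C 4) ![x, y, z, w] =
      μ ![(parity ^ s) x, (parity ^ s) y, ν ![z, w]] := by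
  refine congrArg μ (funext fun t => ?_)
  fin_cases t
  · rfl
  · rfl
  · exact congrArg ν (funext fun l => by fin_cases l <;> rfl)

lemma comp_41_apply_0 (μ : Op A B C 4) (s : ℕ) (ν : Op A B C 1) (x y z w : Tot A B C) :
    (comp μ 0 s ν : Op A B C 4) ![x, y, z, w] =
      μ ![ν ![x], y, z, w] := by
  refine congrArg μ (funext fun t => ?_)
  fin_cases t
  · exact congrArg ν (funext fun l => by fin_cases l <;> rfl)
  · rfl
  · rfl
  · rfl

lemma comp_41_apply_1 (μ : Op A B C 4) (s : ℕ) (ν : Op A B C 1) (x y z w : Tot A B C) :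
    (comp μ 1 s ν : Op A B C 4) ![x, y, z, w] =
      μ ![(parity ^ s) x, ν ![y], z, w] := by
  refine congrArg μ (funext fun t => ?_)
  fin_cases t
  · rfl
  · exact congrArg ν (funext fun l => by fin_cases l <;> rfl)
  · rfl
  · rfl

lemma comp_41_apply_2 (μ : Op A B C 4) (s : ℕ) (ν : Op A B C 1) (x y z w : Tot A B C) :
    (comp μ 2 s ν : Op A B C 4) ![x, y, z, w] =
      μ ![(parity ^ s) x, (parity ^ s) y, ν ![z], w] := by
  refine congrArg μ (funext fun t => ?_)
  fin_cases t
  · rfl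
  · rfl
  · exact congrArg ν (funext fun l => by fin_cases l <;> rfl)
  · rfl

lemma comp_41_apply_3 (μ : Op A B C 4) (s : ℕ) (ν : Op A B C 1) (x y z w : Tot A B C) :
    (comp μ 3 s ν : Op A B C 4) ![x, y, z, w] =
      μ ![(parity ^ s) x, (parity ^ s) y, (parity ^ s) z, ν ![w]] := by
  refine congrArg μ (funext fun t => ?_)
  fin_cases t
  · rfl
  · rfl
  · rfl
  · exact congrArg ν (funext fun l => by fin_cases l <;> rfl)

lemma comp_24_apply_0 (μ : Op A B C 2) (s : ℕ) (ν : Op A B C 4) (x y z w u : Tot A B C) :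
    (comp μ 0 s ν : Op A B C 5) ![x, y, z, w, u] =
      μ ![ν ![x, y, z, w], u] := by
  refine congrArg μ (funext fun t => ?_)
  fin_cases t
  · exact congrArg ν (funext fun l => by fin_cases l <;> rfl)
  · rfl

lemma comp_33_apply_0 (μ : Op A B C 3) (s : ℕ) (ν : Op A B C 3) (x y z w u : Tot A B C) :
    (comp μ 0 s ν : Op A B C 5) ![x, y, z, w, u] =
      μ ![ν ![x, y, z], w, u] := by
  refine congrArg μ (funext fun t => ?_)
  fin_cases t
  · exact congrArg ν (funext fun l => by fin_cases l <;> rfl)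
  · rfl
  · rfl

lemma comp_42_apply_0 (μ : Op A B C 4) (s : ℕ) (ν : Op A B C 2) (x y z w u : Tot A B C) :
    (comp μ 0 s ν : Op A B C 5) ![x, y, z, w, u] =
      μ ![ν ![x, y], z, w, u] := by
  refine congrArg μ (funext fun t => ?_)
  fin_cases t
  · exact congrArg ν (funext fun l => by fin_cases l <;> rfl)
  · rfl
  · rfl
  · rfl

lemma bdry_2_apply (d : Tot A B C →ₗ[ℝ] Tot A B C) (r : ℕ) (μ : Op A B C 2) (x y : Tot A B C) :
    bdry d r μ ![x, y] = d (μ ![x, y]) - (-1 : ℝ) ^ r •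
      (μ ![d x, y] + μ ![parity x, d y]) := by
  rw [bdry, sub_apply, smul_apply, sum_apply, Fin.sum_univ_two]
  simp only [LinearMap.compMultilinearMap_apply]
  rw [comp_21_apply_0, comp_21_apply_1]
  simp only [parity_pow_one]
  rfl

lemma bdry_3_apply (d : Tot A B C →ₗ[ℝ] Tot A B C) (r : ℕ) (μ : Op A B C 3) (x y z : Tot A B C) :
    bdry d r μ ![x, y, z] = d (μ ![x, y, z]) - (-1 : ℝ) ^ r •
      (μ ![d x, y, z] + μ ![parity x, d y, z] + μ ![parity x, parity y, d z]) := by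
  rw [bdry, sub_apply, smul_apply, sum_apply, Fin.sum_univ_three]
  simp only [LinearMap.compMultilinearMap_apply]
  rw [comp_31_apply_0, comp_31_apply_1, comp_31_apply_2]
  simp only [parity_pow_one]
  rfl

lemma bdry_4_apply (d : Tot A B C →ₗ[ℝ] Tot A B C) (r : ℕ) (μ : Op A B C 4) (x y z w : Tot A B C) :
    bdry d r μ ![x, y, z, w] = d (μ ![x, y, z, w]) - (-1 : ℝ) ^ r •
      (μ ![d x, y, z, w] + μ ![parity x, d y, z, w] + μ ![parity x, parity y, d z, w] + μ ![parity x, parity y, parity z, d w]) := by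
  rw [bdry, sub_apply, smul_apply, sum_apply, Fin.sum_univ_four]
  simp only [LinearMap.compMultilinearMap_apply]
  rw [comp_41_apply_0, comp_41_apply_1, comp_41_apply_2, comp_41_apply_3]
  simp only [parity_pow_one]
  rfl

/-- Composites carry the arity `m + k`, whereas the evaluation lemmas are stated for numerals.
Transport along an arbitrary equality of arities is trivial by substitution, and specializes to the
identity when both sides reduce to the same numeral. -/
lemma perm_cast {n m : ℕ} (h : n = m) (σ : Equiv.Perm (Fin n)) (κ : Op A B C n) :
    h ▸ perm σ κ = perm (h ▸ σ) (h ▸ κ) := by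
  subst h
  rfl

lemma perm_comp_22_apply_102 (μ : Op A B C 2) (p : Fin 2) (s : ℕ) (ν : Op A B C 2) (i j k : Fin 3) (x y z : Tot A B C) :
    (perm (n := 1 + 2) (List.formPerm [0, 1]) (comp μ p s ν) : Op A B C 3) ![proj i x, proj j y, proj k z] =
      (-1 : ℤ) ^ ((i : ℕ) * j) • (comp μ p s ν : Op A B C 3) ![proj j y, proj i x, proj k z] := by
  rw [show (perm (n := 1 + 2) (List.formPerm [0, 1]) (comp μ p s ν) : Op A B C 3) =
      perm (n := 3) (List.formPerm [0, 1]) (comp μ p s ν) from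
    perm_cast (n := 1 + 2) (m := 3) rfl (List.formPerm [0, 1]) _, perm_apply_102]

lemma perm_comp_23_apply_1023 (μ : Op A B C 2) (p : Fin 2) (s : ℕ) (ν : Op A B C 3) (i j k l : Fin 3) (x y z w : Tot A B C) :
    (perm (n := 1 + 3) (List.formPerm [0, 1]) (comp μ p s ν) : Op A B C 4) ![proj i x, proj j y, proj k z, proj l w] =
      (-1 : ℤ) ^ ((i : ℕ) * j) • (comp μ p s ν : Op A B C 4) ![proj j y, proj i x, proj k z, proj l w] := by
  rw [show (perm (n := 1 + 3) (List.formPerm [0, 1]) (comp μ p s ν) : Op A B C 4) =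
      perm (n := 4) (List.formPerm [0, 1]) (comp μ p s ν) from
    perm_cast (n := 1 + 3) (m := 4) rfl (List.formPerm [0, 1]) _, perm_apply_1023]

lemma perm_comp_23_apply_2013 (μ : Op A B C 2) (p : Fin 2) (s : ℕ) (ν : Op A B C 3) (i j k l : Fin 3) (x y z w : Tot A B C) :
    (perm (n := 1 + 3) (List.formPerm [0, 1, 2]) (comp μ p s ν) : Op A B C 4) ![proj i x, proj j y, proj k z, proj l w] =
      (-1 : ℤ) ^ ((i : ℕ) * k + (j : ℕ) * k) • (comp μ p s ν : Op A B C 4) ![proj k z, proj i x, proj j y, proj l w] := by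
  rw [show (perm (n := 1 + 3) (List.formPerm [0, 1, 2]) (comp μ p s ν) : Op A B C 4) =
      perm (n := 4) (List.formPerm [0, 1, 2]) (comp μ p s ν) from
    perm_cast (n := 1 + 3) (m := 4) rfl (List.formPerm [0, 1, 2]) _, perm_apply_2013]

lemma perm_comp_32_apply_1023 (μ : Op A B C 3) (p : Fin 3) (s : ℕ) (ν : Op A B C 2) (i j k l : Fin 3) (x y z w : Tot A B C) :
    (perm (n := 2 + 2) (List.formPerm [0, 1]) (comp μ p s ν) : Op A B C 4) ![proj i x, proj j y, proj k z, proj l w] =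
      (-1 : ℤ) ^ ((i : ℕ) * j) • (comp μ p s ν : Op A B C 4) ![proj j y, proj i x, proj k z, proj l w] := by
  rw [show (perm (n := 2 + 2) (List.formPerm [0, 1]) (comp μ p s ν) : Op A B C 4) =
      perm (n := 4) (List.formPerm [0, 1]) (comp μ p s ν) from
    perm_cast (n := 2 + 2) (m := 4) rfl (List.formPerm [0, 1]) _, perm_apply_1023]

lemma perm_comp_32_apply_0213 (μ : Op A B C 3) (p : Fin 3) (s : ℕ) (ν : Op A B C 2) (i j k l : Fin 3) (x y z w : Tot A B C) :
    (perm (n := 2 + 2) (List.formPerm [1, 2]) (comp μ p s ν) : Op A B C 4) ![proj i x, proj j y, proj k z, proj l w] =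
      (-1 : ℤ) ^ ((j : ℕ) * k) • (comp μ p s ν : Op A B C 4) ![proj i x, proj k z, proj j y, proj l w] := by
  rw [show (perm (n := 2 + 2) (List.formPerm [1, 2]) (comp μ p s ν) : Op A B C 4) =
      perm (n := 4) (List.formPerm [1, 2]) (comp μ p s ν) from
    perm_cast (n := 2 + 2) (m := 4) rfl (List.formPerm [1, 2]) _, perm_apply_0213]

lemma perm_comp_32_apply_1203 (μ : Op A B C 3) (p : Fin 3) (s : ℕ) (ν : Op A B C 2) (i j k l : Fin 3) (x y z w : Tot A B C) :
    (perm (n := 2 + 2) (List.formPerm [0, 2, 1]) (comp μ p s ν) : Op A B C 4) ![proj i x, proj j y, proj k z, proj l w] =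
      (-1 : ℤ) ^ ((i : ℕ) * j + (i : ℕ) * k) • (comp μ p s ν : Op A B C 4) ![proj j y, proj k z, proj i x, proj l w] := by
  rw [show (perm (n := 2 + 2) (List.formPerm [0, 2, 1]) (comp μ p s ν) : Op A B C 4) =
      perm (n := 4) (List.formPerm [0, 2, 1]) (comp μ p s ν) from
    perm_cast (n := 2 + 2) (m := 4) rfl (List.formPerm [0, 2, 1]) _, perm_apply_1203]

lemma shSum_comp_22 (μ : Op A B C 2) (p : Fin 2) (s : ℕ) (ν : Op A B C 2) :
    (shSum 2 (comp μ p s ν) : Op A B C 3) = comp μ p s ν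
      - perm (n := 3) (List.formPerm [1, 2]) (comp μ p s ν)
      + perm (n := 3) (List.formPerm [0, 2, 1]) (comp μ p s ν) :=
  shSum_three_two (comp μ p s ν)

lemma alt_three_proj (μ : Op A B C 3) (i j k : Fin 3)
    (he : ∀ a b, a < b → (![i, j, k] a : ℕ) * (![i, j, k] b : ℕ) % 2 = 0)
    (x y z : Tot A B C) :
    alt μ ![proj i x, proj j y, proj k z] =
      μ ![proj i x, proj j y, proj k z]
        - μ ![proj i x, proj k z, proj j y]
        - μ ![proj j y, proj i x, proj k z]
        + μ ![proj j y, proj k z, proj i x]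
        + μ ![proj k z, proj i x, proj j y]
        - μ ![proj k z, proj j y, proj i x] :=
  alt_three_apply μ he ![x, y, z]
    ![proj i x, proj j y, proj k z] (fun t => by fin_cases t <;> rfl)

lemma shSum_four_two_proj (μ : Op A B C 4) (i j k l : Fin 3)
    (he : ∀ a b, a < b → (![i, j, k, l] a : ℕ) * (![i, j, k, l] b : ℕ) % 2 = 0)
    (x y z w : Tot A B C) :
    shSum 2 μ ![proj i x, proj j y, proj k z, proj l w] =
      μ ![proj i x, proj j y, proj k z, proj l w]
        - μ ![proj i x, proj k z, proj j y, proj l w]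
        + μ ![proj i x, proj l w, proj j y, proj k z]
        + μ ![proj j y, proj k z, proj i x, proj l w]
        - μ ![proj j y, proj l w, proj i x, proj k z]
        + μ ![proj k z, proj l w, proj i x, proj j y] :=
  shSum_four_two_apply μ he ![x, y, z, w]
    ![proj i x, proj j y, proj k z, proj l w] (fun t => by fin_cases t <;> rfl)

lemma shSum_four_three_proj (μ : Op A B C 4) (i j k l : Fin 3)
    (he : ∀ a b, a < b → (![i, j, k, l] a : ℕ) * (![i, j, k, l] b : ℕ) % 2 = 0)
    (x y z w : Tot A B C) :
    shSum 3 μ ![proj i x, proj j y, proj k z, proj l w] =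
      μ ![proj i x, proj j y, proj k z, proj l w]
        - μ ![proj i x, proj j y, proj l w, proj k z]
        + μ ![proj i x, proj k z, proj l w, proj j y]
        - μ ![proj j y, proj k z, proj l w, proj i x] :=
  shSum_four_three_apply μ he ![x, y, z, w]
    ![proj i x, proj j y, proj k z, proj l w] (fun t => by fin_cases t <;> rfl)

/-- The identity of arity 5 has degree 2, so only arguments of degree 0 are ever needed. -/
lemma shSum_five_two_proj_zero (μ : Op A B C 5) (x y z w u : Tot A B C) :
    shSum 2 μ ![proj 0 x, proj 0 y, proj 0 z, proj 0 w, proj 0 u] =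
      μ ![proj 0 x, proj 0 y, proj 0 z, proj 0 w, proj 0 u]
        - μ ![proj 0 x, proj 0 z, proj 0 y, proj 0 w, proj 0 u]
        + μ ![proj 0 x, proj 0 w, proj 0 y, proj 0 z, proj 0 u]
        - μ ![proj 0 x, proj 0 u, proj 0 y, proj 0 z, proj 0 w]
        + μ ![proj 0 y, proj 0 z, proj 0 x, proj 0 w, proj 0 u]
        - μ ![proj 0 y, proj 0 w, proj 0 x, proj 0 z, proj 0 u]
        + μ ![proj 0 y, proj 0 u, proj 0 x, proj 0 z, proj 0 w]
        + μ ![proj 0 z, proj 0 w, proj 0 x, proj 0 y, proj 0 u]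
        - μ ![proj 0 z, proj 0 u, proj 0 x, proj 0 y, proj 0 w]
        + μ ![proj 0 w, proj 0 u, proj 0 x, proj 0 y, proj 0 z] :=
  shSum_five_two_apply μ (e := fun _ => 0) (fun _ _ _ => rfl) ![x, y, z, w, u]
    ![proj 0 x, proj 0 y, proj 0 z, proj 0 w, proj 0 u]
    (fun t => by fin_cases t <;> rfl)

lemma shSum_five_three_proj_zero (μ : Op A B C 5) (x y z w u : Tot A B C) :
    shSum 3 μ ![proj 0 x, proj 0 y, proj 0 z, proj 0 w, proj 0 u] =
      μ ![proj 0 x, proj 0 y, proj 0 z, proj 0 w, proj 0 u]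
        - μ ![proj 0 x, proj 0 y, proj 0 w, proj 0 z, proj 0 u]
        + μ ![proj 0 x, proj 0 y, proj 0 u, proj 0 z, proj 0 w]
        + μ ![proj 0 x, proj 0 z, proj 0 w, proj 0 y, proj 0 u]
        - μ ![proj 0 x, proj 0 z, proj 0 u, proj 0 y, proj 0 w]
        + μ ![proj 0 x, proj 0 w, proj 0 u, proj 0 y, proj 0 z]
        - μ ![proj 0 y, proj 0 z, proj 0 w, proj 0 x, proj 0 u]
        + μ ![proj 0 y, proj 0 z, proj 0 u, proj 0 x, proj 0 w]
        - μ ![proj 0 y, proj 0 w, proj 0 u, proj 0 x, proj 0 z]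
        + μ ![proj 0 z, proj 0 w, proj 0 u, proj 0 x, proj 0 y] :=
  shSum_five_three_apply μ (e := fun _ => 0) (fun _ _ _ => rfl) ![x, y, z, w, u]
    ![proj 0 x, proj 0 y, proj 0 z, proj 0 w, proj 0 u]
    (fun t => by fin_cases t <;> rfl)

lemma shSum_five_four_proj_zero (μ : Op A B C 5) (x y z w u : Tot A B C) :
    shSum 4 μ ![proj 0 x, proj 0 y, proj 0 z, proj 0 w, proj 0 u] =
      μ ![proj 0 x, proj 0 y, proj 0 z, proj 0 w, proj 0 u]
        - μ ![proj 0 x, proj 0 y, proj 0 z, proj 0 u, proj 0 w]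
        + μ ![proj 0 x, proj 0 y, proj 0 w, proj 0 u, proj 0 z]
        - μ ![proj 0 x, proj 0 z, proj 0 w, proj 0 u, proj 0 y]
        + μ ![proj 0 y, proj 0 z, proj 0 w, proj 0 u, proj 0 x] :=
  shSum_five_four_apply μ (e := fun _ => 0) (fun _ _ _ => rfl) ![x, y, z, w, u]
    ![proj 0 x, proj 0 y, proj 0 z, proj 0 w, proj 0 u]
    (fun t => by fin_cases t <;> rfl)
lemma alt_comp_22 (μ : Op A B C 2) (p : Fin 2) (s : ℕ) (ν : Op A B C 2) :
    (alt (n := 1 + 2) (comp μ p s ν) : Op A B C 3) = alt (n := 3) (comp μ p s ν) := rfl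

lemma shSum_cast {n m : ℕ} (h : n = m) (κ : Op A B C n) (q : ℕ) :
    h ▸ shSum q κ = shSum q (h ▸ κ) := by
  subst h
  rfl

lemma shSum_comp_23 (q : ℕ) (μ : Op A B C 2) (p : Fin 2) (s : ℕ) (ν : Op A B C 3) :
    (shSum (n := 1 + 3) q (comp μ p s ν) : Op A B C 4) = shSum (n := 4) q (comp μ p s ν) :=
  shSum_cast (n := 1 + 3) (m := 4) rfl _ q

lemma shSum_comp_32 (q : ℕ) (μ : Op A B C 3) (p : Fin 3) (s : ℕ) (ν : Op A B C 2) :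
    (shSum (n := 2 + 2) q (comp μ p s ν) : Op A B C 4) = shSum (n := 4) q (comp μ p s ν) :=
  shSum_cast (n := 2 + 2) (m := 4) rfl _ q

lemma shSum_comp_42 (q : ℕ) (μ : Op A B C 4) (p : Fin 4) (s : ℕ) (ν : Op A B C 2) :
    (shSum (n := 3 + 2) q (comp μ p s ν) : Op A B C 5) = shSum (n := 5) q (comp μ p s ν) :=
  shSum_cast (n := 3 + 2) (m := 5) rfl _ q

lemma shSum_comp_33 (q : ℕ) (μ : Op A B C 3) (p : Fin 3) (s : ℕ) (ν : Op A B C 3) :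
    (shSum (n := 2 + 3) q (comp μ p s ν) : Op A B C 5) = shSum (n := 5) q (comp μ p s ν) :=
  shSum_cast (n := 2 + 3) (m := 5) rfl _ q

lemma shSum_comp_24 (q : ℕ) (μ : Op A B C 2) (p : Fin 2) (s : ℕ) (ν : Op A B C 4) :
    (shSum (n := 1 + 4) q (comp μ p s ν) : Op A B C 5) = shSum (n := 5) q (comp μ p s ν) :=
  shSum_cast (n := 1 + 4) (m := 5) rfl _ q

end Evaluation

/-! ### The algebraic model and its weak Lie 3-algebra -/

section Algebra

variable {A B C : Type*} [AddCommGroup A] [Module ℝ A] [AddCommGroup B] [Module ℝ B]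
  [AddCommGroup C] [Module ℝ C]

lemma bilinOp_apply (c₀₀ : A →ₗ[ℝ] A →ₗ[ℝ] A) (c₀₁ : A →ₗ[ℝ] B →ₗ[ℝ] B)
    (c₁₀ : B →ₗ[ℝ] A →ₗ[ℝ] B) (v w : Tot A B C) :
    (bilinOp c₀₀ c₀₁ c₁₀ : Op A B C 2) ![v, w] =
      (c₀₀ v.1 w.1, c₀₁ v.1 w.2.1 + c₁₀ v.2.1 w.1, 0) := rfl

lemma pairOp_apply (s : A →ₗ[ℝ] B →ₗ[ℝ] C) (v w : Tot A B C) :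
    pairOp s ![v, w] = (0, 0, s v.1 w.2.1 + s w.1 v.2.1) := rfl

lemma triOp_apply (o : MultilinearMap ℝ (fun _ : Fin 3 => A) B) (u v w : Tot A B C) :
    triOp o ![u, v, w] = (0, o ![u.1, v.1, w.1], 0) :=
  congrArg (fun f => ((0, o f, 0) : Tot A B C)) (funext fun t => by fin_cases t <;> rfl)

lemma homDeg_bilinOp (c₀₀ : A →ₗ[ℝ] A →ₗ[ℝ] A) (c₀₁ : A →ₗ[ℝ] B →ₗ[ℝ] B)
    (c₁₀ : B →ₗ[ℝ] A →ₗ[ℝ] B) : HomDeg 0 (bilinOp c₀₀ c₀₁ c₁₀ : Op A B C 2) := fun v => by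
  simp [bilinOp, weight_apply]

lemma homDeg_pairOp (s : A →ₗ[ℝ] B →ₗ[ℝ] C) : HomDeg 1 (pairOp s) := fun v => by
  simp [pairOp, weight_apply, ← smul_add, smul_smul]
  norm_num

lemma homDeg_triOp (o : MultilinearMap ℝ (fun _ : Fin 3 => A) B) :
    HomDeg 1 (triOp o : Op A B C 3) := fun v => by
  simp [triOp, weight_apply]

section Trilinear

variable (o : MultilinearMap ℝ (fun _ : Fin 3 => A) B)

lemma trilinear_zero_left (x y : A) : o ![0, x, y] = 0 := o.map_coord_zero 0 rfl

lemma trilinear_zero_middle (x y : A) : o ![x, 0, y] = 0 := o.map_coord_zero 1 rfl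

lemma trilinear_zero_right (x y : A) : o ![x, y, 0] = 0 := o.map_coord_zero 2 rfl

end Trilinear

variable (A B C) in
/-- The algebraic structure carried by the sections of a CLWX 2-algebroid: a complex `A ← B ← C`, a
bilinear operation on `A ← B`, a pairing of `A` with `B` and a trilinear form on `A`. -/
structure CLWXAlgebra where
  d₁ : B →ₗ[ℝ] A
  d₂ : C →ₗ[ℝ] B
  c₀₀ : A →ₗ[ℝ] A →ₗ[ℝ] A
  c₀₁ : A →ₗ[ℝ] B →ₗ[ℝ] B
  c₁₀ : B →ₗ[ℝ] A →ₗ[ℝ] B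
  s : A →ₗ[ℝ] B →ₗ[ℝ] C
  o : MultilinearMap ℝ (fun _ : Fin 3 => A) B
  d₁_d₂ : ∀ f, d₁ (d₂ f) = 0
  skew : ∀ x y, c₀₀ x y = -c₀₀ y x
  symm : ∀ x a, c₁₀ a x = d₂ (s x a) - c₀₁ x a
  s_d₁ : ∀ a b, s (d₁ a) b = s (d₁ b) a
  s_d₁_d₂ : ∀ a f, s (d₁ a) (d₂ f) = 0
  anchor : ∀ x y a, s y (c₀₁ x a) = s x (d₂ (s y a)) - s (c₀₀ x y) a
  c₁₀_d₂ : ∀ f x, c₁₀ (d₂ f) x = 0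
  o_swap_left : ∀ x y z, o ![x, y, z] = -o ![y, x, z]
  o_swap_right : ∀ x y z, o ![x, y, z] = -o ![x, z, y]
  s_o : ∀ x y z w, s w (o ![x, y, z]) = -s z (o ![x, y, w])
  d₁_c₀₁ : ∀ x a, d₁ (c₀₁ x a) = c₀₀ x (d₁ a)
  c₁₀_d₁ : ∀ a b, c₁₀ a (d₁ b) = c₀₁ (d₁ a) b
  d₁_o : ∀ x y z, d₁ (o ![x, y, z]) = c₀₀ x (c₀₀ y z) - c₀₀ (c₀₀ x y) z - c₀₀ y (c₀₀ x z)
  o_d₁ : ∀ x y a, o ![x, y, d₁ a] = c₀₁ x (c₀₁ y a) - c₀₁ (c₀₀ x y) a - c₀₁ y (c₀₁ x a)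
  o_o : ∀ x y z w, c₁₀ (o ![x, y, z]) w + c₀₁ x (o ![y, z, w]) - c₀₁ y (o ![x, z, w])
    + c₀₁ z (o ![x, y, w]) - o ![c₀₀ x y, z, w] + o ![x, c₀₀ y z, w] - o ![y, c₀₀ x z, w]
    - o ![x, y, c₀₀ z w] + o ![x, z, c₀₀ y w] - o ![y, z, c₀₀ x w] = 0

namespace CLWXAlgebra

variable (G : CLWXAlgebra A B C)

/-- The symmetric part of `∘` on `x` and `Df` is `D S(x, Df)`, and `Df ∘ x` vanishes. -/
lemma d₂_s_d₂ (x : A) (f : C) : G.d₂ (G.s x (G.d₂ f)) = G.c₀₁ x (G.d₂ f) := by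
  have h := G.symm x (G.d₂ f)
  rw [G.c₁₀_d₂] at h
  exact (sub_eq_zero.1 h.symm)

/-- Reading `S(x, Df)` as `ρ(x)f`, this is `[ρ(x), ρ(y)] = ρ(x ∘ y)`. It is the invariance axiom for
`a = Df`. -/
lemma s_d₂_comm (x y : A) (f : C) : G.s x (G.d₂ (G.s y (G.d₂ f))) =
    G.s y (G.d₂ (G.s x (G.d₂ f))) + G.s (G.c₀₀ x y) (G.d₂ f) := by
  have h := G.anchor x y (G.d₂ f)
  rw [← G.d₂_s_d₂] at h
  rw [h]
  abel

lemma c₀₁_d₂ (x : A) (f : C) : G.c₀₁ x (G.d₂ f) = G.d₂ (G.s x (G.d₂ f)) := (G.d₂_s_d₂ x f).symm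

/-- Skew-symmetry of `Ω` carries the Leibniz identity from the last slot to the other two, which is
why `CLWXAlgebra` records it only once. -/
lemma o_d₁_middle (x y : A) (a : B) :
    G.o ![x, G.d₁ a, y] = G.c₀₁ y (G.c₀₁ x a) + G.c₀₁ (G.c₀₀ x y) a - G.c₀₁ x (G.c₀₁ y a) := by
  rw [G.o_swap_right, G.o_d₁]
  abel

lemma o_d₁_left (x y : A) (a : B) :
    G.o ![G.d₁ a, x, y] = G.c₀₁ x (G.c₀₁ y a) - G.c₀₁ (G.c₀₀ x y) a - G.c₀₁ y (G.c₀₁ x a) := by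
  rw [G.o_swap_left, G.o_d₁_middle]
  abel

/-- The operation `λ₂ = ∘ + S ∘₂ D`. -/
def lam2 : Op A B C 2 :=
  bilinOp G.c₀₀ G.c₀₁ G.c₁₀ + comp (pairOp G.s) 1 1 (unary (diff 0 G.d₂))

lemma lam2_apply (v w : Tot A B C) : G.lam2 ![v, w] =
    (G.c₀₀ v.1 w.1, G.c₀₁ v.1 w.2.1 + G.c₁₀ v.2.1 w.1, G.s v.1 (G.d₂ w.2.2)) := by
  rw [lam2, add_apply, bilinOp_apply, comp_21_apply_1, pairOp_apply, unary_apply]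
  simp [diff_apply, parity_pow_one, parity_apply]

lemma homDeg_lam2 : HomDeg 0 G.lam2 :=
  (homDeg_bilinOp _ _ _).add
    ((homDeg_pairOp G.s).comp 1 1 (HomDeg.unary_diff 0 G.d₂))

/-- The weak Lie 3-algebra of `G`. -/
def weakLie3 : WeakLie3Data A B C where
  d₁ := G.d₁
  d₂ := G.d₂
  l2 := G.lam2
  l21 := pairOp G.s
  l211 := 0
  l3 := triOp G.o
  l31 := 0
  l32 := 0
  l4 := 0

lemma comp_zero_left {m k : ℕ} (i : Fin (m + 1)) (p : ℕ) (ν : Op A B C k) :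
    comp (0 : Op A B C (m + 1)) i p ν = 0 := rfl

lemma comp_zero_right {m k : ℕ} (μ : Op A B C (m + 1)) (i : Fin (m + 1)) (p : ℕ) :
    comp μ i p (0 : Op A B C k) = 0 := by
  ext1 v
  refine μ.map_coord_zero i ?_
  simp [compArgs]

lemma bdry_zero {m : ℕ} (d : Tot A B C →ₗ[ℝ] Tot A B C) (r : ℕ) :
    bdry d r (0 : Op A B C (m + 1)) = 0 := by
  simp only [bdry, comp_zero_left, Finset.sum_const_zero, smul_zero, sub_zero]
  ext1 v
  exact d.map_zero

lemma bdry_lam2 : bdry (diff G.d₁ G.d₂) 0 G.lam2 = 0 := by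
  refine (G.homDeg_lam2.bdry _ _ _).ext_two_neg_one (HomDeg.zero _) ?_ ?_ ?_ ?_ ?_ ?_ ?_ <;>
  · intro x y
    simp [bdry_2_apply, lam2_apply, proj_zero_apply, proj_one_apply, proj_two_apply, diff_apply,
      parity_apply, G.d₁_c₀₁, G.c₁₀_d₁, G.symm, G.d₁_d₂, G.s_d₁_d₂, G.d₂_s_d₂]
    -- Left over for arguments of degrees 1 and 0, where `∂(a ∘ x)` has become `-(x ∘ ∂a)` because
    -- `∂D = 0`.
    try rw [G.skew, neg_neg, sub_self]

/-- On `A` and `B` this is the Leibniz identity of the given 2-algebra. The new content is an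
argument of `C` in last place, where it says that the anchor respects brackets; all other new
patterns vanish termwise. -/
lemma jacobi_lam2 : bdry (diff G.d₁ G.d₂) 1 (triOp G.o) =
    comp G.lam2 1 0 G.lam2 - comp G.lam2 0 0 G.lam2
      - perm (List.formPerm [0, 1]) (comp G.lam2 1 0 G.lam2) := by
  have h1 := G.homDeg_lam2.comp 1 0 G.homDeg_lam2
  have h0 := G.homDeg_lam2.comp 0 0 G.homDeg_lam2
  refine ((homDeg_triOp _).bdry _ _ _).ext_three_zero ((h1.sub h0).sub (h1.perm _))
    ?_ ?_ ?_ ?_ ?_ ?_ ?_ ?_ ?_ ?_ <;>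
  · intro x y z
    simp only [-Nat.reduceAdd, bdry_3_apply, sub_apply, perm_comp_22_apply_102, comp_22_apply_0,
      comp_22_apply_1, parity_pow_zero]
    simp [Prod.ext_iff, lam2_apply, triOp_apply, proj_zero_apply, proj_one_apply, proj_two_apply,
      diff_apply, parity_apply, trilinear_zero_left, trilinear_zero_middle, trilinear_zero_right,
      G.d₁_o, G.o_d₁, G.o_d₁_middle, G.o_d₁_left, G.symm, G.c₀₁_d₂]
    -- Rewriting `a ∘ x` as `D S(x, a) - x ∘ a` leaves terms `D S(y, x ∘ a)`, which `anchor`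
    -- removes.
    try simp only [G.s_d₂_comm x.1 y.1, G.anchor, map_sub, G.skew z.1]
    try simp only [G.skew y.1 x.1, map_neg, LinearMap.neg_apply]
    try module

/-- If some argument has degree 1, every term is zero, since `Ω` vanishes on `B` and `λ₂` vanishes
on `B ⊗ B`. What remains is `o_o`. -/
lemma jacobi_lam2_o : bdry (diff G.d₁ G.d₂) 2 (0 : Op A B C 4) =
    comp G.lam2 0 1 (triOp G.o) + comp G.lam2 1 1 (triOp G.o)
      - perm (List.formPerm [0, 1]) (comp G.lam2 1 1 (triOp G.o))
      + perm (List.formPerm [0, 1, 2]) (comp G.lam2 1 1 (triOp G.o))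
      - comp (triOp G.o) 0 0 G.lam2
      + comp (triOp G.o) 1 0 G.lam2 - perm (List.formPerm [0, 1]) (comp (triOp G.o) 1 0 G.lam2)
      - comp (triOp G.o) 2 0 G.lam2 + perm (List.formPerm [1, 2]) (comp (triOp G.o) 2 0 G.lam2)
      - perm (List.formPerm [0, 2, 1]) (comp (triOp G.o) 2 0 G.lam2) := by
  have h1 := fun i p => G.homDeg_lam2.comp i p (homDeg_triOp (C := C) G.o)
  have h2 := fun i p => (homDeg_triOp (C := C) G.o).comp i p G.homDeg_lam2
  refine ((HomDeg.zero 2).bdry _ _ _).ext_four_one ?_ ?_ ?_ ?_ ?_ ?_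
  · have p1 := fun i p σ => (h1 i p).perm σ
    have p2 := fun i p σ => (h2 i p).perm σ
    exact (((((((((h1 _ _).add (h1 _ _)).sub (p1 _ _ _)).add (p1 _ _ _)).sub (h2 _ _)).add
      (h2 _ _)).sub (p2 _ _ _)).sub (h2 _ _)).add (p2 _ _ _)).sub (p2 _ _ _)
  all_goals
    intro x y z w
    simp only [-Nat.reduceAdd, bdry_4_apply, sub_apply, add_apply, zero_apply,
      perm_comp_23_apply_1023, perm_comp_23_apply_2013, perm_comp_32_apply_1023,
      perm_comp_32_apply_0213, perm_comp_32_apply_1203, comp_23_apply_0, comp_23_apply_1,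
      comp_32_apply_0, comp_32_apply_1, comp_32_apply_2, parity_pow_zero, parity_pow_one]
    simp [Prod.ext_iff, lam2_apply, triOp_apply, proj_zero_apply, proj_one_apply, proj_two_apply,
      diff_apply, parity_apply, trilinear_zero_left, trilinear_zero_middle, trilinear_zero_right]
  exact (G.o_o x.1 y.1 z.1 w.1).symm

/-- `Ω` takes values in `B` and vanishes there. -/
lemma comp_triOp_triOp (i : Fin 3) (p : ℕ) :
    comp (triOp G.o : Op A B C 3) i p (triOp G.o) = 0 := by
  ext1 v
  refine congrArg (fun b : B => ((0, b, 0) : Tot A B C)) (G.o.map_coord_zero i ?_)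
  simp [compArgs, triOp]

lemma isLeibniz3 : IsLeibniz3 G.d₁ G.d₂ G.lam2 (triOp G.o) 0 where
  complex := LinearMap.ext G.d₁_d₂
  homog2 := G.homDeg_lam2.isHomog
  homog3 := (homDeg_triOp _).isHomog
  homog4 := (HomDeg.zero _).isHomog
  jacobi2 := G.bdry_lam2
  jacobi3 := G.jacobi_lam2
  jacobi4 := G.jacobi_lam2_o
  jacobi5 := by
    simp only [comp_zero_left, comp_zero_right, comp_triOp_triOp, perm_zero]
    simp

/-- This identity explains the summand `S ∘₂ D` of `λ₂`: on `A ⊗ C` the boundary of `S` is `S(x,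
Df)`. On `A ⊗ B` it is the symmetric part of `∘`, and on `B ⊗ B` it is the symmetry of `S(∂a, b)`.
-/
lemma bdry_pairOp : bdry (diff G.d₁ G.d₂) 1 (pairOp G.s) =
    G.lam2 + perm (List.formPerm [0, 1]) G.lam2 := by
  refine ((homDeg_pairOp _).bdry _ _ _).ext_two_zero (G.homDeg_lam2.add (G.homDeg_lam2.perm _))
    ?_ ?_ ?_ ?_ ?_ ?_ <;>
  · intro x y
    simp only [bdry_2_apply, add_apply, perm_apply_10]
    simp [Prod.ext_iff, pairOp_apply, lam2_apply, proj_zero_apply, proj_one_apply, proj_two_apply,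
      diff_apply, parity_apply, G.symm]
    try first | rw [G.skew, neg_add_cancel] | rw [G.s_d₁, add_neg_cancel]

lemma pairOp_symm : perm (List.formPerm [0, 1]) (pairOp G.s) = pairOp G.s := by
  refine ((homDeg_pairOp _).perm _).ext_two_one (homDeg_pairOp _) ?_ ?_ ?_ <;>
  · intro x y
    rw [perm_apply_10]
    simp [Prod.ext_iff, pairOp_apply, proj_zero_apply, proj_one_apply]

/-- `λ₂ ∘₁ S` is zero because `λ₂` vanishes when its first argument lies in `C`; the rest is
skew-symmetry of `Ω`. -/
lemma zero_eq_triOp_add : (0 : Op A B C 3) =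
    triOp G.o + perm (List.formPerm [0, 1]) (triOp G.o) + comp G.lam2 0 1 (pairOp G.s) := by
  have h := homDeg_triOp (C := C) G.o
  refine (HomDeg.zero _).ext_three_one
    ((h.add (h.perm _)).add (G.homDeg_lam2.comp _ _ (homDeg_pairOp _))) ?_ ?_ ?_ ?_ <;>
  · intro x y z
    simp only [-Nat.reduceAdd, add_apply, zero_apply, perm_apply_102, comp_22_apply_0,
      parity_pow_one]
    simp [Prod.ext_iff, lam2_apply, triOp_apply, pairOp_apply, proj_zero_apply, proj_one_apply,
      trilinear_zero_left, trilinear_zero_middle, trilinear_zero_right]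
    try rw [G.o_swap_left, neg_add_cancel]

/-- On three arguments of degree 0 this is skew-symmetry of `Ω`. With one argument of degree 1 it
expresses the invariance of `S` under `∘`. -/
lemma zero_eq_triOp_add_sub : (0 : Op A B C 3) =
    triOp G.o + perm (List.formPerm [1, 2]) (triOp G.o) - comp G.lam2 1 1 (pairOp G.s)
      + comp (pairOp G.s) 0 0 G.lam2
      + perm (List.formPerm [0, 1]) (comp (pairOp G.s) 1 0 G.lam2) := by
  have h := homDeg_triOp (C := C) G.o
  have h' := fun i p => (homDeg_pairOp G.s).comp i p G.homDeg_lam2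
  refine (HomDeg.zero _).ext_three_one
    ((((h.add (h.perm _)).sub (G.homDeg_lam2.comp _ _ (homDeg_pairOp _))).add (h' _ _)).add
      ((h' _ _).perm _)) ?_ ?_ ?_ ?_ <;>
  · intro x y z
    simp only [-Nat.reduceAdd, add_apply, sub_apply, zero_apply, perm_apply_021, comp_22_apply_0,
      perm_comp_22_apply_102, comp_22_apply_1, parity_pow_one, parity_pow_zero]
    simp [Prod.ext_iff, lam2_apply, triOp_apply, pairOp_apply, proj_zero_apply, proj_one_apply,
      trilinear_zero_left, trilinear_zero_middle, trilinear_zero_right, parity_apply, G.symm,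
      G.anchor]
    try first
      | rw [G.o_swap_right, neg_add_cancel]
      | rw [G.skew z.1 y.1, map_neg, LinearMap.neg_apply]; module
      | module

lemma comp_triOp_pairOp (i : Fin 3) (p : ℕ) : comp (triOp G.o) i p (pairOp G.s) = 0 := by
  ext1 v
  refine congrArg (fun b : B => ((0, b, 0) : Tot A B C)) (G.o.map_coord_zero i ?_)
  simp [compArgs, pairOp]

lemma comp_pairOp_pairOp (i : Fin 2) (p : ℕ) : comp (pairOp G.s) i p (pairOp G.s) = 0 := by
  ext1 v
  fin_cases i
  · rw [eta_three v]
    refine (comp_22_apply_0 _ _ _ _ _ _).trans ?_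
    simp [pairOp_apply]
  · rw [eta_three v]
    refine (comp_22_apply_1 _ _ _ _ _ _).trans ?_
    simp [pairOp_apply]

/-- Only arguments of degree 0 count, and there it is the skew-symmetry of `S(Ω(x, y, z), w)` in `z`
and `w`. -/
lemma comp_pairOp_triOp_add : comp (pairOp G.s) 0 1 (triOp G.o)
    + perm (List.formPerm [0, 1, 2]) (comp (pairOp G.s) 1 1 (triOp G.o)) = 0 := by
  have h := fun i p => (homDeg_pairOp G.s).comp i p (homDeg_triOp (C := C) G.o)
  refine ((h _ _).add ((h _ _).perm _)).ext_two_deg (HomDeg.zero 2) fun v => ?_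
  rw [eta_four fun i => proj 0 (v i)]
  simp only [-Nat.reduceAdd, add_apply, zero_apply, perm_comp_23_apply_2013, comp_23_apply_0,
    comp_23_apply_1, parity_pow_one]
  simp [Prod.ext_iff, pairOp_apply, triOp_apply, proj_zero_apply, parity_apply]
  rw [G.s_o, neg_add_cancel]

lemma isWeakLie3 : G.weakLie3.IsWeakLie3 where
  leibniz := G.isLeibniz3
  homog21 := (homDeg_pairOp _).isHomog
  homog211 := (HomDeg.zero _).isHomog
  homog31 := (HomDeg.zero _).isHomog
  homog32 := (HomDeg.zero _).isHomog
  eq21 := G.bdry_pairOp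
  eq211 := by
    refine (bdry_zero _ _).trans ?_
    simp only [weakLie3, pairOp_symm, sub_self]
  eq31 := (bdry_zero _ _).trans G.zero_eq_triOp_add
  eq32 := (bdry_zero _ _).trans G.zero_eq_triOp_add_sub
  eq2111 := by simp only [weakLie3, perm_zero, add_zero]
  eq311 := by simp only [weakLie3, perm_zero, comp_zero_right, sub_zero]
  eq312 := by
    simp only [weakLie3, perm_zero, comp_zero_left, G.comp_pairOp_pairOp]
    simp
  eq322 := by
    simp only [weakLie3, perm_zero, comp_zero_left, comp_zero_right]
    simp
  eq41 := by
    simp only [weakLie3, perm_zero, comp_zero_left, comp_zero_right, G.comp_triOp_pairOp]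
    simp
  eq42 := by
    simp only [weakLie3, perm_zero, comp_zero_left, comp_zero_right, G.comp_triOp_pairOp]
    simp
  eq43 := by
    simp only [weakLie3, perm_zero, comp_zero_left, comp_zero_right, G.comp_triOp_pairOp]
    simp only [add_zero, sub_zero]
    exact G.comp_pairOp_triOp_add.symm

end CLWXAlgebra

end Algebra

/-! ### Closed forms of the skew-symmetrized brackets -/

section SkewSymmetrization

variable {A B C : Type*} [AddCommGroup A] [Module ℝ A] [AddCommGroup B] [Module ℝ B]
  [AddCommGroup C] [Module ℝ C]

/-- The operation of degree 1 with component `A ⊗ A ⊗ B → C` a trilinear map `t`, extended to the other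
orders of the arguments by cyclic permutation. -/
def cyclicOp (t : A →ₗ[ℝ] A →ₗ[ℝ] B →ₗ[ℝ] C) : Op A B C 3 :=
  MultilinearMap.mk' (fun v => (0, 0, t (v 0).1 (v 1).1 (v 2).2.1
      + t (v 2).1 (v 0).1 (v 1).2.1 + t (v 1).1 (v 2).1 (v 0).2.1))
    (fun v i x y => by
      have h01 : (0 : Fin 3) ≠ 1 := by decide
      have h02 : (0 : Fin 3) ≠ 2 := by decide
      have h12 : (1 : Fin 3) ≠ 2 := by decide
      have hi : i = 0 ∨ i = 1 ∨ i = 2 := by revert i; decide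
      rcases hi with rfl | rfl | rfl <;>
      · refine Prod.ext (by simp) (Prod.ext (by simp) ?_)
        simp only [Function.update_self, Function.update_of_ne, ne_eq, h01, h02, h12, h01.symm,
          h02.symm, h12.symm, not_false_eq_true, Prod.fst_add, Prod.snd_add, map_add,
          LinearMap.add_apply]
        abel)
    (fun v i c x => by
      have h01 : (0 : Fin 3) ≠ 1 := by decide
      have h02 : (0 : Fin 3) ≠ 2 := by decide
      have h12 : (1 : Fin 3) ≠ 2 := by decide
      have hi : i = 0 ∨ i = 1 ∨ i = 2 := by revert i; decide
      rcases hi with rfl | rfl | rfl <;>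
      · refine Prod.ext (by simp) (Prod.ext (by simp) ?_)
        simp only [Function.update_self, Function.update_of_ne, ne_eq, h01, h02, h12, h01.symm,
          h02.symm, h12.symm, not_false_eq_true, Prod.smul_fst, Prod.smul_snd, map_smul,
          LinearMap.smul_apply, smul_add])

namespace CLWXAlgebra

variable (G : CLWXAlgebra A B C)

/-- The bracket `[x, a] = (x ∘ a - a ∘ x) / 2`. -/
def bracket : A →ₗ[ℝ] B →ₗ[ℝ] B := (1 / 2 : ℝ) • (G.c₀₁ - G.c₁₀.flip)

lemma bracket_apply (x : A) (a : B) :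
    G.bracket x a = (1 / 2 : ℝ) • (G.c₀₁ x a - G.c₁₀ a x) := rfl

lemma bracket_eq (x : A) (a : B) :
    G.bracket x a = G.c₀₁ x a - (1 / 2 : ℝ) • G.d₂ (G.s x a) := by
  rw [bracket_apply, G.symm]
  module

/-- The trilinear map `(x, y, a) ↦ S(x, [y, a]) + S(x ∘ y, a) - S(y, [x, a])`. -/
def tripleForm : A →ₗ[ℝ] A →ₗ[ℝ] B →ₗ[ℝ] C :=
  LinearMap.mk₂ ℝ (fun x y => G.s x ∘ₗ G.bracket y + G.s (G.c₀₀ x y) - G.s y ∘ₗ G.bracket x)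
    (fun x x' y => by
      simp only [map_add, LinearMap.add_apply, LinearMap.comp_add, LinearMap.add_comp]; abel)
    (fun c x y => by
      simp only [map_smul, LinearMap.smul_apply, LinearMap.comp_smul, LinearMap.smul_comp]; module)
    (fun x y y' => by
      simp only [map_add, LinearMap.add_apply, LinearMap.comp_add, LinearMap.add_comp]; abel)
    (fun c x y => by
      simp only [map_smul, LinearMap.smul_apply, LinearMap.comp_smul, LinearMap.smul_comp]; module)

lemma tripleForm_apply (x y : A) (a : B) : G.tripleForm x y a =
    G.s x (G.bracket y a) + G.s (G.c₀₀ x y) a - G.s y (G.bracket x a) := rfl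

/-- A normal form without brackets of mixed degree. By `anchor`, each of `S(x, [y, a])` and `-S(y,
[x, a])` contributes `S(x ∘ y, a)` once more, and the `D`-terms get coefficient `1 + 1/2`. -/
lemma tripleForm_eq (x y : A) (a : B) : G.tripleForm x y a = (3 : ℝ) • G.s (G.c₀₀ x y) a
    + (3 / 2 : ℝ) • (G.s y (G.d₂ (G.s x a)) - G.s x (G.d₂ (G.s y a))) := by
  rw [tripleForm_apply, G.bracket_eq, G.bracket_eq, map_sub, map_sub, map_smul, map_smul, G.anchor,
    G.anchor, G.skew y x, map_neg, LinearMap.neg_apply]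
  module

lemma alt_two (μ : Op A B C 2) : alt μ = μ - perm (List.formPerm [0, 1]) μ := by
  have hs : (Finset.univ : Finset (Equiv.Perm (Fin 2))).val = {1, List.formPerm [0, 1]} := by
    decide +kernel
  have h2 : (Equiv.Perm.sign (List.formPerm [0, 1] : Equiv.Perm (Fin 2)) : ℤ) = -1 := by
    decide +kernel
  rw [alt, Finset.sum, hs]
  simp only [Multiset.insert_eq_cons, Multiset.map_cons, Multiset.map_singleton,
    Multiset.sum_cons, Multiset.sum_singleton, h2, Equiv.Perm.sign_one, perm_one]
  simp only [Units.val_one, one_smul, neg_smul]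
  abel

/-- The binary bracket of the skew-symmetrization, in closed form. -/
def lie2 : Op A B C 2 :=
  bilinOp G.c₀₀ G.bracket (-G.bracket.flip) + (1 / 2 : ℝ) •
    (comp (pairOp G.s) 1 1 (unary (diff 0 G.d₂)) - comp (pairOp G.s) 0 1 (unary (diff 0 G.d₂)))

lemma lie2_apply (v w : Tot A B C) : G.lie2 ![v, w] =
    (G.c₀₀ v.1 w.1, G.bracket v.1 w.2.1 - G.bracket w.1 v.2.1,
      (1 / 2 : ℝ) • (G.s v.1 (G.d₂ w.2.2) - G.s w.1 (G.d₂ v.2.2))) := by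
  rw [lie2, add_apply, smul_apply, sub_apply, bilinOp_apply, comp_21_apply_1, comp_21_apply_0,
    pairOp_apply, pairOp_apply, unary_apply, unary_apply]
  simp [diff_apply, parity_pow_one, parity_apply, sub_eq_add_neg]

lemma homDeg_pairOp_d₂ (i : Fin 2) : HomDeg 0 (comp (pairOp G.s) i 1 (unary (diff 0 G.d₂))) :=
  (homDeg_pairOp G.s).comp i 1 (HomDeg.unary_diff 0 G.d₂)

lemma homDeg_lie2 : HomDeg 0 G.lie2 :=
  (homDeg_bilinOp _ _ _).add (((G.homDeg_pairOp_d₂ 1).sub (G.homDeg_pairOp_d₂ 0)).smul _)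

lemma lie2_eq_half_alt : G.lie2 = (1 / 2 : ℝ) • alt G.lam2 := by
  refine G.homDeg_lie2.ext_two_zero (G.homDeg_lam2.alt.smul _) ?_ ?_ ?_ ?_ ?_ ?_ <;>
  · intro x y
    rw [alt_two]
    simp only [smul_apply, sub_apply, perm_apply_10]
    simp [Prod.ext_iff, lie2_apply, lam2_apply, proj_zero_apply, proj_one_apply, proj_two_apply,
      bracket_apply]
    try rw [G.skew y.1 x.1]; module
    try module

lemma lie2_eq : G.lie2 = (1 / 2 : ℝ) • (bilinOp G.c₀₀ G.c₀₁ G.c₁₀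
    - perm (List.formPerm [0, 1]) (bilinOp G.c₀₀ G.c₀₁ G.c₁₀)
    - comp (pairOp G.s) 0 1 (unary (diff 0 G.d₂))
    + comp (pairOp G.s) 1 1 (unary (diff 0 G.d₂))) := by
  have h := homDeg_bilinOp (C := C) G.c₀₀ G.c₀₁ G.c₁₀
  refine G.homDeg_lie2.ext_two_zero (((((h.sub (h.perm _)).sub (G.homDeg_pairOp_d₂ 0)).add
    (G.homDeg_pairOp_d₂ 1))).smul _) ?_ ?_ ?_ ?_ ?_ ?_ <;>
  · intro x y
    simp only [smul_apply, sub_apply, add_apply, perm_apply_10, comp_21_apply_1, comp_21_apply_0]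
    simp [Prod.ext_iff, lie2_apply, bilinOp_apply, pairOp_apply, unary_apply, diff_apply,
      proj_zero_apply, proj_one_apply, proj_two_apply, bracket_apply, parity_pow_one, parity_apply]
    try rw [G.skew y.1 x.1]; module
    try module

/-- The operation of degree 1 whose component `A ⊗ A ⊗ B → C` is `tripleForm`. -/
def tripleOp : Op A B C 3 := cyclicOp G.tripleForm

lemma tripleOp_apply (u v w : Tot A B C) : G.tripleOp ![u, v, w] =
    (0, 0, G.tripleForm u.1 v.1 w.2.1 + G.tripleForm w.1 u.1 v.2.1
      + G.tripleForm v.1 w.1 u.2.1) := rfl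

lemma homDeg_tripleOp : HomDeg 1 G.tripleOp := fun v => by
  simp [tripleOp, cyclicOp, weight_apply, ← smul_add, smul_smul]
  norm_num

/-- The six orders of `x, y, a` pair up: skew-symmetry of `∘` on `A` doubles `S(x ∘ y, a)`, and `y ∘
a - a ∘ y` is twice the bracket. -/
lemma alt_comp_bilinOp :
    alt (comp (pairOp G.s) 0 0 (bilinOp G.c₀₀ G.c₀₁ G.c₁₀)) = (2 : ℝ) • G.tripleOp := by
  have h := (homDeg_pairOp G.s).comp 0 0 (homDeg_bilinOp (C := C) G.c₀₀ G.c₀₁ G.c₁₀)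
  refine h.alt.ext_three_one (G.homDeg_tripleOp.smul _) ?_ ?_ ?_ ?_ <;>
  · intro x y z
    rw [alt_comp_22, alt_three_proj _ _ _ _ (by decide)]
    simp [Prod.ext_iff, comp_22_apply_0, pairOp_apply, tripleOp_apply, bilinOp_apply,
      tripleForm_apply, bracket_apply, smul_apply, proj_zero_apply, proj_one_apply]
    try rw [G.skew y.1 x.1]
    try rw [G.skew z.1 x.1]
    try rw [G.skew z.1 y.1]
    try simp only [map_neg, LinearMap.neg_apply]
    try module

/-- The summand `S ∘₂ D` of `λ₂` does not contribute, as `S` vanishes on `C`. Since `S` is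
symmetric, the two composites differ by a cyclic permutation, which is even, so each contributes `2
• tripleOp`. -/
lemma alt_comp_lam2 :
    alt (comp (pairOp G.s) 0 0 G.lam2 + comp (pairOp G.s) 1 0 G.lam2) = (4 : ℝ) • G.tripleOp := by
  have h := fun i => (homDeg_pairOp G.s).comp i 0 G.homDeg_lam2
  rw [alt_add]
  refine ((h 0).alt.add (h 1).alt).ext_three_one (G.homDeg_tripleOp.smul _) ?_ ?_ ?_ ?_ <;>
  · intro x y z
    rw [add_apply, alt_comp_22, alt_comp_22, alt_three_proj _ _ _ _ (by decide),
      alt_three_proj _ _ _ _ (by decide)]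
    simp [Prod.ext_iff, comp_22_apply_0, comp_22_apply_1, pairOp_apply, tripleOp_apply, lam2_apply,
      tripleForm_apply, bracket_apply, smul_apply, proj_zero_apply, proj_one_apply,
      parity_pow_zero]
    try rw [G.skew y.1 x.1]
    try rw [G.skew z.1 x.1]
    try rw [G.skew z.1 y.1]
    try simp only [map_neg, LinearMap.neg_apply]
    try module

lemma alt_triOp : alt (triOp G.o : Op A B C 3) = (6 : ℝ) • triOp G.o := by
  have h := homDeg_triOp (C := C) G.o
  refine h.alt.ext_three_one (h.smul _) ?_ ?_ ?_ ?_ <;>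
  · intro x y z
    rw [alt_three_proj _ _ _ _ (by decide)]
    simp [Prod.ext_iff, triOp_apply, smul_apply, proj_zero_apply, proj_one_apply,
      trilinear_zero_left, trilinear_zero_middle, trilinear_zero_right]
    try rw [G.o_swap_left z.1 y.1 x.1, G.o_swap_right y.1 z.1 x.1, G.o_swap_left y.1 x.1 z.1,
      G.o_swap_left z.1 x.1 y.1, G.o_swap_right x.1 z.1 y.1]; module

/-- The ternary bracket of the skew-symmetrization, in closed form. -/
def lie3 : Op A B C 3 := triOp G.o - (1 / 6 : ℝ) • G.tripleOp

lemma lie3_apply (u v w : Tot A B C) : G.lie3 ![u, v, w] =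
    (0, G.o ![u.1, v.1, w.1], -((1 / 6 : ℝ) • (G.tripleForm u.1 v.1 w.2.1
      + G.tripleForm w.1 u.1 v.2.1 + G.tripleForm v.1 w.1 u.2.1))) := by
  rw [lie3, sub_apply, smul_apply, triOp_apply, tripleOp_apply]
  simp

lemma homDeg_lie3 : HomDeg 1 G.lie3 := (homDeg_triOp _).sub (G.homDeg_tripleOp.smul _)

lemma lie3_eq : G.lie3 = triOp G.o -
    (1 / 12 : ℝ) • alt (comp (pairOp G.s) 0 0 (bilinOp G.c₀₀ G.c₀₁ G.c₁₀)) := by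
  rw [lie3, alt_comp_bilinOp, smul_smul]
  norm_num

/-- The quaternary bracket of the skew-symmetrization, in closed form. -/
def lie4 : Op A B C 4 := comp (pairOp G.s) 0 1 (triOp G.o)

lemma lie4_apply (x y z w : Tot A B C) : G.lie4 ![x, y, z, w] =
    (0, 0, G.s w.1 (G.o ![x.1, y.1, z.1])) := by
  rw [lie4, comp_23_apply_0, pairOp_apply, triOp_apply]
  simp

lemma homDeg_lie4 : HomDeg 2 G.lie4 := (homDeg_pairOp G.s).comp 0 1 (homDeg_triOp (C := C) G.o)

/-- Adjacent transpositions generate the symmetric group, and both the action and the sign are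
multiplicative. -/
lemma isSkew_of_swap {n : ℕ} {μ : Op A B C (n + 1)}
    (h : ∀ i : Fin n, perm (Equiv.swap i.castSucc i.succ) μ = -μ) : IsSkew μ := fun σ => by
  have hσ : σ ∈ Submonoid.closure
      (Set.range fun i : Fin n => Equiv.swap i.castSucc i.succ) := by
    rw [Equiv.Perm.mclosure_swap_castSucc_succ]
    trivial
  induction hσ using Submonoid.closure_induction with
  | mem τ hτ =>
    obtain ⟨i, rfl⟩ := hτ
    rw [h i, Equiv.Perm.sign_swap (Fin.castSucc_lt_succ (i := i)).ne]
    simp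
  | one => rw [perm_one, Equiv.Perm.sign_one, Units.val_one, one_smul]
  | mul σ τ _ _ hσ hτ =>
    rw [← perm_perm, hσ, perm_zsmul, hτ, smul_smul, Equiv.Perm.sign_mul, Units.val_mul]

/-- The first two adjacent exchanges are those of the alternating form `Ω`; the third is the axiom
`s_o`. -/
lemma isSkew_lie4 : IsSkew G.lie4 := by
  refine isSkew_of_swap fun i =>
    (G.homDeg_lie4.perm _).ext_two_deg G.homDeg_lie4.neg fun v => ?_
  rw [perm_apply_proj_zero, neg_apply, eta_four fun t => proj 0 (v t), eta_four fun t => proj 0 _,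
    lie4_apply, lie4_apply]
  have hi : i = 0 ∨ i = 1 ∨ i = 2 := by revert i; decide
  rcases hi with rfl | rfl | rfl
  · change (0, 0, G.s (v 3).1 (G.o ![(v 1).1, (v 0).1, (v 2).1])) = _
    simp [Prod.ext_iff, proj_zero_apply]
    rw [G.o_swap_left, map_neg]
  · change (0, 0, G.s (v 3).1 (G.o ![(v 0).1, (v 2).1, (v 1).1])) = _
    simp [Prod.ext_iff, proj_zero_apply]
    rw [G.o_swap_right, map_neg]
  · change (0, 0, G.s (v 2).1 (G.o ![(v 0).1, (v 1).1, (v 3).1])) = _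
    simp [Prod.ext_iff, proj_zero_apply]
    rw [G.s_o]

lemma alt_cast {n m : ℕ} (h : n = m) (κ : Op A B C n) : h ▸ alt κ = alt (h ▸ κ) := by
  subst h
  rfl

lemma alt_comp_23 (μ : Op A B C 2) (p : Fin 2) (s : ℕ) (ν : Op A B C 3) :
    (alt (n := 1 + 3) (comp μ p s ν) : Op A B C 4) = alt (n := 4) (comp μ p s ν) :=
  alt_cast (n := 1 + 3) (m := 4) rfl _

lemma perm_comp_23_cast (μ : Op A B C 2) (p : Fin 2) (s : ℕ) (ν : Op A B C 3) :
    (perm (n := 1 + 3) (List.formPerm [0, 1, 2]) (comp μ p s ν) : Op A B C 4) =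
      perm (n := 4) (List.formPerm [0, 1, 2]) (comp μ p s ν) :=
  perm_cast (n := 1 + 3) (m := 4) rfl (List.formPerm [0, 1, 2]) _

/-- By `comp_pairOp_triOp_add` the two composites of `S` and `Ω` are negatives of each other up to a
3-cycle, which is even. -/
lemma alt_comp_triOp_one : alt (n := 4) (comp (pairOp G.s) 1 1 (triOp G.o)) = -alt G.lie4 := by
  have h : G.lie4 = -perm (n := 4) (List.formPerm [0, 1, 2])
      (comp (pairOp G.s) 1 1 (triOp G.o)) := by
    rw [← perm_comp_23_cast]
    exact eq_neg_of_add_eq_zero_left G.comp_pairOp_triOp_add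
  have h2 : (Equiv.Perm.sign (List.formPerm [0, 1, 2] : Equiv.Perm (Fin 4)) : ℤ) = 1 := by
    decide +kernel
  rw [h, alt_neg, alt_perm, h2, one_smul, neg_neg]

lemma skewSymm_eq : G.weakLie3.skewSymm = ⟨G.d₁, G.d₂, G.lie2, G.lie3, G.lie4⟩ := by
  have h4 : (4 : ℕ).factorial = 24 := rfl
  have e4 : alt G.lie4 = (24 : ℝ) • G.lie4 := by
    rw [G.isSkew_lie4.alt_eq, h4]
    norm_cast
  unfold WeakLie3Data.skewSymm
  congr 1
  · exact G.lie2_eq_half_alt.symm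
  · simp only [weakLie3, alt_triOp, alt_comp_lam2, lie3, smul_smul]
    norm_num
  · simp only [weakLie3, comp_zero_left, alt_zero, sub_zero, add_zero, smul_zero, zero_add]
    -- The two terms of the difference each give `24 • lie4`, which cancels the factor `1 / 48`.
    rw [alt_sub, alt_comp_23, alt_comp_23, alt_comp_triOp_one, ← lie4, e4]
    module

end CLWXAlgebra

end SkewSymmetrization

/-! ### The Lie 3-algebra identities -/

section Jacobi

variable {A B C : Type*} [AddCommGroup A] [Module ℝ A] [AddCommGroup B] [Module ℝ B]
  [AddCommGroup C] [Module ℝ C]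

namespace CLWXAlgebra

variable (G : CLWXAlgebra A B C)

lemma s_c₀₀_d₂ (x y : A) (f : C) : G.s (G.c₀₀ x y) (G.d₂ f) =
    G.s x (G.d₂ (G.s y (G.d₂ f))) - G.s y (G.d₂ (G.s x (G.d₂ f))) := by
  rw [G.s_d₂_comm x y]
  abel

/-- Since `x ∘ ∂a = ∂(x ∘ a)`, symmetry of `S(∂·, ·)` brings `anchor` into play. It serves the
patterns with two arguments of degree 1. -/
lemma s_c₀₀_d₁ (x : A) (a b : B) : G.s (G.c₀₀ x (G.d₁ a)) b =
    G.s x (G.d₂ (G.s (G.d₁ a) b)) - G.s (G.c₀₀ x (G.d₁ b)) a := by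
  rw [← G.d₁_c₀₁, G.s_d₁, G.anchor, G.s_d₁ b]

lemma o_rotate (x y z : A) : G.o ![x, y, z] = G.o ![z, x, y] := by
  rw [G.o_swap_right, G.o_swap_left, neg_neg]

/-- The relation `o_o` with every inner bracket moved to the first slot of `Ω`, the shape in which
the terms of `l₃ ∘₁ l₂` appear. -/
lemma o_bracket (x y z w : A) : G.c₁₀ (G.o ![x, y, z]) w + G.c₀₁ x (G.o ![y, z, w])
    - G.c₀₁ y (G.o ![x, z, w]) + G.c₀₁ z (G.o ![x, y, w]) - G.o ![G.c₀₀ x y, z, w]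
    - G.o ![G.c₀₀ y z, x, w] + G.o ![G.c₀₀ x z, y, w] - G.o ![G.c₀₀ z w, x, y]
    + G.o ![G.c₀₀ y w, x, z] - G.o ![G.c₀₀ x w, y, z] = 0 := by
  rw [← G.o_o x y z w, G.o_swap_left x (G.c₀₀ y z), G.o_swap_left y (G.c₀₀ x z),
    G.o_rotate x y (G.c₀₀ z w), G.o_rotate x z (G.c₀₀ y w), G.o_rotate y z (G.c₀₀ x w)]
  abel

lemma s_o_middle (x y z w : A) : G.s y (G.o ![x, z, w]) = G.s w (G.o ![x, y, z]) := by
  rw [G.s_o, G.o_swap_right, map_neg, neg_neg]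

lemma s_o_left (x y z w : A) : G.s x (G.o ![y, z, w]) = -G.s w (G.o ![x, y, z]) := by
  rw [G.s_o, G.o_rotate]

lemma bdry_lie2 : bdry (diff G.d₁ G.d₂) 0 G.lie2 = 0 := by
  refine (G.homDeg_lie2.bdry _ _ _).ext_two_neg_one (HomDeg.zero _) ?_ ?_ ?_ ?_ ?_ ?_ ?_ <;>
    intro x y <;> rw [bdry_2_apply] <;>
    simp [Prod.ext_iff, lie2_apply, proj_zero_apply, proj_one_apply, proj_two_apply, diff_apply,
      parity_apply, bracket_eq, G.d₁_c₀₁, G.c₀₁_d₂, G.d₁_d₂, G.s_d₁_d₂]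
  · rw [G.skew y.1]
    abel
  · module
  · module
  -- The claim is `[∂a, b] + [∂b, a] = 0`. The sum `∂a ∘ b + ∂b ∘ a` equals `D S(∂b, a)`, and the
  -- two halves subtracted in the brackets cancel it.
  · have h := G.c₁₀_d₁ x.2.1 y.2.1
    rw [G.symm] at h
    rw [← h, G.s_d₁ x.2.1]
    module

/-- On `A ⊗ A ⊗ B` the Jacobi sums of `[·,·]` and `∘` differ by a `D`-exact term, and the factor `1
/ 6` of `tripleForm` is what accounts for it. -/
lemma bdry_lie3 : bdry (diff G.d₁ G.d₂) 1 G.lie3 = -shSum 2 (comp G.lie2 0 0 G.lie2) := by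
  have h := G.homDeg_lie2.comp 0 0 G.homDeg_lie2
  refine (G.homDeg_lie3.bdry _ _ _).ext_three_zero (h.shSum _).neg
    ?_ ?_ ?_ ?_ ?_ ?_ ?_ ?_ ?_ ?_ <;>
    intro x y z <;> rw [shSum_comp_22] <;>
    simp only [bdry_3_apply, neg_apply, sub_apply, add_apply, perm_apply_021, perm_apply_120,
      comp_22_apply_0] <;>
    simp [Prod.ext_iff, lie2_apply, lie3_apply, proj_zero_apply, proj_one_apply, proj_two_apply,
      diff_apply, parity_apply, trilinear_zero_left, trilinear_zero_middle, trilinear_zero_right,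
      bracket_eq, tripleForm_eq]
  · rw [G.d₁_o, G.skew (G.c₀₀ y.1 z.1), G.skew (G.c₀₀ x.1 z.1)]
    abel
  · simp only [G.o_d₁, G.c₀₁_d₂, G.anchor, map_sub]
    rw [G.skew y.1 x.1]
    simp only [map_neg, LinearMap.neg_apply]
    module
  · simp only [G.o_d₁_middle, G.c₀₁_d₂, G.anchor, map_sub]
    rw [G.skew z.1 x.1]
    simp only [map_neg, LinearMap.neg_apply]
    module
  · simp only [G.o_d₁_left, G.c₀₁_d₂, G.anchor, map_sub]
    rw [G.skew z.1 y.1]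
    simp only [map_neg, LinearMap.neg_apply]
    module
  -- With one argument in `C`, both sides are multiples of a commutator of two anchored derivations
  -- applied to `f`; the next two goals are alike.
  · simp only [G.s_c₀₀_d₂]
    module
  · simp only [G.s_c₀₀_d₂]
    module
  · simp only [G.s_c₀₀_d₂]
    module
  -- With two arguments in `B`, here and in the remaining goals, terms `S(∂a, Df)` vanish and
  -- `s_c₀₀_d₁` relates the rest.
  · rw [G.skew _ x.1]
    simp only [map_neg, LinearMap.neg_apply, G.s_d₁_d₂]
    rw [G.s_c₀₀_d₁ x.1 y.2.1 z.2.1, G.s_d₁ z.2.1 y.2.1]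
    module
  · rw [G.skew _ y.1]
    simp only [map_neg, LinearMap.neg_apply, G.s_d₁_d₂]
    rw [G.s_c₀₀_d₁ y.1 x.2.1 z.2.1, G.s_d₁ z.2.1 x.2.1]
    module
  · rw [G.skew _ z.1]
    simp only [map_neg, LinearMap.neg_apply, G.s_d₁_d₂]
    rw [G.s_c₀₀_d₁ z.1 x.2.1 y.2.1, G.s_d₁ y.2.1 x.2.1]
    module

lemma bdry_lie4 : bdry (diff G.d₁ G.d₂) 2 G.lie4 =
    -shSum 2 (comp G.lie3 0 0 G.lie2) + shSum 3 (comp G.lie2 0 1 G.lie3) := by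
  have h1 := G.homDeg_lie3.comp 0 0 G.homDeg_lie2
  have h2 := G.homDeg_lie2.comp 0 1 G.homDeg_lie3
  refine (G.homDeg_lie4.bdry _ _ _).ext_four_one ((h1.shSum _).neg.add (h2.shSum _))
    ?_ ?_ ?_ ?_ ?_ <;>
    intro x y z w <;>
    rw [shSum_comp_32, shSum_comp_23, add_apply, neg_apply,
      shSum_four_two_proj _ _ _ _ _ (by decide), shSum_four_three_proj _ _ _ _ _ (by decide),
      bdry_4_apply] <;>
    simp only [comp_32_apply_0, comp_23_apply_0] <;>
    simp [Prod.ext_iff, lie2_apply, lie3_apply, lie4_apply, proj_zero_apply, proj_one_apply,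
      proj_two_apply, diff_apply, parity_apply, trilinear_zero_left, trilinear_zero_middle,
      trilinear_zero_right, bracket_eq, tripleForm_eq]
  -- Once `Ω(x, y, z) ∘ w` is replaced by `D S(w, Ω(x, y, z)) - w ∘ Ω(x, y, z)`, the difference of
  -- the two sides is the negative of `o_bracket`.
  · have h := G.o_bracket x.1 y.1 z.1 w.1
    rw [G.symm] at h
    rw [G.s_o x.1 y.1 w.1 z.1, G.s_o_middle x.1 y.1, G.s_o_left x.1 y.1]
    simp only [map_neg]
    refine sub_eq_zero.1 (Eq.trans ?_ (neg_eq_zero.2 h))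
    module
  -- `S(∂a, Ω(x, y, z)) = S(∂Ω(x, y, z), a)`, and `∂Ω` is the Jacobi sum of `∘`. All terms then
  -- reduce to iterated anchors and brackets paired with `a`. In the later goals `∂a` is first moved
  -- out of `Ω` by skew-symmetry.
  · rw [G.s_d₁, G.d₁_o]
    simp only [G.anchor, G.s_c₀₀_d₂, map_sub, LinearMap.sub_apply, G.skew y.1 x.1, G.skew z.1 x.1, G.skew z.1 y.1,
      G.skew x.1 (G.c₀₀ _ _), G.skew y.1 (G.c₀₀ _ _), G.skew z.1 (G.c₀₀ _ _), map_neg, LinearMap.neg_apply]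
    module
  · rw [G.s_o, G.s_d₁, G.d₁_o]
    simp only [G.anchor, G.s_c₀₀_d₂, map_sub, LinearMap.sub_apply, G.skew y.1 x.1, G.skew w.1 x.1, G.skew w.1 y.1,
      G.skew x.1 (G.c₀₀ _ _), G.skew y.1 (G.c₀₀ _ _), G.skew w.1 (G.c₀₀ _ _), map_neg, LinearMap.neg_apply]
    module
  · rw [G.o_swap_right, map_neg, G.s_o, G.s_d₁, G.d₁_o]
    simp only [G.anchor, G.s_c₀₀_d₂, map_sub, LinearMap.sub_apply, G.skew z.1 x.1, G.skew w.1 x.1, G.skew w.1 z.1,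
      G.skew x.1 (G.c₀₀ _ _), G.skew z.1 (G.c₀₀ _ _), G.skew w.1 (G.c₀₀ _ _), map_neg, LinearMap.neg_apply]
    module
  · rw [G.o_swap_left, G.o_swap_right, neg_neg, G.s_o, G.s_d₁, G.d₁_o]
    simp only [G.anchor, G.s_c₀₀_d₂, map_sub, LinearMap.sub_apply, G.skew z.1 y.1, G.skew w.1 y.1, G.skew w.1 z.1,
      G.skew y.1 (G.c₀₀ _ _), G.skew z.1 (G.c₀₀ _ _), G.skew w.1 (G.c₀₀ _ _), map_neg, LinearMap.neg_apply]
    module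

lemma zero_eq_shSum : (0 : Op A B C 5) = -shSum 2 (comp G.lie4 0 0 G.lie2)
    - shSum 3 (comp G.lie3 0 1 G.lie3) - shSum 4 (comp G.lie2 0 2 G.lie4) := by
  have h1 := G.homDeg_lie4.comp 0 0 G.homDeg_lie2
  have h2 := G.homDeg_lie3.comp 0 1 G.homDeg_lie3
  have h3 := G.homDeg_lie2.comp 0 2 G.homDeg_lie4
  refine (HomDeg.zero 2).ext_two_deg (((h1.shSum _).neg.sub (h2.shSum _)).sub (h3.shSum _))
    fun v => ?_
  rw [eta_five fun t => proj 0 (v t)]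
  generalize v 0 = x
  generalize v 1 = y
  generalize v 2 = z
  generalize v 3 = w
  generalize v 4 = u
  rw [shSum_comp_42, shSum_comp_33, shSum_comp_24, sub_apply, sub_apply, neg_apply,
    shSum_five_two_proj_zero, shSum_five_three_proj_zero, shSum_five_four_proj_zero]
  simp only [comp_42_apply_0, comp_33_apply_0, comp_24_apply_0]
  simp [Prod.ext_iff, lie2_apply, lie3_apply, lie4_apply, proj_zero_apply, trilinear_zero_left,
    trilinear_zero_middle, trilinear_zero_right, bracket_eq, tripleForm_eq]
  have h := congrArg (G.s u.1) (G.o_bracket x.1 y.1 z.1 w.1)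
  rw [G.symm] at h
  simp only [map_add, map_sub, map_zero, G.anchor] at h
  -- Applied with `p` a bracket, this moves the bracket out of `Ω` and into the pairing; the
  -- remaining rewrites fix the order of the other arguments.
  have h4 : ∀ p a b c : A, G.s a (G.o ![p, b, c]) = -G.s p (G.o ![b, c, a]) := fun p a b c => by
    rw [G.s_o_left p, neg_neg]
  simp only [h4 (G.c₀₀ _ _)] at h ⊢
  simp only [G.s_o x.1 y.1 u.1 z.1, G.s_o x.1 y.1 u.1 w.1, G.s_o x.1 z.1 u.1 w.1,
    G.s_o y.1 z.1 u.1 w.1, G.s_o_middle x.1 y.1 z.1 u.1, G.s_o_middle x.1 z.1 w.1 u.1,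
    G.s_o_middle x.1 y.1 w.1 u.1, G.s_o_middle y.1 z.1 w.1 u.1, G.s_o_left x.1 y.1 z.1 u.1,
    G.s_o_left x.1 y.1 w.1 u.1, G.s_o_left x.1 z.1 w.1 u.1, G.s_o_left y.1 z.1 w.1 u.1,
    G.s_o x.1 y.1 w.1 z.1, G.s_o_middle x.1 y.1 z.1 w.1, G.s_o_left x.1 y.1 z.1 w.1, map_neg]
  -- In this normal form the full sum is `3 / 2` times the relation `o_bracket` paired with the
  -- fifth argument.
  refine (smul_eq_zero_of_right (3 / 2 : ℝ) h).symm.trans ?_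
  module

lemma isSkew_lie2 : IsSkew G.lie2 := by
  rw [G.lie2_eq_half_alt]
  exact (isSkew_alt _).smul _

/-- Both summands are multiples of antisymmetrizations, by `alt_triOp` and `alt_comp_bilinOp`. -/
lemma isSkew_lie3 : IsSkew G.lie3 := by
  have h1 : IsSkew ((1 / 6 : ℝ) • alt (triOp G.o : Op A B C 3)) := (isSkew_alt _).smul _
  have h2 : IsSkew ((1 / 2 : ℝ) •
      alt (n := 3) (comp (pairOp G.s) 0 0 (bilinOp G.c₀₀ G.c₀₁ G.c₁₀))) := (isSkew_alt _).smul _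
  rw [alt_triOp, smul_smul] at h1
  rw [← alt_comp_22, alt_comp_bilinOp, smul_smul] at h2
  norm_num at h1 h2
  exact h1.sub (h2.smul _)

lemma isLie3 : (⟨G.d₁, G.d₂, G.lie2, G.lie3, G.lie4⟩ : Lie3Data A B C).IsLie3 := by
  constructor
  · exact LinearMap.ext G.d₁_d₂
  · exact G.homDeg_lie2.isHomog
  · exact G.homDeg_lie3.isHomog
  · exact G.homDeg_lie4.isHomog
  · exact G.isSkew_lie2
  · exact G.isSkew_lie3
  · exact G.isSkew_lie4
  · exact G.bdry_lie2
  · exact G.bdry_lie3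
  · dsimp only
    exact G.bdry_lie4
  · dsimp only
    exact G.zero_eq_shSum

end CLWXAlgebra

end Jacobi

/-! ### Global sections through a given vector -/

section Sections

variable {E : Type*} [NormedAddCommGroup E] [NormedSpace ℝ E] [FiniteDimensional ℝ E]
  {M : Type*} [TopologicalSpace M] [T2Space M] [SecondCountableTopology M]
  [ChartedSpace E M] [IsManifold 𝓘(ℝ, E) ∞ M]

/-- A partition of unity glues local sections subject to a fibrewise convex condition: being `v`
over `p`, and nothing elsewhere. -/
lemma exists_section_eq (F : Type*) [NormedAddCommGroup F] [NormedSpace ℝ F]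
    {V : M → Type*} [∀ x, AddCommGroup (V x)] [∀ x, Module ℝ (V x)]
    [∀ x, TopologicalSpace (V x)] [TopologicalSpace (TotalSpace F V)]
    [FiberBundle F V] [VectorBundle ℝ F V] [ContMDiffVectorBundle ∞ F V 𝓘(ℝ, E)]
    (p : M) (v : V p) : ∃ s : ContMDiffSection 𝓘(ℝ, E) F ∞ V, s p = v := by
  classical
  have : LocallyCompactSpace M := ChartedSpace.locallyCompactSpace E M
  have hc : ∀ x, Convex ℝ {u : V x | ∀ h : x = p, h ▸ u = v} := fun x => by
    rcases eq_or_ne x p with rfl | hx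
    · intro a ha b hb c d _ _ hcd h
      have ha' : a = v := ha rfl
      have hb' : b = v := hb rfl
      change c • a + d • b = v
      rw [ha', hb', ← add_smul, hcd, one_smul]
    · exact fun a _ b _ c d _ _ _ h => absurd h hx
  obtain ⟨s, hs⟩ := exists_contMDiffSection_forall_mem_convex_of_local (n := ⊤) (F_fiber := F)
    𝓘(ℝ, E) V (fun x => {u : V x | ∀ h : x = p, h ▸ u = v}) hc fun x => by
      rcases eq_or_ne x p with rfl | hx
      · obtain ⟨U, hU, h⟩ := FiberBundle.exists_contMDiffOn_extend (k := ∞) 𝓘(ℝ, E) F v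
        refine ⟨U, hU, _, h, fun y _ hy => ?_⟩
        subst hy
        exact FiberBundle.extend_apply_self F v
      · obtain ⟨U, hU, h⟩ := FiberBundle.exists_contMDiffOn_extend (k := ∞) 𝓘(ℝ, E) F (0 : V x)
        -- Removing `p` from the neighbourhood makes the condition void, so any local section will
        -- do.
        exact ⟨U ∩ {p}ᶜ, Filter.inter_mem hU (isOpen_compl_singleton.mem_nhds hx), _,
          h.mono Set.inter_subset_left, fun y hy hyp => absurd hyp hy.2⟩
  exact ⟨s, hs p rfl⟩

end Sections

/-! ### Components of the Leibniz 2-algebra identities -/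

section LeibnizTwo

variable {A B C : Type*} [AddCommGroup A] [Module ℝ A] [AddCommGroup B] [Module ℝ B]
  [AddCommGroup C] [Module ℝ C] {d₁ : B →ₗ[ℝ] A} {d₂ : C →ₗ[ℝ] B} {c₀₀ : A →ₗ[ℝ] A →ₗ[ℝ] A}
  {c₀₁ : A →ₗ[ℝ] B →ₗ[ℝ] B} {c₁₀ : B →ₗ[ℝ] A →ₗ[ℝ] B}
  {o : MultilinearMap ℝ (fun _ : Fin 3 => A) B}

namespace IsLeibniz3

lemma jacobi2_apply {l2 : Op A B C 2} {l3 : Op A B C 3} {l4 : Op A B C 4}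
    (h : IsLeibniz3 d₁ d₂ l2 l3 l4) (x y : Tot A B C) :
    bdry (diff d₁ d₂) 0 l2 ![x, y] = 0 := by
  rw [h.jacobi2, zero_apply]

lemma d₁_c₀₁ (h : IsLeibniz3 d₁ d₂ (bilinOp c₀₀ c₀₁ c₁₀) (triOp o) 0) (x : A) (a : B) :
    d₁ (c₀₁ x a) = c₀₀ x (d₁ a) := by
  have h := h.jacobi2_apply (x, 0, 0) (0, a, 0)
  simpa [bdry_2_apply, bilinOp_apply, diff_apply, parity_apply, Prod.ext_iff, sub_eq_zero] using h

lemma c₁₀_d₁ (h : IsLeibniz3 d₁ d₂ (bilinOp c₀₀ c₀₁ c₁₀) (triOp o) 0) (a b : B) :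
    c₁₀ a (d₁ b) = c₀₁ (d₁ a) b := by
  have h := h.jacobi2_apply (0, a, 0) (0, b, 0)
  simpa [bdry_2_apply, bilinOp_apply, diff_apply, parity_apply, Prod.ext_iff,
    add_neg_eq_zero] using h

lemma d₁_o (h : IsLeibniz3 d₁ d₂ (bilinOp c₀₀ c₀₁ c₁₀) (triOp o) 0) (x y z : A) :
    d₁ (o ![x, y, z]) = c₀₀ x (c₀₀ y z) - c₀₀ (c₀₀ x y) z - c₀₀ y (c₀₀ x z) := by
  -- The arguments are written as projections so that the evaluation rules for `perm` apply.
  have h := congrFun (congrArg DFunLike.coe h.jacobi3)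
    ![proj 0 (x, 0, 0), proj 0 (y, 0, 0), proj 0 (z, 0, 0)]
  simp only [-Nat.reduceAdd, bdry_3_apply, sub_apply, comp_22_apply_0, comp_22_apply_1,
    perm_comp_22_apply_102] at h
  simpa [bilinOp_apply, triOp_apply, proj_zero_apply, proj_one_apply, diff_apply, parity_apply,
    Prod.ext_iff, trilinear_zero_left, trilinear_zero_middle, trilinear_zero_right,
    parity_pow_zero] using h

lemma o_d₁ (h : IsLeibniz3 d₁ d₂ (bilinOp c₀₀ c₀₁ c₁₀) (triOp o) 0) (x y : A) (a : B) :
    o ![x, y, d₁ a] = c₀₁ x (c₀₁ y a) - c₀₁ (c₀₀ x y) a - c₀₁ y (c₀₁ x a) := by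
  have h := congrFun (congrArg DFunLike.coe h.jacobi3)
    ![proj 0 (x, 0, 0), proj 0 (y, 0, 0), proj 1 (0, a, 0)]
  simp only [-Nat.reduceAdd, bdry_3_apply, sub_apply, comp_22_apply_0, comp_22_apply_1,
    perm_comp_22_apply_102] at h
  simpa [bilinOp_apply, triOp_apply, proj_zero_apply, proj_one_apply, diff_apply, parity_apply,
    Prod.ext_iff, trilinear_zero_left, trilinear_zero_middle, trilinear_zero_right,
    parity_pow_zero] using h

/-- This and the next identity are kept with both one-sided products; it is their comparison that
shows `D S(x, a) ∘ y = 0`. -/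
lemma o_d₁_middle (h : IsLeibniz3 d₁ d₂ (bilinOp c₀₀ c₀₁ c₁₀) (triOp o) 0) (x y : A) (a : B) :
    o ![x, d₁ a, y] = c₀₁ x (c₁₀ a y) - c₁₀ (c₀₁ x a) y - c₁₀ a (c₀₀ x y) := by
  have h := congrFun (congrArg DFunLike.coe h.jacobi3)
    ![proj 0 (x, 0, 0), proj 1 (0, a, 0), proj 0 (y, 0, 0)]
  simp only [-Nat.reduceAdd, bdry_3_apply, sub_apply, comp_22_apply_0, comp_22_apply_1,
    perm_comp_22_apply_102] at h
  simpa [bilinOp_apply, triOp_apply, proj_zero_apply, proj_one_apply, diff_apply, parity_apply,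
    Prod.ext_iff, trilinear_zero_left, trilinear_zero_middle, trilinear_zero_right,
    parity_pow_zero] using h

lemma o_d₁_left (h : IsLeibniz3 d₁ d₂ (bilinOp c₀₀ c₀₁ c₁₀) (triOp o) 0) (x y : A) (a : B) :
    o ![d₁ a, x, y] = c₁₀ a (c₀₀ x y) - c₁₀ (c₁₀ a x) y - c₀₁ x (c₁₀ a y) := by
  have h := congrFun (congrArg DFunLike.coe h.jacobi3)
    ![proj 1 (0, a, 0), proj 0 (x, 0, 0), proj 0 (y, 0, 0)]
  simp only [-Nat.reduceAdd, bdry_3_apply, sub_apply, comp_22_apply_0, comp_22_apply_1,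
    perm_comp_22_apply_102] at h
  simpa [bilinOp_apply, triOp_apply, proj_zero_apply, proj_one_apply, diff_apply, parity_apply,
    Prod.ext_iff, trilinear_zero_left, trilinear_zero_middle, trilinear_zero_right,
    parity_pow_zero] using h

lemma o_o (h : IsLeibniz3 d₁ d₂ (bilinOp c₀₀ c₀₁ c₁₀) (triOp o) 0) (x y z w : A) :
    c₁₀ (o ![x, y, z]) w + c₀₁ x (o ![y, z, w]) - c₀₁ y (o ![x, z, w])
      + c₀₁ z (o ![x, y, w]) - o ![c₀₀ x y, z, w] + o ![x, c₀₀ y z, w] - o ![y, c₀₀ x z, w]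
      - o ![x, y, c₀₀ z w] + o ![x, z, c₀₀ y w] - o ![y, z, c₀₀ x w] = 0 := by
  have h := congrFun (congrArg DFunLike.coe h.jacobi4)
    ![proj 0 (x, 0, 0), proj 0 (y, 0, 0), proj 0 (z, 0, 0), proj 0 (w, 0, 0)]
  simp only [-Nat.reduceAdd, bdry_4_apply, sub_apply, add_apply, zero_apply,
    comp_23_apply_0, comp_23_apply_1, comp_32_apply_0, comp_32_apply_1, comp_32_apply_2,
    perm_comp_23_apply_1023, perm_comp_23_apply_2013, perm_comp_32_apply_1023,
    perm_comp_32_apply_0213, perm_comp_32_apply_1203] at h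
  simpa [bilinOp_apply, triOp_apply, proj_zero_apply, diff_apply, parity_apply,
    Prod.ext_iff, eq_comm, parity_pow_zero, parity_pow_one] using h

end IsLeibniz3

end LeibnizTwo

/-! ### From CLWX 2-algebroids to the algebraic model -/

section CLWX

variable {E : Type*} [NormedAddCommGroup E] [NormedSpace ℝ E]
  {M : Type*} [TopologicalSpace M] [ChartedSpace E M] [IsManifold 𝓘(ℝ, E) ∞ M]
  {F₀ : Type*} [NormedAddCommGroup F₀] [NormedSpace ℝ F₀] [FiniteDimensional ℝ F₀]
  {F₁ : Type*} [NormedAddCommGroup F₁] [NormedSpace ℝ F₁] [FiniteDimensional ℝ F₁]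
  {E₀ : M → Type*} [∀ x, AddCommGroup (E₀ x)] [∀ x, Module ℝ (E₀ x)]
  [∀ x, TopologicalSpace (E₀ x)] [∀ x, IsTopologicalAddGroup (E₀ x)]
  [∀ x, ContinuousSMul ℝ (E₀ x)] [TopologicalSpace (TotalSpace F₀ E₀)]
  [FiberBundle F₀ E₀] [VectorBundle ℝ F₀ E₀] [ContMDiffVectorBundle ∞ F₀ E₀ 𝓘(ℝ, E)]
  {E₁ : M → Type*} [∀ x, AddCommGroup (E₁ x)] [∀ x, Module ℝ (E₁ x)]
  [∀ x, TopologicalSpace (E₁ x)] [∀ x, IsTopologicalAddGroup (E₁ x)]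
  [∀ x, ContinuousSMul ℝ (E₁ x)] [TopologicalSpace (TotalSpace F₁ E₁)]
  [FiberBundle F₁ E₁] [VectorBundle ℝ F₁ E₁] [ContMDiffVectorBundle ∞ F₁ E₁ 𝓘(ℝ, E)]

namespace CLWXData

variable (P : CLWXData E F₀ F₁ E₀ E₁)

lemma pairSec_D_apply (x : ContMDiffSection 𝓘(ℝ, E) F₀ ∞ E₀) (f : C^∞⟮𝓘(ℝ, E), M; ℝ⟯) (p : M) :
    P.pairSec x (P.D f) p = mvfderiv 𝓘(ℝ, E) f p (P.rho p (x p)) :=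
  P.pairing_D f p (x p)

lemma coe_pairSec_D (x : ContMDiffSection 𝓘(ℝ, E) F₀ ∞ E₀) (f : C^∞⟮𝓘(ℝ, E), M; ℝ⟯) :
    ⇑(P.pairSec x (P.D f)) = P.anchorDeriv x f :=
  funext fun p => P.pairSec_D_apply x f p

lemma pairSec_D_mul (x : ContMDiffSection 𝓘(ℝ, E) F₀ ∞ E₀) (f g : C^∞⟮𝓘(ℝ, E), M; ℝ⟯) :
    P.pairSec x (P.D (f * g)) = f * P.pairSec x (P.D g) + g * P.pairSec x (P.D f) := by
  ext p
  rw [ContMDiffMap.coe_add, Pi.add_apply, ContMDiffMap.coe_mul, ContMDiffMap.coe_mul,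
    Pi.mul_apply, Pi.mul_apply, pairSec_D_apply, pairSec_D_apply, pairSec_D_apply,
    ContMDiffMap.coe_mul, mvfderiv_mul (f.contMDiff.mdifferentiable (by simp) p)
      (g.contMDiff.mdifferentiable (by simp) p)]
  rfl

lemma exists_pairSec_eq_mul (f : C^∞⟮𝓘(ℝ, E), M; ℝ⟯) (a : ContMDiffSection 𝓘(ℝ, E) F₁ ∞ E₁) :
    ∃ b, ∀ x : ContMDiffSection 𝓘(ℝ, E) F₀ ∞ E₀, P.pairSec x b = f * P.pairSec x a := by
  refine ⟨⟨fun p => f p • a p, f.contMDiff.smul_section a.contMDiff⟩, fun x => ?_⟩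
  ext p
  exact (P.pairing p (x p)).map_smul (f p) (a p)

lemma pairSec_del_D (a : ContMDiffSection 𝓘(ℝ, E) F₁ ∞ E₁) (f : C^∞⟮𝓘(ℝ, E), M; ℝ⟯) :
    P.pairSec (P.delSec a) (P.D f) = 0 := by
  ext p
  rw [pairSec_D_apply]
  change mvfderiv 𝓘(ℝ, E) f p (P.rho p (P.del p (a p))) = 0
  rw [P.rho_del, map_zero]

lemma omegaSec_apply (x y z : ContMDiffSection 𝓘(ℝ, E) F₀ ∞ E₀) (p : M) :
    P.omegaSec ![x, y, z] p = P.omega p ![x p, y p, z p] :=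
  congrArg (P.omega p) (funext fun t => by fin_cases t <;> rfl)

lemma omegaSec_swap_left (x y z : ContMDiffSection 𝓘(ℝ, E) F₀ ∞ E₀) :
    P.omegaSec ![x, y, z] = -P.omegaSec ![y, x, z] := by
  ext p
  rw [ContMDiffSection.coe_neg, Pi.neg_apply, omegaSec_apply, omegaSec_apply,
    ← (P.omega p).map_swap ![y p, x p, z p] (i := 0) (j := 1) (by decide)]
  exact congrArg (P.omega p) (funext fun t => by fin_cases t <;> rfl)

lemma omegaSec_swap_right (x y z : ContMDiffSection 𝓘(ℝ, E) F₀ ∞ E₀) :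
    P.omegaSec ![x, y, z] = -P.omegaSec ![x, z, y] := by
  ext p
  rw [ContMDiffSection.coe_neg, Pi.neg_apply, omegaSec_apply, omegaSec_apply,
    ← (P.omega p).map_swap ![x p, z p, y p] (i := 1) (j := 2) (by decide)]
  exact congrArg (P.omega p) (funext fun t => by fin_cases t <;> rfl)

/-- Fibrewise non-degeneracy suffices, as every vector of `E₀` is the value of a global section. -/
lemma eq_zero_of_pairSec_right [FiniteDimensional ℝ E] [T2Space M] [SecondCountableTopology M]
    (a : ContMDiffSection 𝓘(ℝ, E) F₁ ∞ E₁)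
    (h : ∀ x : ContMDiffSection 𝓘(ℝ, E) F₀ ∞ E₀, P.pairSec x a = 0) : a = 0 := by
  ext p
  refine P.nondeg_right p _ fun u => ?_
  obtain ⟨x, rfl⟩ := exists_section_eq (E := E) F₀ p u
  exact congrArg (fun f : C^∞⟮𝓘(ℝ, E), M; ℝ⟯ => f p) (h x)

lemma eq_zero_of_pairSec_left [FiniteDimensional ℝ E] [T2Space M] [SecondCountableTopology M]
    (x : ContMDiffSection 𝓘(ℝ, E) F₀ ∞ E₀)
    (h : ∀ a : ContMDiffSection 𝓘(ℝ, E) F₁ ∞ E₁, P.pairSec x a = 0) : x = 0 := by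
  ext p
  refine P.nondeg_left p _ fun u => ?_
  obtain ⟨a, rfl⟩ := exists_section_eq (E := E) F₁ p u
  exact congrArg (fun f : C^∞⟮𝓘(ℝ, E), M; ℝ⟯ => f p) (h a)

variable {P}

namespace IsCLWX2

/-- The axiom on `e ∘ e` for `e = x + a`, where `S(e, e) = 2 S(x, a)`. -/
lemma symm (hP : P.IsCLWX2) (x : ContMDiffSection 𝓘(ℝ, E) F₀ ∞ E₀)
    (a : ContMDiffSection 𝓘(ℝ, E) F₁ ∞ E₁) :
    P.circ₁₀ a x = P.D (P.pairSec x a) - P.circ₀₁ x a := by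
  have h := congrArg Prod.snd (hP.circ_self (x, a))
  change P.circ₀₁ x a + P.circ₁₀ a x = (1 / 2 : ℝ) • P.D (P.pairSec x a + P.pairSec x a) at h
  rw [eq_sub_iff_add_eq', h, map_add]
  module

lemma pairSec_del (hP : P.IsCLWX2) (a b : ContMDiffSection 𝓘(ℝ, E) F₁ ∞ E₁) :
    P.pairSec (P.delSec a) b = P.pairSec (P.delSec b) a := by
  have h := hP.S_bd (0, a) (0, b)
  simpa [CLWXData.S, CLWXData.bd] using h

lemma anchor (hP : P.IsCLWX2) (x y : ContMDiffSection 𝓘(ℝ, E) F₀ ∞ E₀)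
    (a : ContMDiffSection 𝓘(ℝ, E) F₁ ∞ E₁) :
    P.pairSec y (P.circ₀₁ x a) = P.pairSec x (P.D (P.pairSec y a)) - P.pairSec (P.circ₀₀ x y) a := by
  have h := hP.anchor_S (x, 0) (y, 0) (0, a)
  simp only [CLWXData.S, CLWXData.circ, map_zero, LinearMap.zero_apply, add_zero, zero_add] at h
  rw [← P.coe_pairSec_D] at h
  rw [eq_sub_iff_add_eq']
  exact (DFunLike.coe_injective h).symm

lemma pairSec_omegaSec (hP : P.IsCLWX2) (x y z w : ContMDiffSection 𝓘(ℝ, E) F₀ ∞ E₀) :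
    P.pairSec w (P.omegaSec ![x, y, z]) = -P.pairSec z (P.omegaSec ![x, y, w]) := by
  have h := hP.S_Om (x, 0) (y, 0) (z, 0) (w, 0)
  simpa [CLWXData.S, CLWXData.Om] using h

/-- `D S(x, a)` is `x ∘ a + a ∘ x`. In `Ω(x, ∂a, y) + Ω(∂a, x, y) = 0` all terms cancel except `-(x
∘ a) ∘ y - (a ∘ x) ∘ y`. -/
lemma circ₁₀_D_pairSec (hP : P.IsCLWX2) (x y : ContMDiffSection 𝓘(ℝ, E) F₀ ∞ E₀)
    (a : ContMDiffSection 𝓘(ℝ, E) F₁ ∞ E₁) : P.circ₁₀ (P.D (P.pairSec x a)) y = 0 := by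
  have h := P.omegaSec_swap_left x (P.delSec a) y
  rw [hP.leibniz2.o_d₁_middle, hP.leibniz2.o_d₁_left] at h
  have h' : P.D (P.pairSec x a) = P.circ₀₁ x a + P.circ₁₀ a x := by rw [hP.symm]; abel
  rw [h', map_add, LinearMap.add_apply]
  rw [← sub_eq_zero] at h
  rw [← neg_eq_zero, ← h]
  abel

/-- The right side is `([ρ(y), ρ(z)] + ρ(z ∘ y)) f`, the failure of the anchor to respect brackets.
In particular it is a derivation in `f`. -/
lemma pairSec_circ₁₀_D (hP : P.IsCLWX2) (y z : ContMDiffSection 𝓘(ℝ, E) F₀ ∞ E₀)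
    (f : C^∞⟮𝓘(ℝ, E), M; ℝ⟯) : P.pairSec y (P.circ₁₀ (P.D f) z) =
      P.pairSec y (P.D (P.pairSec z (P.D f))) - P.pairSec z (P.D (P.pairSec y (P.D f)))
        + P.pairSec (P.circ₀₀ z y) (P.D f) := by
  rw [hP.symm, map_sub, hP.anchor]
  abel

lemma pairSec_circ₁₀_D_mul (hP : P.IsCLWX2) (y z : ContMDiffSection 𝓘(ℝ, E) F₀ ∞ E₀)
    (f g : C^∞⟮𝓘(ℝ, E), M; ℝ⟯) : P.pairSec y (P.circ₁₀ (P.D (f * g)) z) =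
      f * P.pairSec y (P.circ₁₀ (P.D g) z) + g * P.pairSec y (P.circ₁₀ (P.D f) z) := by
  simp only [hP.pairSec_circ₁₀_D, P.pairSec_D_mul, map_add]
  ring

variable [FiniteDimensional ℝ E] [T2Space M] [SecondCountableTopology M]

/-- For `h = S(y, Df ∘ z)`, the derivation `g ↦ S(y, Dg ∘ z)` kills `h` and `f h`, both being values
of the pairing, while the product rule gives `f · 0 + h · h` on `f h`. So `h² = 0`, and `h = 0`
pointwise. -/
lemma circ₁₀_D (hP : P.IsCLWX2) (f : C^∞⟮𝓘(ℝ, E), M; ℝ⟯)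
    (z : ContMDiffSection 𝓘(ℝ, E) F₀ ∞ E₀) : P.circ₁₀ (P.D f) z = 0 := by
  refine P.eq_zero_of_pairSec_right _ fun y => ?_
  obtain ⟨b, hb⟩ := P.exists_pairSec_eq_mul f (P.circ₁₀ (P.D f) z)
  have h := hP.pairSec_circ₁₀_D_mul y z f (P.pairSec y (P.circ₁₀ (P.D f) z))
  rw [← hb, hP.circ₁₀_D_pairSec, hP.circ₁₀_D_pairSec, map_zero, mul_zero, zero_add] at h
  ext p
  exact mul_self_eq_zero.1 (congrArg (fun f : C^∞⟮𝓘(ℝ, E), M; ℝ⟯ => f p) h).symm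

lemma delSec_D (hP : P.IsCLWX2) (f : C^∞⟮𝓘(ℝ, E), M; ℝ⟯) : P.delSec (P.D f) = 0 :=
  P.eq_zero_of_pairSec_left _ fun a => by rw [hP.pairSec_del, P.pairSec_del_D]

/-- The algebraic structure on the sections of a CLWX 2-algebroid. -/
def algebra (hP : P.IsCLWX2) : CLWXAlgebra (ContMDiffSection 𝓘(ℝ, E) F₀ ∞ E₀)
    (ContMDiffSection 𝓘(ℝ, E) F₁ ∞ E₁) C^∞⟮𝓘(ℝ, E), M; ℝ⟯ where
  d₁ := P.delSec
  d₂ := P.D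
  c₀₀ := P.circ₀₀
  c₀₁ := P.circ₀₁
  c₁₀ := P.circ₁₀
  s := P.pairSec
  o := P.omegaSec
  d₁_d₂ := hP.delSec_D
  skew := P.circ₀₀_skew
  symm := hP.symm
  s_d₁ := hP.pairSec_del
  s_d₁_d₂ := P.pairSec_del_D
  anchor := hP.anchor
  c₁₀_d₂ := hP.circ₁₀_D
  o_swap_left := P.omegaSec_swap_left
  o_swap_right := P.omegaSec_swap_right
  s_o := hP.pairSec_omegaSec
  d₁_c₀₁ := hP.leibniz2.d₁_c₀₁
  c₁₀_d₁ := hP.leibniz2.c₁₀_d₁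
  d₁_o := hP.leibniz2.d₁_o
  o_d₁ := hP.leibniz2.o_d₁
  o_o := hP.leibniz2.o_o

end IsCLWX2

end CLWXData

end CLWX

/-! ### Skew-symmetrization for CLWX 2-algebroids -/

section CLWX

variable {E : Type*} [NormedAddCommGroup E] [NormedSpace ℝ E] [FiniteDimensional ℝ E]
  {M : Type*} [TopologicalSpace M] [T2Space M] [SecondCountableTopology M]
  [ChartedSpace E M] [IsManifold 𝓘(ℝ, E) ∞ M]
  {F₀ : Type*} [NormedAddCommGroup F₀] [NormedSpace ℝ F₀] [FiniteDimensional ℝ F₀]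
  {F₁ : Type*} [NormedAddCommGroup F₁] [NormedSpace ℝ F₁] [FiniteDimensional ℝ F₁]
  {E₀ : M → Type*} [∀ x, AddCommGroup (E₀ x)] [∀ x, Module ℝ (E₀ x)]
  [∀ x, TopologicalSpace (E₀ x)] [∀ x, IsTopologicalAddGroup (E₀ x)]
  [∀ x, ContinuousSMul ℝ (E₀ x)] [TopologicalSpace (TotalSpace F₀ E₀)]
  [FiberBundle F₀ E₀] [VectorBundle ℝ F₀ E₀] [ContMDiffVectorBundle ∞ F₀ E₀ 𝓘(ℝ, E)]
  {E₁ : M → Type*} [∀ x, AddCommGroup (E₁ x)] [∀ x, Module ℝ (E₁ x)]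
  [∀ x, TopologicalSpace (E₁ x)] [∀ x, IsTopologicalAddGroup (E₁ x)]
  [∀ x, ContinuousSMul ℝ (E₁ x)] [TopologicalSpace (TotalSpace F₁ E₁)]
  [FiberBundle F₁ E₁] [VectorBundle ℝ F₁ E₁] [ContMDiffVectorBundle ∞ F₁ E₁ 𝓘(ℝ, E)]

namespace CLWXData

variable {P : CLWXData E F₀ F₁ E₀ E₁} (hP : P.IsCLWX2)

namespace IsCLWX2

lemma skewSymm_eq : P.weakLie3.skewSymm =
    ⟨P.delSec, P.D, hP.algebra.lie2, hP.algebra.lie3, hP.algebra.lie4⟩ :=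
  hP.algebra.skewSymm_eq

lemma isLiuSheng : P.IsLiuSheng
    ⟨P.delSec, P.D, hP.algebra.lie2, hP.algebra.lie3, hP.algebra.lie4⟩ where
  d₁_eq := rfl
  d₂_eq := rfl
  l2_00 x y := by simp [CLWXAlgebra.lie2_apply, algebra]
  l2_01 x a := by
    simp [CLWXAlgebra.lie2_apply, CLWXAlgebra.bracket_apply, lsBracket, algebra]
  l2_02 x f := by simp [CLWXAlgebra.lie2_apply, algebra]
  l2_11 a b := by simp [CLWXAlgebra.lie2_apply, algebra]
  l3_000 x y z := by simp [CLWXAlgebra.lie3_apply, algebra]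
  l3_001 x y a := by
    simp [CLWXAlgebra.lie3_apply, CLWXAlgebra.tripleForm_apply, CLWXAlgebra.bracket_apply,
      lsBracket, algebra, trilinear_zero_right]
  l4_0000 x y z w := by simp [CLWXAlgebra.lie4_apply, algebra]
  homog2 := hP.algebra.isLie3.homog2
  homog3 := hP.algebra.isLie3.homog3
  homog4 := hP.algebra.isLie3.homog4
  skew2 := hP.algebra.isLie3.skew2
  skew3 := hP.algebra.isLie3.skew3
  skew4 := hP.algebra.isLie3.skew4

end IsCLWX2

end CLWXData

end CLWX

end WeakLie

end

theorem mainTheorem8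
    {E : Type*} [NormedAddCommGroup E] [NormedSpace ℝ E] [FiniteDimensional ℝ E]
    {M : Type*} [TopologicalSpace M] [T2Space M] [SecondCountableTopology M]
    [ChartedSpace E M] [IsManifold 𝓘(ℝ, E) ∞ M]
    {F₀ : Type*} [NormedAddCommGroup F₀] [NormedSpace ℝ F₀] [FiniteDimensional ℝ F₀]
    {F₁ : Type*} [NormedAddCommGroup F₁] [NormedSpace ℝ F₁] [FiniteDimensional ℝ F₁]
    {E₀ : M → Type*} [∀ x, AddCommGroup (E₀ x)] [∀ x, Module ℝ (E₀ x)]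
    [∀ x, TopologicalSpace (E₀ x)] [∀ x, IsTopologicalAddGroup (E₀ x)]
    [∀ x, ContinuousSMul ℝ (E₀ x)] [TopologicalSpace (TotalSpace F₀ E₀)]
    [FiberBundle F₀ E₀] [VectorBundle ℝ F₀ E₀] [ContMDiffVectorBundle ∞ F₀ E₀ 𝓘(ℝ, E)]
    {E₁ : M → Type*} [∀ x, AddCommGroup (E₁ x)] [∀ x, Module ℝ (E₁ x)]
    [∀ x, TopologicalSpace (E₁ x)] [∀ x, IsTopologicalAddGroup (E₁ x)]
    [∀ x, ContinuousSMul ℝ (E₁ x)] [TopologicalSpace (TotalSpace F₁ E₁)]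
    [FiberBundle F₁ E₁] [VectorBundle ℝ F₁ E₁] [ContMDiffVectorBundle ∞ F₁ E₁ 𝓘(ℝ, E)]
    (P : WeakLie.CLWXData E F₀ F₁ E₀ E₁) (hP : P.IsCLWX2) :
    P.weakLie3.IsWeakLie3 ∧
    P.weakLie3.skewSymm.IsLie3 ∧
    P.weakLie3.skewSymm.l2 = (1 / 2 : ℝ) • (P.circOp - WeakLie.perm (List.formPerm [0, 1]) P.circOp
      - WeakLie.comp P.SOp 0 1 P.DOp + WeakLie.comp P.SOp 1 1 P.DOp) ∧
    P.weakLie3.skewSymm.l3 = P.OmOp - (1 / 12 : ℝ) • WeakLie.alt (WeakLie.comp P.SOp 0 0 P.circOp) ∧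
    P.weakLie3.skewSymm.l4 = WeakLie.comp P.SOp 0 1 P.OmOp ∧
    P.IsLiuSheng P.weakLie3.skewSymm := by
  -- From here on the skew-symmetrization is replaced by its closed form.
  rw [hP.skewSymm_eq]
  refine ⟨hP.algebra.isWeakLie3, hP.algebra.isLie3, hP.algebra.lie2_eq, ?_, rfl, hP.isLiuSheng⟩
  -- The operations of the algebraic model are by definition those of `P`.
  have ho : WeakLie.triOp hP.algebra.o = P.OmOp := rfl
  have hs : WeakLie.pairOp hP.algebra.s = P.SOp := rfl
  have hc : WeakLie.bilinOp hP.algebra.c₀₀ hP.algebra.c₀₁ hP.algebra.c₁₀ = P.circOp := rfl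
  dsimp only
  rw [hP.algebra.lie3_eq, ho, hs, hc]
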